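/- Let $k$ be a finite field and $K$ a function field in one variable over $k$, of characteristic different from $3$. Let $L=K(y)$ be a cubic extension of $K$ in which $y$ has minimal polynomial $f(X)=X^3-3X-a$, $a\in K$. Let $r\in\overline K$ (an algebraic closure of $K$ containing $L$) be a root of the quadratic resolvent $R(X)=X^2+3aX+(-27+9a^2)$ of $f$. Let $\mathfrak p$ be a place of $K$, with normalised valuation $v_{\mathfrak p}$ and residue field $k(\mathfrak p)$. For a place $\mathfrak P$ of an extension above $\mathfrak p$ let $e(\mathfrak P|\mathfrak p)$ and $f(\mathfrak P|\mathfrak p)$ be the ramification index and the inertia degree; the signature of $\mathfrak p$ in $L$ is the list $(e(\mathfrak P_1|\mathfrak p),f(\mathfrak P_1|\mathfrak p);\dots;e(\mathfrak P_n|\mathfrak p),f(\mathfrak P_n|\mathfrak p))$ over the distinct places $\mathfrak P_1,\dots,\mathfrak P_n$ of $L$ above $\mathfrak p$, up to order. In a finite extension $M/K$, $\mathfrak p$ is completely split if there are $[M:K]$ places above it; inert if there is a single place above it, of inertia degree $[M:K]$; ramified if some place above it has ramification index $>1$; fully ramified if some place above it has ramification index $[M:K]$. For $x\in K$, $\mathcal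 O_{L,x}$ denotes the integral closure of $k[x]$ in $L$; ideals $\mathfrak p\mathcal O_{L,x}$ are generated by $\mathfrak p\cap\mathcal O_{K,x}$, and a place of $L$ above $\mathfrak p$ is identified with its prime ideal in $\mathcal O_{L,x}$. There is $x\in K$, transcendental over $k$, with $v_{\mathfrak p}(x)\ge 0$ (so that $\mathfrak p$ is a finite place over $k(x)$) and with $\mathcal O_{L,x}$ a Dedekind domain. For every such $x$ the following holds. 1. Suppose $v_{\mathfrak p}(a)\ge 0$. (a) $\mathfrak p$ is completely split in $L$ if and only if either $f\equiv (X-\alpha)(X-\beta)(X-\gamma) \bmod \mathfrak p$ with $\alpha,\beta,\gamma\in k(\mathfrak p)$ distinct, or $f\equiv (X-\alpha)(X-\beta)^2\bmod\mathfrak p$ with $\alpha,\beta\in k(\mathfrak p)$ and either $r\in K$, or $r\notin K$ and $\mathfrak p$ is completely split in $K(r)$. This is exactly the case of signature $(1,1;1,1;1,1)$. (b) $\mathfrak p$ is inert in $L$ if and only if $f$ is irreducible modulo $\mathfrak p$. This is exactly the case of signature $(1,3)$. (c) $\mathfrak p\mathcal O_{L,x}=\mathfrak P_1\mathfrak P_2$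 with $\mathfrak P_1\ne\mathfrak P_2$ places of $L$ above $\mathfrak p$ if and only if either $f\equiv (X-\alpha)Q(X)\bmod\mathfrak p$ with $\alpha\in k(\mathfrak p)$ and $Q$ an irreducible quadratic polynomial over $k(\mathfrak p)$, or $r\notin K$, $f\equiv(X-\alpha)(X-\beta)^2\bmod\mathfrak p$ with $\alpha,\beta\in k(\mathfrak p)$ and $\mathfrak p$ is inert in $K(r)$. In this case $r\notin K$ and, up to relabelling, $f(\mathfrak P_1|\mathfrak p)=1$ and $\mathfrak P_1$ is inert in $L(r)$, while $f(\mathfrak P_2|\mathfrak p)=2$ and $\mathfrak P_2$ is completely split in $L(r)$. This is exactly the case of signature $(1,1;1,2)$. (d) $\mathfrak p\mathcal O_{L,x}=\mathfrak P_1^2\mathfrak P_2$ with $\mathfrak P_1\neq\mathfrak P_2$ places of $L$ above $\mathfrak p$ if and only if $r\notin K$, $f\equiv (X-\alpha)(X-\beta)^2\bmod\mathfrak p$ with $\alpha,\beta\in k(\mathfrak p)$ and $\mathfrak p$ is ramified in $K(r)$. In this case $f(\mathfrak P_1|\mathfrak p)=f(\mathfrak P_2|\mathfrak p)=1$, $\mathfrak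 P_1$ is completely split in $L(r)$ and $\mathfrak P_2$ is ramified in $L(r)$. This is exactly the case of signature $(2,1;1,1)$. 2. Suppose $v_{\mathfrak p}(a)<0$, and let $\pi\in K$ be any element with $v_{\mathfrak p}(\pi)=1$. Put $u=\pi^{-v_{\mathfrak p}(a)}a \bmod \mathfrak p\in k(\mathfrak p)$. (a) $\mathfrak p\mathcal O_{L,x}=\mathfrak P^3$ for a place $\mathfrak P$ of $L$ above $\mathfrak p$ if and only if $\gcd(v_{\mathfrak p}(a),3)=1$; equivalently $\mathfrak p$ is fully ramified in $L$. This is exactly the case of signature $(3,1)$. (b) $\mathfrak p$ is completely split in $L$ if and only if $3\mid v_{\mathfrak p}(a)$, $|k(\mathfrak p)|\equiv 1 \bmod 3$ and $u^{(|k(\mathfrak p)|-1)/3}=1$. This is exactly the case of signature $(1,1;1,1;1,1)$. (c) $\mathfrak p$ is inert in $L$ if and only if $3\mid v_{\mathfrak p}(a)$, $|k(\mathfrak p)|\equiv 1\bmod 3$ and $u^{(|k(\mathfrak p)|-1)/3}=\xi^i$ for some $i\in\{1,2\}$, where $\xi\in k(\mathfrak p)$ is a primitive third root of unity. This is exactly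 the case of signature $(1,3)$. (d) $\mathfrak p\mathcal O_{L,x}=\mathfrak P_1\mathfrak P_2$ with $\mathfrak P_1\ne\mathfrak P_2$ places of $L$ above $\mathfrak p$ if and only if $3\mid v_{\mathfrak p}(a)$ and $|k(\mathfrak p)|\equiv -1\bmod 3$. In this case $r\notin K$ and, up to relabelling, $f(\mathfrak P_1|\mathfrak p)=1$ and $\mathfrak P_1$ is inert in $L(r)$, while $f(\mathfrak P_2|\mathfrak p)=2$ and $\mathfrak P_2$ is completely split in $L(r)$. This is exactly the case of signature $(1,1;1,2)$. -/

import Mathlib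

open Polynomial IntermediateField

noncomputable section

/-- `K` is an algebraic function field (of one variable) over `k`: for some `t ∈ K` transcendental
over `k`, the extension `K / k(t)` is finite. -/
def IsFunctionField (k K : Type*) [Field k] [Field K] [Algebra k K] : Prop :=
  ∃ t : K, Transcendental k t ∧ FiniteDimensional k⟮t⟯ K

/-- A place of a field `K`, given by its valuation ring: a discrete valuation ring with fraction
field `K`. When `K` is a function field over a finite field `k`, such a ring contains `k`
automatically, since the nonzero elements of `k` are roots of unity. -/
structure Place (K : Type*) [Field K] where
  /-- The valuation ring of the place. -/
  ring : ValuationSubring K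
  isDVR : IsDiscreteValuationRing ring

attribute [instance] Place.isDVR

namespace Place

variable {K : Type*} [Field K]

/-- The normalised discrete valuation `v_𝔭 : K^× → ℤ` (with the convention `v_𝔭(0) = 0`). -/
def ord (p : Place K) (z : K) : ℤ :=
  -WithZero.log ((IsDiscreteValuationRing.maximalIdeal p.ring).valuation K z)

/-- The residue field `k(𝔭)`. -/
abbrev ResidueField (p : Place K) : Type _ := IsLocalRing.ResidueField p.ring

open scoped Classical in
/-- Reduction modulo `𝔭` of an element of the valuation ring (and `0` on other elements). -/
def reduce (p : Place K) (z : K) : p.ResidueField :=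
  if h : z ∈ p.ring then IsLocalRing.residue p.ring ⟨z, h⟩ else 0

/-- The places of `L` above the place `p` of `K`. -/
def Above (p : Place K) (L : Type*) [Field L] [Algebra K L] : Type _ :=
  {P : Place L // P.ring.comap (algebraMap K L) = p.ring}

/-- The centre `R ∩ 𝔪_𝔓` of the place `P` on a ring `R`, as an ideal of `R`. (The set below is
already an ideal as soon as the image of `R` lies in the valuation ring of `P`.) -/
def centre (P : Place K) (R : Type*) [CommRing R] [Algebra R K] : Ideal R :=
  Ideal.span {z : R | P.ring.valuation (algebraMap R K z) < 1}

namespace Above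

variable {p : Place K} {L : Type*} [Field L] [Algebra K L]

theorem mem_iff (P : p.Above L) (z : K) : algebraMap K L z ∈ P.1.ring ↔ z ∈ p.ring := by
  rw [← ValuationSubring.mem_comap, P.2]

/-- The inclusion of valuation rings of a place and a place above it. -/
def ringHom (P : p.Above L) : p.ring →+* P.1.ring where
  toFun z := ⟨algebraMap K L z, (P.mem_iff z).2 z.2⟩
  map_one' := Subtype.ext (by simp)
  map_mul' _ _ := Subtype.ext (by simp)
  map_zero' := Subtype.ext (by simp)
  map_add' _ _ := Subtype.ext (by simp)

instance isLocalHom_ringHom (P : p.Above L) : IsLocalHom P.ringHom where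
  map_nonunit z hz := by
    obtain ⟨w, hw⟩ := hz.exists_right_inv
    have hw' : algebraMap K L z * (w : L) = 1 := congrArg Subtype.val hw
    have hinv : (z : K)⁻¹ ∈ p.ring := by
      rw [← P.mem_iff, map_inv₀, inv_eq_of_mul_eq_one_right hw']
      exact w.2
    have hz0 : (z : K) ≠ 0 := by
      intro h0
      rw [h0, map_zero, zero_mul] at hw'
      exact zero_ne_one hw'
    exact IsUnit.of_mul_eq_one (⟨(z : K)⁻¹, hinv⟩ : p.ring) (Subtype.ext (mul_inv_cancel₀ hz0))

/-- The inertia degree `f(𝔓|𝔭) = [k(𝔓) : k(𝔭)]`. -/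
def inertiaDeg (P : p.Above L) : ℕ :=
  letI := (IsLocalRing.ResidueField.map P.ringHom).toAlgebra
  Module.finrank p.ResidueField P.1.ResidueField

/-- The ramification index `e(𝔓|𝔭)`: the unique positive integer `e` such that
`v_𝔓(z) = e v_𝔭(z)` for all `z ∈ K`. -/
def ramificationIdx (P : p.Above L) : ℕ :=
  sInf {e : ℕ | 0 < e ∧ ∀ z : K, P.1.ord (algebraMap K L z) = e * p.ord z}

end Above

variable (p : Place K) (L : Type*) [Field L] [Algebra K L]

/-- The signature of `p` in `L` is `s = (e₁, f₁; …; e_n, f_n)`: the places of `L` above `p` can be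
enumerated, without repetition, as `𝔓₁, …, 𝔓_n` with `e(𝔓ᵢ|𝔭) = eᵢ` and `f(𝔓ᵢ|𝔭) = fᵢ`. -/
def HasSignature (s : List (ℕ × ℕ)) : Prop :=
  ∃ P : Fin s.length ≃ p.Above L,
    ∀ i, ((P i).ramificationIdx, (P i).inertiaDeg) = s.get i

/-- `p` splits completely in `L`: there are exactly `[L : K]` places of `L` above `p`. -/
def IsCompletelySplit : Prop := Nat.card (p.Above L) = Module.finrank K L

/-- `p` is inert in `L`: there is only one place of `L` above `p`, and its inertia degree is
`[L : K]`. -/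
def IsInert : Prop :=
  ∃ P : p.Above L, (∀ Q : p.Above L, Q = P) ∧ P.inertiaDeg = Module.finrank K L

/-- `p` is ramified in `L`: some place above `p` has ramification index greater than `1`. -/
def IsRamified : Prop := ∃ P : p.Above L, 1 < P.ramificationIdx

/-- `p` is fully ramified in `L`: some place above `p` has ramification index `[L : K]`. -/
def IsFullyRamified : Prop := ∃ P : p.Above L, P.ramificationIdx = Module.finrank K L

end Place

/-- For `x ∈ K` and an extension `L / K`, the ring `𝒪_{L,x}`: the integral closure of `k[x]`
in `L`. -/
abbrev IntClosure (k : Type*) {K : Type*} [Field k] [Field K] [Algebra k K] (x : K)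
    (L : Type*) [Field L] [Algebra K L] : Type _ :=
  ↥(integralClosure (Algebra.adjoin k {x}) L)

namespace Place

variable {K : Type*} [Field K]

/-- The ideal `𝔭 𝒪_{L,x}` generated in `𝒪_{L,x}` by the prime `𝔭 ∩ 𝒪_{K,x}` of `𝒪_{K,x}`. -/
def extendedIdeal (p : Place K) (k : Type*) [Field k] [Algebra k K] (x : K)
    (L : Type*) [Field L] [Algebra K L] : Ideal (IntClosure k x L) :=
  Ideal.span {z | ∃ w : IntClosure k x K,
    w ∈ p.centre (IntClosure k x K) ∧ algebraMap K L (w : K) = (z : L)}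

/-- The prime ideal of `𝒪_{L,x}` attached to a place of `L`. -/
def Above.primeIdeal {p : Place K} {L : Type*} [Field L] [Algebra K L] (P : p.Above L)
    (k : Type*) [Field k] [Algebra k K] (x : K) : Ideal (IntClosure k x L) :=
  P.1.centre (IntClosure k x L)

/-- The element `x ∈ K \ k` is such that `𝔭` is a finite place over `k(x)` (it does not lie above
the pole of `x`) and the integral closure of `k[x]` in `L` is a Dedekind domain. -/
def IsFiniteFor (p : Place K) (k : Type*) [Field k] [Algebra k K] (x : K)
    (L : Type*) [Field L] [Algebra K L] : Prop :=
  Transcendental k x ∧ x ∈ p.ring ∧ IsDedekindDomain (IntClosure k x L)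

end Place

/-- The cubic polynomial `X³ - 3X - a`. -/
def cubicPoly {R : Type*} [CommRing R] (a : R) : R[X] := X ^ 3 - 3 * X - C a

end

/-! The decomposition of 𝔭 in `L` is local: the places above 𝔭 are the nonzero primes of the
integral closure in `L` of the valuation ring of 𝔭 (`equivHeightOneSpectrum`). Hence ∑ e f = 3, and
only five signatures are possible (`hasSignature_of_finrank_eq_three`). They exclude one another, so
it suffices to find out which one each condition on `a` forces.

The main tool is a form of Kummer's theorem, `exists_equiv_of_dvd`: pairwise coprime irreducible
factors of the reduced minimal polynomial, of total degree [L : K], account for all places and show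
them unramified. For integral `a` this settles the irreducible case, the case of a linear times an
irreducible quadratic factor, and the case of three distinct roots. For a pole of `a` of order 3m
the same tool applies to π^m y, whose minimal polynomial reduces to X³ - u; its factorisation is a
question about cubes in a finite field. If the order of the pole is prime to 3, then v(a) = 3 v(y)
at every place above 𝔭, so 3 divides e.

What remains is a double root β modulo 𝔭. Characteristic different from 3 gives α = -2β and β² = 1,
so α ≠ β; there are at least two places, and three signatures survive. The quadratic resolvent
separates them. The field L(r) is Galois over K, because r together with y determines the other two
roots (`exists_second_root`). If r lies in K, then L/K is Galois and mixed signatures are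
impossible. Otherwise L(r)/K has degree 6, and the uniformity of e and f over 𝔭 in L(r) turns
(1,1;1,2) into inertia in K(r) and (2,1;1,1) into ramification in K(r) (`resolvent_decomposition`).
In the remaining case, at a place of L where y reduces to β the other two roots of f reduce to the
distinct elements α and β, so that place splits in L(r); this forces 𝔭 to split in K(r)
(`isCompletelySplit_resolvent_of_double`).

The statements on ideals of 𝒪_{L,x} hold for every admissible x, also when K/k(x) is inseparable.
They rest on `ValuationSubring.exists_mul_eq`: elements of a valuation ring containing k[x] are
fractions of integral elements with unit denominator. So the primes over the centre of 𝔭 are the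
centres of the places above it, and the extended ideal is the product of their powers with exponents
e (`extendedCentre_eq_prod`). -/

noncomputable section

/-! ### Places, normalised valuations and primes of Dedekind domains. -/

open WithZero IsDedekindDomain

/-- A surjective valuation to `ℤᵐ⁰` on a field is determined by its valuation ring. -/
theorem Valuation.eq_of_surjective_of_le_one_iff {F : Type*} [Field F] {v w : Valuation F ℤᵐ⁰}
    (hv : Function.Surjective v) (hw : Function.Surjective w) (h : ∀ z, v z ≤ 1 ↔ w z ≤ 1) :
    v = w := by
  have hE : v.IsEquiv w := Valuation.isEquiv_iff_val_le_one.2 fun {z} => h z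
  have h1 : ∀ z, v z = 1 → w z = 1 := fun z hz => (hE.eq_one_iff_eq_one).1 hz
  have h0 : ∀ z, z ≠ 0 → ∃ n : ℤ, v z = exp n := fun z hz =>
    ⟨log (v z), (exp_log ((Valuation.ne_zero_iff _).2 hz)).symm⟩
  have h0' : ∀ z, z ≠ 0 → ∃ n : ℤ, w z = exp n := fun z hz =>
    ⟨log (w z), (exp_log ((Valuation.ne_zero_iff _).2 hz)).symm⟩
  obtain ⟨π, hπ⟩ := hv (exp 1)
  have hπ0 : π ≠ 0 := by rintro rfl; exact exp_ne_zero (hπ.symm.trans (map_zero _))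
  obtain ⟨m, hm⟩ := h0' π hπ0
  -- Dividing z by a power of π makes it a unit for v, hence for w; so w is v with exponents
  -- multiplied by m, and surjectivity of w leaves m = 1.
  have key : ∀ z (n : ℤ), v z = exp n → w z = exp (m * n) := by
    intro z n hz
    have : v (z * (π ^ n)⁻¹) = 1 := by
      rw [map_mul, map_inv₀, map_zpow₀, hπ, hz, ← exp_zsmul]
      simp
    have := h1 _ this
    rw [map_mul, map_inv₀, map_zpow₀, hm, ← exp_zsmul,
      mul_inv_eq_one₀ exp_ne_zero] at this
    rw [this]; congr 1; simp [mul_comm]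
  have hm0 : 0 < m := by
    have : 1 < w π := by
      rw [← hE.one_lt_iff_one_lt, hπ, ← exp_zero, exp_lt_exp]; norm_num
    rwa [hm, ← exp_zero, exp_lt_exp] at this
  obtain ⟨ρ, hρ⟩ := hw (exp 1)
  have hρ0 : ρ ≠ 0 := by rintro rfl; exact exp_ne_zero (hρ.symm.trans (map_zero _))
  obtain ⟨n, hn⟩ := h0 ρ hρ0
  have hmn : m * n = 1 := by
    have := key ρ n hn
    rw [hρ, exp_inj] at this
    exact this.symm
  have hm1 : m = 1 := Int.eq_one_of_mul_eq_one_right hm0.le hmn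
  ext z
  rcases eq_or_ne z 0 with rfl | hz
  · simp
  · obtain ⟨n, hn⟩ := h0 z hz
    rw [hn, key z n hn, hm1, one_mul]

namespace Place

variable {K : Type*} [Field K] (p : Place K)

/-- The multiplicative normalised valuation attached to a place. -/
abbrev val : Valuation K ℤᵐ⁰ := (IsDiscreteValuationRing.maximalIdeal p.ring).valuation K

theorem val_le_one_iff {z : K} : p.val z ≤ 1 ↔ z ∈ p.ring := by
  constructor
  · intro h
    obtain ⟨a, rfl⟩ := IsDiscreteValuationRing.exists_lift_of_le_one h
    exact a.2
  · intro h
    exact HeightOneSpectrum.valuation_le_one (K := K) _ (⟨z, h⟩ : p.ring)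

theorem val_surjective : Function.Surjective p.val :=
  HeightOneSpectrum.valuation_surjective _ _

theorem val_isEquiv : p.val.IsEquiv p.ring.valuation :=
  Valuation.isEquiv_iff_val_le_one.2 fun {z} => by
    rw [p.val_le_one_iff, ValuationSubring.valuation_le_one_iff]

theorem val_lt_one_iff {z : K} : p.val z < 1 ↔ p.ring.valuation z < 1 :=
  p.val_isEquiv.lt_one_iff_lt_one

theorem ord_def (z : K) : p.ord z = -log (p.val z) := rfl

theorem val_eq_exp {z : K} (hz : z ≠ 0) : p.val z = exp (-p.ord z) := by
  rw [ord_def, neg_neg, exp_log ((Valuation.ne_zero_iff _).2 hz)]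

theorem ord_eq_iff {z : K} (hz : z ≠ 0) (n : ℤ) : p.ord z = n ↔ p.val z = exp (-n) := by
  rw [val_eq_exp p hz, exp_inj, neg_inj]

@[simp] theorem ord_zero : p.ord 0 = 0 := by simp [ord_def]

@[simp] theorem ord_one : p.ord 1 = 0 := by simp [ord_def]

theorem ord_mul {z w : K} (hz : z ≠ 0) (hw : w ≠ 0) : p.ord (z * w) = p.ord z + p.ord w := by
  rw [ord_def, map_mul, log_mul ((Valuation.ne_zero_iff _).2 hz)
    ((Valuation.ne_zero_iff _).2 hw), ord_def, ord_def]
  ring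

theorem ord_pow (z : K) (n : ℕ) : p.ord (z ^ n) = n * p.ord z := by
  simp [ord_def]

theorem ord_inv (z : K) : p.ord z⁻¹ = - p.ord z := by
  simp [ord_def]

theorem ord_nonneg_iff {z : K} (hz : z ≠ 0) : 0 ≤ p.ord z ↔ z ∈ p.ring := by
  rw [← val_le_one_iff, val_eq_exp p hz, ← exp_zero, exp_le_exp, Left.neg_nonpos_iff]

theorem mem_of_ord_nonneg {z : K} (hz : 0 ≤ p.ord z) : z ∈ p.ring := by
  rcases eq_or_ne z 0 with rfl | h
  · exact zero_mem _
  · exact (p.ord_nonneg_iff h).1 hz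

theorem ord_nonneg {z : K} (hz : z ∈ p.ring) : 0 ≤ p.ord z := by
  rcases eq_or_ne z 0 with rfl | h
  · simp
  · exact (p.ord_nonneg_iff h).2 hz

theorem ord_pos_iff {z : K} (hz : z ≠ 0) : 0 < p.ord z ↔ p.ring.valuation z < 1 := by
  rw [← val_lt_one_iff, val_eq_exp p hz, ← exp_zero, exp_lt_exp, Left.neg_neg_iff]

theorem exists_ord_eq_one : ∃ π : K, π ≠ 0 ∧ p.ord π = 1 := by
  obtain ⟨π, hπ⟩ := p.val_surjective (exp (-1))
  have h0 : π ≠ 0 := by rintro rfl; exact exp_ne_zero (hπ.symm.trans (map_zero _))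
  exact ⟨π, h0, (p.ord_eq_iff h0 1).2 hπ⟩

theorem ring_ne_top : p.ring ≠ ⊤ := by
  obtain ⟨π, h0, h⟩ := p.exists_ord_eq_one
  intro htop
  have : 0 ≤ p.ord π⁻¹ := p.ord_nonneg (htop ▸ ValuationSubring.mem_top _)
  rw [ord_inv] at this
  omega

theorem ext_ring {p q : Place K} (h : p.ring = q.ring) : p = q := by
  obtain ⟨r, hr⟩ := p
  obtain ⟨s, hs⟩ := q
  obtain rfl : r = s := h
  rfl

/-- A valuation ring containing the ring of a place is equal to it, or is the whole field. -/
theorem ring_eq_of_le {V : ValuationSubring K} (h : p.ring ≤ V) (hV : V ≠ ⊤) : p.ring = V :=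
  -- Rings between a valuation ring and its field are localisations at primes; in dimension one
  -- there is none strictly between.
  haveI : Ring.KrullDimLE 1 p.ring := Ring.KrullDimLE.mk₁' fun _ a _ ↦ IsPrime.to_maximal_ideal a
  ValuationSubring.eq_of_le_of_ne_top _ h hV

theorem mem_maximalIdeal_iff (z : p.ring) :
    z ∈ IsLocalRing.maximalIdeal p.ring ↔ p.ring.valuation (z : K) < 1 :=
  ValuationSubring.valuation_lt_one_iff _ _

theorem reduce_of_mem {z : K} (h : z ∈ p.ring) :
    p.reduce z = IsLocalRing.residue p.ring ⟨z, h⟩ := dif_pos h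

/-- The place attached to a nonzero prime of a Dedekind domain with fraction field `K`. -/
def ofPrime {R : Type*} [CommRing R] [IsDedekindDomain R] [Algebra R K] [IsFractionRing R K]
    (v : HeightOneSpectrum R) : Place K :=
  ⟨(v.valuation K).valuationSubring, inferInstance⟩

section Dedekind

variable {R : Type*} [CommRing R] [Algebra R K]

theorem mem_centre_iff (hR : ∀ z : R, algebraMap R K z ∈ p.ring) (z : R) :
    z ∈ p.centre R ↔ p.ring.valuation (algebraMap R K z) < 1 := by
  let J : Ideal R :=
    { carrier := {z : R | p.ring.valuation (algebraMap R K z) < 1}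
      zero_mem' := by simp
      add_mem' := fun {a b} ha hb => by
        simp only [Set.mem_ofPred_eq, map_add] at *
        exact Valuation.map_add_lt _ ha hb
      smul_mem' := fun c a ha => by
        simp only [Set.mem_ofPred_eq, smul_eq_mul, map_mul] at *
        exact mul_lt_one_of_nonneg_of_lt_one_right ((ValuationSubring.valuation_le_one_iff _ _).2 (hR c)) zero_le ha }
  have : p.centre R = J := Ideal.span_eq J
  rw [this]
  rfl

theorem centre_eq_comap (hR : ∀ z : R, algebraMap R K z ∈ p.ring) :
    p.centre R = (IsLocalRing.maximalIdeal p.ring).comap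
      ((algebraMap R K).codRestrict p.ring.toSubring hR) := by
  ext z
  rw [mem_centre_iff p hR, Ideal.mem_comap]
  exact (p.mem_maximalIdeal_iff ((algebraMap R K).codRestrict p.ring.toSubring hR z)).symm

theorem centre_isPrime (hR : ∀ z : R, algebraMap R K z ∈ p.ring) : (p.centre R).IsPrime := by
  rw [centre_eq_comap p hR]
  exact Ideal.comap_isPrime _ _

/-- Valuation rings other than the field containing a Dedekind domain `R` with that field of
fractions come from the nonzero primes of `R`. -/
theorem exists_heightOneSpectrum [IsDedekindDomain R] [IsFractionRing R K] (V : ValuationSubring K)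
    (hV : V ≠ ⊤) (hR : ∀ z : R, algebraMap R K z ∈ V) :
    ∃ v : HeightOneSpectrum R, (v.valuation K).valuationSubring = V ∧
      ∀ z : R, z ∈ v.asIdeal ↔ V.valuation (algebraMap R K z) < 1 := by
  let φ : R →+* V := (algebraMap R K).codRestrict V.toSubring hR
  let J : Ideal R := (IsLocalRing.maximalIdeal V).comap φ
  have hJ : ∀ z : R, z ∈ J ↔ V.valuation (algebraMap R K z) < 1 := fun z =>
    ValuationSubring.valuation_lt_one_iff V (φ z)
  have hden : ∀ z : K, (∃ a b : R, b ∉ J ∧ z * algebraMap R K b = algebraMap R K a) → z ∈ V := by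
    rintro z ⟨a, b, hb, h⟩
    rw [← V.valuation_le_one_iff]
    have hb1 : V.valuation (algebraMap R K b) = 1 :=
      le_antisymm ((V.valuation_le_one_iff _).2 (hR b)) (not_lt.1 fun h => hb ((hJ b).2 h))
    have := congrArg V.valuation h
    rw [map_mul, hb1, mul_one] at this
    rw [this]
    exact (V.valuation_le_one_iff _).2 (hR a)
  -- If the centre were zero, every nonzero denominator would be a unit of V, so V would be the
  -- whole field.
  have hJ0 : J ≠ ⊥ := by
    intro h0
    apply hV
    rw [eq_top_iff]
    intro z _
    obtain ⟨a, b, hb, rfl⟩ := IsFractionRing.div_surjective (A := R) z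
    have hb0 : algebraMap R K b ≠ 0 := IsFractionRing.to_map_ne_zero_of_mem_nonZeroDivisors hb
    refine hden _ ⟨a, b, ?_, div_mul_cancel₀ _ hb0⟩
    rw [h0, Ideal.mem_bot]
    exact nonZeroDivisors.ne_zero hb
  refine ⟨⟨J, Ideal.comap_isPrime _ _, hJ0⟩, ?_, hJ⟩
  -- The localisation at the centre is already a discrete valuation ring inside V, and such a ring
  -- is maximal among proper subrings.
  refine (ofPrime (K := K) (⟨J, Ideal.comap_isPrime _ _, hJ0⟩ : HeightOneSpectrum R)).ring_eq_of_le
    (fun z hz => ?_) hV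
  obtain ⟨n, d, h⟩ := HeightOneSpectrum.exists_primeCompl_mul_eq_of_integer _ z hz
  exact hden z ⟨n, d, d.2, h⟩

theorem val_eq_of_ring_eq [IsDedekindDomain R] [IsFractionRing R K] {v : HeightOneSpectrum R}
    (h : (v.valuation K).valuationSubring = p.ring) : p.val = v.valuation K :=
  Valuation.eq_of_surjective_of_le_one_iff p.val_surjective (v.valuation_surjective K) fun z => by
    rw [p.val_le_one_iff, ← h, Valuation.mem_valuationSubring_iff]

theorem val_ofPrime [IsDedekindDomain R] [IsFractionRing R K] (v : HeightOneSpectrum R) :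
    (ofPrime (K := K) v).val = v.valuation K :=
  val_eq_of_ring_eq _ rfl

theorem exists_heightOneSpectrum_eq_centre [IsDedekindDomain R] [IsFractionRing R K]
    (hR : ∀ z : R, algebraMap R K z ∈ p.ring) :
    ∃ v : HeightOneSpectrum R, ofPrime v = p ∧ v.asIdeal = p.centre R := by
  obtain ⟨v, h1, h2⟩ := exists_heightOneSpectrum p.ring p.ring_ne_top hR
  exact ⟨v, ext_ring h1, by ext z; rw [h2, mem_centre_iff p hR]⟩

theorem centre_ofPrime [IsDedekindDomain R] [IsFractionRing R K] (v : HeightOneSpectrum R) :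
    (ofPrime (K := K) v).centre R = v.asIdeal := by
  ext z
  rw [mem_centre_iff _ fun z => v.valuation_le_one z, ← val_lt_one_iff, val_ofPrime,
    HeightOneSpectrum.valuation_lt_one_iff_mem]

end Dedekind

end Place

end

/-! ### Places above a given place, and the fundamental identity. -/

noncomputable section

open WithZero IsDedekindDomain

namespace Place

section Extension

variable {K : Type*} [Field K] {p : Place K} {L : Type*} [Field L] [Algebra K L]

/-- Elements integral over the ring of a place lie in every valuation ring above it. -/
theorem mem_of_isIntegral {V : ValuationSubring L} (hV : p.ring ≤ V.comap (algebraMap K L))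
    {z : L} (hz : IsIntegral p.ring z) : z ∈ V := by
  let φ : p.ring →+* V := ((algebraMap K L).comp p.ring.subtype).codRestrict V.toSubring
    fun z => hV z.2
  have : IsIntegral V z := hz.map_of_comp_eq φ (RingHom.id L) rfl
  have h2 : V.valuation.Integers V :=
    ⟨Subtype.val_injective, fun z => (V.valuation_le_one_iff _).2 z.2,
      fun {z} hz => ⟨⟨z, (V.valuation_le_one_iff _).1 hz⟩, rfl⟩⟩
  exact (V.valuation_le_one_iff _).1 (h2.mem_of_integral this)

namespace Above

theorem mem_of_isIntegral (P : p.Above L) {z : L} (hz : IsIntegral p.ring z) : z ∈ P.1.ring :=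
  Place.mem_of_isIntegral P.2.ge hz

/-- The criterion for the ramification index. -/
theorem ramificationIdx_eq (P : p.Above L) {e : ℕ} (he : 0 < e)
    (h : ∀ z : K, P.1.ord (algebraMap K L z) = e * p.ord z) : P.ramificationIdx = e := by
  obtain ⟨π, -, hπ⟩ := p.exists_ord_eq_one
  have : {e : ℕ | 0 < e ∧ ∀ z : K, P.1.ord (algebraMap K L z) = e * p.ord z} = {e} := by
    ext e'
    simp only [Set.mem_ofPred_eq, Set.mem_singleton_iff]
    constructor
    · rintro ⟨-, h'⟩
      have := (h' π).symm.trans (h π)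
      rw [hπ] at this
      omega
    · rintro rfl
      exact ⟨he, h⟩
  rw [ramificationIdx, this, csInf_singleton]

end Above

variable [FiniteDimensional K L]

instance isFractionRing_integralClosure : IsFractionRing (integralClosure p.ring L) L :=
  integralClosure.isFractionRing_of_finite_extension K L

variable [Algebra.IsSeparable K L]

instance isDedekindDomain_integralClosure : IsDedekindDomain (integralClosure p.ring L) :=
  integralClosure.isDedekindDomain p.ring K L

instance finite_integralClosure : Module.Finite p.ring (integralClosure p.ring L) :=
  IsIntegralClosure.finite p.ring K L _

instance torsionFree_integralClosure :
    Module.IsTorsionFree p.ring (integralClosure p.ring L) :=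
  IsIntegralClosure.isTorsionFree p.ring L

theorem maximalIdeal_ne_bot (p : Place K) : IsLocalRing.maximalIdeal p.ring ≠ ⊥ :=
  IsDiscreteValuationRing.not_a_field _

omit [FiniteDimensional K L] [Algebra.IsSeparable K L] in
variable (p L) in
/-- A nonzero prime of the integral closure of the ring of `p` lies over the maximal ideal. -/
theorem liesOver_maximalIdeal (w : HeightOneSpectrum (integralClosure p.ring L)) :
    w.asIdeal.LiesOver (IsLocalRing.maximalIdeal p.ring) := by
  have h1 : w.asIdeal.under p.ring ≠ ⊥ := Ideal.IsIntegral.comap_ne_bot p.ring w.ne_bot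
  have h2 : (w.asIdeal.under p.ring).IsMaximal := IsPrime.to_maximal_ideal h1
  exact ⟨(IsLocalRing.eq_maximalIdeal h2).symm⟩

/-- A discrete valuation ring is a maximal proper subring, so only the possibility that the
restriction is all of `K` must be excluded: a uniformiser of `p` lies in `w`, hence its inverse is
not integral at `w`. -/
theorem comap_ring_ofPrime (w : HeightOneSpectrum (integralClosure p.ring L)) :
    (ofPrime (K := L) w).ring.comap (algebraMap K L) = p.ring := by
  have := liesOver_maximalIdeal p L w
  refine (p.ring_eq_of_le (fun z hz => ?_) ?_).symm
  · exact w.valuation_le_one (K := L) (algebraMap p.ring _ ⟨z, hz⟩)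
  · intro htop
    obtain ⟨π, h0, hπ⟩ := p.exists_ord_eq_one
    have hval := (p.ord_pos_iff h0).1 (by omega)
    have hmem : π ∈ p.ring := (p.ring.valuation_le_one_iff _).1 hval.le
    have h1 : (⟨π, hmem⟩ : p.ring) ∈ IsLocalRing.maximalIdeal p.ring :=
      (p.mem_maximalIdeal_iff _).2 hval
    rw [w.asIdeal.over_def (IsLocalRing.maximalIdeal p.ring), Ideal.under_def, Ideal.mem_comap,
      ← w.valuation_lt_one_iff_mem (K := L)] at h1
    have h2 : π⁻¹ ∈ (ofPrime (K := L) w).ring.comap (algebraMap K L) :=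
      htop ▸ ValuationSubring.mem_top _
    have h2 : w.valuation L (algebraMap K L π⁻¹) ≤ 1 := h2
    rw [map_inv₀, map_inv₀] at h2
    have h3 : w.valuation L (algebraMap K L π) < 1 := h1
    have h4 : w.valuation L (algebraMap K L π) ≠ 0 :=
      (Valuation.ne_zero_iff _).2 ((_root_.map_ne_zero _).2 h0)
    exact absurd ((inv_le_one₀ (zero_lt_iff.2 h4)).1 h2) (not_le.2 h3)

/-- Every valuation ring above the ring of a place is the ring of a place. -/
theorem exists_above_ring_eq {V : ValuationSubring L} (hV : V.comap (algebraMap K L) = p.ring) :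
    ∃ P : p.Above L, P.1.ring = V := by
  obtain ⟨w, h1, -⟩ := exists_heightOneSpectrum (R := integralClosure p.ring L) V
    (by rintro rfl
        exact p.ring_ne_top (hV.symm.trans (by ext; simp)))
    (fun z => mem_of_isIntegral hV.ge ((mem_integralClosure_iff _ _).1 z.2))
  exact ⟨⟨ofPrime w, comap_ring_ofPrime w⟩, h1⟩

namespace Above

theorem exists_ofPrime_eq (P : p.Above L) :
    ∃ w : HeightOneSpectrum (integralClosure p.ring L), ofPrime w = P.1 :=
  (exists_heightOneSpectrum_eq_centre P.1 fun z => P.mem_of_isIntegral ((mem_integralClosure_iff _ _).1 z.2)).imp fun _ h => h.1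

variable (p L) in
/-- The places above `p` correspond to the nonzero primes of the integral closure. -/
def equivHeightOneSpectrum : HeightOneSpectrum (integralClosure p.ring L) ≃ p.Above L :=
  Equiv.ofBijective (fun w => ⟨ofPrime w, comap_ring_ofPrime w⟩) <| by
    constructor
    · intro w w' h
      have h : ofPrime (K := L) w = ofPrime w' := congrArg Subtype.val h
      ext1
      rw [← centre_ofPrime (K := L) w, ← centre_ofPrime (K := L) w', h]
    · intro P
      obtain ⟨w, hw⟩ := P.exists_ofPrime_eq
      exact ⟨w, Subtype.ext hw⟩

variable (w : HeightOneSpectrum (integralClosure p.ring L))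

/-- This links the exponent of ideal theory to the scaling factor of valuations by which
`ramificationIdx` of a place is defined. -/
theorem ord_equivHeightOneSpectrum (z : K) :
    (equivHeightOneSpectrum p L w).1.ord (algebraMap K L z) =
      w.asIdeal.ramificationIdx p.ring * p.ord z := by
  have := liesOver_maximalIdeal p L w
  have hm := maximalIdeal_ne_bot p
  have : w.asIdeal.LiesOver (IsDiscreteValuationRing.maximalIdeal p.ring).asIdeal := this
  have h1 := HeightOneSpectrum.valuation_liesOver L (IsDiscreteValuationRing.maximalIdeal p.ring) w
    z
  rw [ord_def, ord_def, ← Ideal.ramificationIdx'_eq_ramificationIdx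
    (IsLocalRing.maximalIdeal p.ring) w.asIdeal hm]
  have h2 : (equivHeightOneSpectrum p L w).1.val = w.valuation L := val_ofPrime w
  rw [h2, ← h1, log_pow]
  simp only [IsDiscreteValuationRing.maximalIdeal, nsmul_eq_mul, mul_neg, neg_inj]
  rfl

theorem ramificationIdx_equivHeightOneSpectrum :
    (equivHeightOneSpectrum p L w).ramificationIdx = w.asIdeal.ramificationIdx p.ring :=
  ramificationIdx_eq _ (Ideal.ramificationIdx_pos _ _) (ord_equivHeightOneSpectrum w)

/-- The residue field of the place is the integral closure modulo `w`: a fraction n/d with d outside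
`w` has the same residue as n c, where c inverts d modulo `w`. -/
theorem inertiaDeg_equivHeightOneSpectrum :
    (equivHeightOneSpectrum p L w).inertiaDeg = w.asIdeal.inertiaDeg p.ring := by
  have := liesOver_maximalIdeal p L w
  have hwm : w.asIdeal.IsMaximal := w.isMaximal
  rw [← Ideal.inertiaDeg'_eq_inertiaDeg (IsLocalRing.maximalIdeal p.ring),
    Ideal.inertiaDeg'_algebraMap]
  set P := equivHeightOneSpectrum p L w
  let φ : integralClosure p.ring L →+* P.1.ring :=
    (algebraMap (integralClosure p.ring L) L).codRestrict P.1.ring.toSubring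
      fun z => P.mem_of_isIntegral ((mem_integralClosure_iff _ _).1 z.2)
  have hker : ∀ z, IsLocalRing.residue P.1.ring (φ z) = 0 ↔ z ∈ w.asIdeal := by
    intro z
    have h : w.asIdeal = P.1.centre _ := (centre_ofPrime (K := L) w).symm
    rw [IsLocalRing.residue_eq_zero_iff, h,
      centre_eq_comap P.1 fun z : integralClosure p.ring L =>
        P.mem_of_isIntegral ((mem_integralClosure_iff _ _).1 z.2)]
    rfl
  have hsurj : Function.Surjective ((IsLocalRing.residue P.1.ring).comp φ) := by
    intro y
    obtain ⟨⟨z, hz⟩, rfl⟩ := IsLocalRing.residue_surjective y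
    obtain ⟨n, d, hnd⟩ := HeightOneSpectrum.exists_primeCompl_mul_eq_of_integer w z hz
    obtain ⟨c, hc⟩ := Ideal.Quotient.exists_inv (I := w.asIdeal)
      (a := Ideal.Quotient.mk _ (d : integralClosure p.ring L))
      (by rw [Ne, Ideal.Quotient.eq_zero_iff_mem]; exact d.2)
    obtain ⟨c, rfl⟩ := Ideal.Quotient.mk_surjective c
    have h1 : IsLocalRing.residue P.1.ring (φ d) * IsLocalRing.residue P.1.ring (φ c) = 1 := by
      rw [← map_mul, ← map_mul, ← sub_eq_zero, ← map_one (IsLocalRing.residue P.1.ring),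
        ← map_one φ, ← map_sub, ← map_sub, hker, ← Ideal.Quotient.eq_zero_iff_mem, map_sub, map_mul,
        hc, map_one, sub_self]
    have h2 : (⟨z, hz⟩ : P.1.ring) * φ d = φ n := Subtype.ext hnd
    refine ⟨n * c, ?_⟩
    simp only [RingHom.comp_apply, map_mul, ← h2]
    rw [mul_assoc, h1, mul_one]
  let ψ : (integralClosure p.ring L ⧸ w.asIdeal) ≃+* P.1.ResidueField :=
    (Ideal.quotEquivOfEq (by ext z; exact (hker z).symm)).trans
      (RingHom.quotientKerEquivOfSurjective hsurj)
  let : Algebra (p.ring ⧸ IsLocalRing.maximalIdeal p.ring) P.1.ResidueField :=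
    (IsLocalRing.ResidueField.map P.ringHom).toAlgebra
  refine (Algebra.finrank_eq_of_equiv_equiv (RingEquiv.refl (p.ring ⧸ IsLocalRing.maximalIdeal p.ring)) ψ ?_).symm
  ext z
  rfl

theorem finite (p : Place K) (L : Type*) [Field L] [Algebra K L] [FiniteDimensional K L]
    [Algebra.IsSeparable K L] : Finite (p.Above L) := by
  have : Finite ((IsLocalRing.maximalIdeal p.ring).primesOver (integralClosure p.ring L)) :=
    Algebra.QuasiFinite.finite_primesOver _
  refine Finite.of_injective (β := (IsLocalRing.maximalIdeal p.ring).primesOver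
    (integralClosure p.ring L))
    (fun P => ⟨((equivHeightOneSpectrum p L).symm P).asIdeal,
      ((equivHeightOneSpectrum p L).symm P).isPrime, liesOver_maximalIdeal p L _⟩) ?_
  intro P Q h
  exact (equivHeightOneSpectrum p L).symm.injective
    (HeightOneSpectrum.ext (congrArg Subtype.val h))

theorem ord_algebraMap (P : p.Above L) (z : K) :
    P.1.ord (algebraMap K L z) = P.ramificationIdx * p.ord z := by
  obtain ⟨w, rfl⟩ := (equivHeightOneSpectrum p L).surjective P
  rw [ord_equivHeightOneSpectrum, ramificationIdx_equivHeightOneSpectrum]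

theorem ramificationIdx_pos (P : p.Above L) : 0 < P.ramificationIdx := by
  obtain ⟨w, rfl⟩ := (equivHeightOneSpectrum p L).surjective P
  rw [ramificationIdx_equivHeightOneSpectrum]
  exact Ideal.ramificationIdx_pos _ _

theorem inertiaDeg_pos (P : p.Above L) : 0 < P.inertiaDeg := by
  obtain ⟨w, rfl⟩ := (equivHeightOneSpectrum p L).surjective P
  rw [inertiaDeg_equivHeightOneSpectrum]
  exact Ideal.inertiaDeg_pos _ _

variable (p L) in
/-- The fundamental identity. -/
theorem sum_ramificationIdx_mul_inertiaDeg [Fintype (p.Above L)] :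
    ∑ P : p.Above L, P.ramificationIdx * P.inertiaDeg = Module.finrank K L := by
  let e : (IsLocalRing.maximalIdeal p.ring).primesOver (integralClosure p.ring L) ≃
      HeightOneSpectrum (integralClosure p.ring L) :=
    { toFun := fun I => ⟨I.1, I.2.1, by
        have := I.2.2
        exact Ideal.ne_bot_of_liesOver_of_ne_bot (maximalIdeal_ne_bot p) I.1⟩
      invFun := fun w => ⟨w.asIdeal, w.isPrime, liesOver_maximalIdeal p L w⟩
      left_inv := fun _ => rfl
      right_inv := fun _ => rfl }
  have : Fintype ((IsLocalRing.maximalIdeal p.ring).primesOver (integralClosure p.ring L)) :=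
    Fintype.ofEquiv _ (e.trans (equivHeightOneSpectrum p L)).symm
  rw [← IsIntegralClosure.rank p.ring K L (integralClosure p.ring L),
    ← Ideal.sum_ramification_inertia_eq_finrank (IsLocalRing.maximalIdeal p.ring),
    ← (e.trans (equivHeightOneSpectrum p L)).sum_comp]
  refine Finset.sum_congr rfl fun I _ => ?_
  rw [Equiv.trans_apply, ramificationIdx_equivHeightOneSpectrum, inertiaDeg_equivHeightOneSpectrum]
  rfl

variable (p L) in
theorem nonempty : Nonempty (p.Above L) := by
  have := finite p L
  have := Fintype.ofFinite (p.Above L)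
  have h := sum_ramificationIdx_mul_inertiaDeg p L
  by_contra h0
  rw [not_nonempty_iff] at h0
  rw [Finset.univ_eq_empty, Finset.sum_empty] at h
  exact Module.finrank_pos.ne h

/-- The Galois group acts on the integral closure and permutes the primes over the maximal ideal of
`p` transitively. -/
theorem ramificationIdx_eq_and_inertiaDeg_eq_of_isGalois [IsGalois K L] (P Q : p.Above L) :
    P.ramificationIdx = Q.ramificationIdx ∧ P.inertiaDeg = Q.inertiaDeg := by
  obtain ⟨v, rfl⟩ := (equivHeightOneSpectrum p L).surjective P
  obtain ⟨w, rfl⟩ := (equivHeightOneSpectrum p L).surjective Q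
  simp only [ramificationIdx_equivHeightOneSpectrum, inertiaDeg_equivHeightOneSpectrum]
  have := liesOver_maximalIdeal p L v
  have := liesOver_maximalIdeal p L w
  let : MulSemiringAction Gal(L/K) (integralClosure p.ring L) :=
    IsIntegralClosure.MulSemiringAction p.ring K L _
  have : IsGaloisGroup Gal(L/K) p.ring (integralClosure p.ring L) :=
    IsGaloisGroup.of_isFractionRing _ _ _ K L
  exact ⟨Ideal.ramificationIdx_eq_of_isGaloisGroup (IsLocalRing.maximalIdeal p.ring) _ _ Gal(L/K),
    Ideal.inertiaDeg_eq_of_isGaloisGroup (IsLocalRing.maximalIdeal p.ring) _ _ Gal(L/K)⟩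

theorem card_mul_eq_finrank_of_isGalois [IsGalois K L] (P : p.Above L) :
    Nat.card (p.Above L) * (P.ramificationIdx * P.inertiaDeg) = Module.finrank K L := by
  have := finite p L
  have := Fintype.ofFinite (p.Above L)
  rw [← sum_ramificationIdx_mul_inertiaDeg p L, Nat.card_eq_fintype_card, ← Finset.card_univ,
    ← smul_eq_mul, ← Finset.sum_const]
  refine Finset.sum_congr rfl fun Q _ => ?_
  rw [(ramificationIdx_eq_and_inertiaDeg_eq_of_isGalois P Q).1,
    (ramificationIdx_eq_and_inertiaDeg_eq_of_isGalois P Q).2]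

end Above

end Extension

end Place

end

/-! ### Towers of extensions. -/

noncomputable section

open WithZero IsDedekindDomain

namespace Place

namespace Above

section Tower

variable {K : Type*} [Field K] {p : Place K} {L : Type*} [Field L] [Algebra K L]
  {N : Type*} [Field N] [Algebra K N] [Algebra L N] [IsScalarTower K L N]

/-- A place above a place above `p` is above `p`. -/
def trans (P : p.Above L) (Q : P.1.Above N) : p.Above N :=
  ⟨Q.1, by
    rw [IsScalarTower.algebraMap_eq K L N, ← ValuationSubring.comap_comap]
    exact (congrArg (ValuationSubring.comap · (algebraMap K L)) Q.2).trans P.2⟩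

theorem inertiaDeg_trans (P : p.Above L) (Q : P.1.Above N) :
    (P.trans Q).inertiaDeg = P.inertiaDeg * Q.inertiaDeg := by
  let : Algebra p.ResidueField P.1.ResidueField :=
    (IsLocalRing.ResidueField.map P.ringHom).toAlgebra
  let : Algebra P.1.ResidueField Q.1.ResidueField :=
    (IsLocalRing.ResidueField.map Q.ringHom).toAlgebra
  let : Algebra p.ResidueField Q.1.ResidueField :=
    (IsLocalRing.ResidueField.map (P.trans Q).ringHom).toAlgebra
  have : IsScalarTower p.ResidueField P.1.ResidueField Q.1.ResidueField := by
    refine IsScalarTower.of_algebraMap_eq fun z => ?_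
    obtain ⟨z, rfl⟩ := IsLocalRing.residue_surjective z
    change IsLocalRing.residue Q.1.ring _ = IsLocalRing.residue Q.1.ring _
    congr 1
    exact Subtype.ext (IsScalarTower.algebraMap_apply K L N z)
  exact (Module.finrank_mul_finrank p.ResidueField P.1.ResidueField Q.1.ResidueField).symm

variable [FiniteDimensional K L] [Algebra.IsSeparable K L]

/-- The restriction of the valuation ring of `Q` to `L` lies above `p`, and is therefore discrete by
`exists_above_ring_eq`. -/
theorem exists_trans_eq (Q : p.Above N) : ∃ (P : p.Above L) (Q' : P.1.Above N), P.trans Q' = Q := by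
  obtain ⟨P, hP⟩ := exists_above_ring_eq (p := p) (V := Q.1.ring.comap (algebraMap L N)) (by
    rw [ValuationSubring.comap_comap, ← IsScalarTower.algebraMap_eq K L N, Q.2])
  exact ⟨P, ⟨Q.1, hP.symm⟩, rfl⟩

variable [FiniteDimensional L N] [Algebra.IsSeparable L N]

theorem ramificationIdx_trans (P : p.Above L) (Q : P.1.Above N) :
    (P.trans Q).ramificationIdx = P.ramificationIdx * Q.ramificationIdx := by
  refine ramificationIdx_eq _ (mul_pos P.ramificationIdx_pos Q.ramificationIdx_pos) fun z => ?_
  rw [IsScalarTower.algebraMap_apply K L N]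
  refine (Q.ord_algebraMap _).trans ?_
  rw [P.ord_algebraMap]
  push_cast
  ring

end Tower

/-! ### Kummer's theorem for the reduction of a minimal polynomial. -/

section Root

variable {K : Type*} [Field K] {p : Place K} {L : Type*} [Field L] [Algebra K L]
  [FiniteDimensional K L] [Algebra.IsSeparable K L]

/-- A polynomial over the residue field evaluated at the residue class of an element upstairs. -/
def evalReduce (P : p.Above L) (φ : p.ResidueField[X]) (z : L) : P.1.ResidueField :=
  φ.eval₂ (IsLocalRing.ResidueField.map P.ringHom) (P.1.reduce z)

/-- Up to a constant, φ is the minimal polynomial of the residue of z, and the degree of an element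
is at most that of the residue extension. -/
theorem natDegree_le_inertiaDeg (P : p.Above L) {φ : p.ResidueField[X]} (hφ : Irreducible φ) {z : L}
    (h : P.evalReduce φ z = 0) : φ.natDegree ≤ P.inertiaDeg := by
  let : Algebra p.ResidueField P.1.ResidueField :=
    (IsLocalRing.ResidueField.map P.ringHom).toAlgebra
  have hpos : 0 < Module.finrank p.ResidueField P.1.ResidueField := P.inertiaDeg_pos
  have := Module.finite_of_finrank_pos hpos
  have h1 := minpoly.eq_of_irreducible hφ h
  have h2 := minpoly.natDegree_le (A := p.ResidueField) (P.1.reduce z)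
  rw [← h1, natDegree_mul_C (inv_ne_zero (leadingCoeff_ne_zero.2 hφ.ne_zero))] at h2
  exact h2

/-- Irreducible factors of the reduction of a minimal polynomial give places. -/
theorem exists_evalReduce_eq_zero {G : p.ring[X]} (hG : G.Monic) {z : L}
    (hz : minpoly K z = G.map (algebraMap p.ring K)) {φ : p.ResidueField[X]} (hφ : Irreducible φ)
    (hdvd : φ ∣ G.map (IsLocalRing.residue p.ring)) :
    ∃ P : p.Above L, P.evalReduce φ z = 0 := by
  have haev : ∀ h : p.ring[X], aeval z h = aeval z (h.map (algebraMap p.ring K)) := fun h => by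
    rw [aeval_map_algebraMap]
  have hint : IsIntegral p.ring z := by
    refine ⟨G, hG, ?_⟩
    rw [← aeval_def, haev, ← hz, minpoly.aeval]
  let B := integralClosure p.ring L
  let b : B := ⟨z, hint⟩
  have hb : ∀ h : p.ring[X], ((aeval b h : B) : L) = aeval z h := fun h =>
    (aeval_algebraMap_apply (B := L) (A := B) b h).symm
  -- Through X ↦ b, the ring B is integral over the polynomial ring, so lying-over can be applied to
  -- the preimage I of (φ).
  let : Algebra p.ring[X] B := (aeval b).toAlgebra
  have : IsScalarTower p.ring p.ring[X] B :=
    IsScalarTower.of_algebraMap_eq fun c => (aeval_C b c).symm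
  have : Algebra.IsIntegral p.ring[X] B := Algebra.IsIntegral.tower_top p.ring
  let I : Ideal p.ring[X] := (Ideal.span {φ}).comap (mapRingHom (IsLocalRing.residue p.ring))
  have hφp : (Ideal.span {φ}).IsPrime := (Ideal.span_singleton_prime hφ.ne_zero).2 hφ.prime
  have hI : I.IsPrime := Ideal.comap_isPrime _ _
  have hIm : ∀ h : p.ring[X], h ∈ I ↔ φ ∣ h.map (IsLocalRing.residue p.ring) := fun h =>
    Ideal.mem_span_singleton
  -- The kernel of evaluation at b must lie in I: its elements are multiples of the monic G, by
  -- divisibility over K, and φ divides the reduction of G.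
  obtain ⟨w, -, hw, hwI⟩ := Ideal.exists_ideal_over_prime_of_isIntegral I (⊥ : Ideal B) (by
    intro h hh
    have h0 : aeval b h = 0 := hh
    have h1 : aeval z (h.map (algebraMap p.ring K)) = 0 := by
      rw [← haev, ← hb, h0]; rfl
    have h2 := minpoly.dvd K z h1
    rw [hz, map_dvd_map _ (IsFractionRing.injective p.ring K) hG] at h2
    exact (hIm h).2 (hdvd.trans (Polynomial.map_dvd _ h2)))
  have hwm : ∀ h : p.ring[X], aeval b h ∈ w ↔ φ ∣ h.map (IsLocalRing.residue p.ring) := fun h => by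
    rw [← hIm, ← hwI]; rfl
  -- Constants from the maximal ideal of `p` reduce to zero, so they lie in I and their images lie
  -- in w.
  have hw0 : w ≠ ⊥ := by
    rintro rfl
    obtain ⟨a, ha, ha0⟩ := Submodule.exists_mem_ne_zero_of_ne_bot (maximalIdeal_ne_bot p)
    have := (hwm (C a)).2 (by
      rw [map_C, (IsLocalRing.residue_eq_zero_iff a).2 ha, C_0]; exact dvd_zero _)
    rw [aeval_C, Ideal.mem_bot, FaithfulSMul.algebraMap_eq_zero_iff] at this
    exact ha0 this
  let P := equivHeightOneSpectrum p L ⟨w, hw, hw0⟩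
  obtain ⟨Φ, hΦ⟩ := map_surjective _ (IsLocalRing.residue_surjective (R := p.ring)) φ
  have hPw : P.1.centre B = w := centre_ofPrime _
  have hmem : aeval b Φ ∈ P.1.centre B := hPw ▸ (hwm Φ).2 (hΦ ▸ dvd_rfl)
  let ι : B →+* P.1.ring := (algebraMap B L).codRestrict P.1.ring.toSubring
      fun z => P.mem_of_isIntegral ((mem_integralClosure_iff _ _).1 z.2)
  rw [centre_eq_comap P.1 fun z : B => P.mem_of_isIntegral ((mem_integralClosure_iff _ _).1 z.2),
    Ideal.mem_comap] at hmem
  have hmem := (IsLocalRing.residue_eq_zero_iff (ι (aeval b Φ))).2 hmem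
  refine ⟨P, ?_⟩
  rw [evalReduce, ← hΦ, eval₂_map, reduce_of_mem _ (P.mem_of_isIntegral hint), ← hmem, aeval_def,
    hom_eval₂, hom_eval₂]
  rfl

/-- If irreducible pairwise coprime factors of the reduction of a minimal polynomial have total
degree `[L : K]`, they describe all places above `p`, which are unramified. -/
theorem exists_equiv_of_dvd {G : p.ring[X]} (hG : G.Monic) {z : L}
    (hz : minpoly K z = G.map (algebraMap p.ring K)) {ι : Type*} [Fintype ι]
    (φ : ι → p.ResidueField[X]) (hφ : ∀ i, Irreducible (φ i))
    (hdvd : ∀ i, φ i ∣ G.map (IsLocalRing.residue p.ring))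
    (hcop : Pairwise fun i j => IsCoprime (φ i) (φ j))
    (hdeg : ∑ i, (φ i).natDegree = Module.finrank K L) :
    ∃ P : ι ≃ p.Above L, ∀ i, (P i).ramificationIdx = 1 ∧ (P i).inertiaDeg = (φ i).natDegree := by
  classical
  choose P hP using fun i => exists_evalReduce_eq_zero hG hz (hφ i) (hdvd i)
  -- A Bézout relation between two coprime factors, evaluated at the residue of z, would read 0 = 1
  -- at a common place.
  have hinj : Function.Injective P := by
    intro i j hij
    by_contra hne
    obtain ⟨u, v, huv⟩ := hcop hne
    have h := congrArg (fun q => (P i).evalReduce q z) huv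
    have hj := hP j
    rw [← hij] at hj
    simp only [evalReduce] at h hj hP
    rw [eval₂_add, eval₂_mul, eval₂_mul, hP i, hj, mul_zero, mul_zero, add_zero, eval₂_one] at h
    exact zero_ne_one h
  have := finite p L
  have := Fintype.ofFinite (p.Above L)
  have hsum := sum_ramificationIdx_mul_inertiaDeg p L
  have hle : ∀ i ∈ Finset.univ, (φ i).natDegree ≤ (P i).ramificationIdx * (P i).inertiaDeg :=
    fun i _ => (natDegree_le_inertiaDeg _ (hφ i) (hP i)).trans
      (Nat.le_mul_of_pos_left _ (P i).ramificationIdx_pos)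
  have himg : ∑ i, (P i).ramificationIdx * (P i).inertiaDeg =
      ∑ Q ∈ Finset.univ.image P, Q.ramificationIdx * Q.inertiaDeg :=
    (Finset.sum_image (f := fun Q : p.Above L => Q.ramificationIdx * Q.inertiaDeg)
      fun i _ j _ h => hinj h).symm
  have hle2 : ∑ Q ∈ Finset.univ.image P, Q.ramificationIdx * Q.inertiaDeg ≤
      Module.finrank K L := by
    rw [← hsum]
    exact Finset.sum_le_sum_of_subset (Finset.subset_univ _)
  -- Squeeze: [L : K] = ∑ deg φᵢ ≤ ∑ e f over the places found ≤ [L : K]. Equality excludes further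
  -- places and makes each inequality deg φᵢ ≤ f ≤ e f sharp.
  have heq : ∑ i, (φ i).natDegree = ∑ i, (P i).ramificationIdx * (P i).inertiaDeg :=
    le_antisymm (Finset.sum_le_sum hle) (by rw [himg, hdeg]; exact hle2)
  have hsurj : Function.Surjective P := by
    intro Q
    by_contra hQ
    have hQ' : Q ∉ Finset.univ.image P := by
      simpa using hQ
    have := Finset.sum_le_sum_of_subset (f := fun Q : p.Above L => Q.ramificationIdx * Q.inertiaDeg)
      (Finset.subset_univ (insert Q (Finset.univ.image P)))
    rw [Finset.sum_insert hQ', hsum, ← himg, ← heq, hdeg] at this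
    have h2 := mul_pos Q.ramificationIdx_pos Q.inertiaDeg_pos
    omega
  refine ⟨Equiv.ofBijective P ⟨hinj, hsurj⟩, fun i => ?_⟩
  have h1 := (Finset.sum_eq_sum_iff_of_le hle).1 heq i (Finset.mem_univ i)
  have h2 := natDegree_le_inertiaDeg _ (hφ i) (hP i)
  have h3 := (P i).ramificationIdx_pos
  have h4 := (P i).inertiaDeg_pos
  change (P i).ramificationIdx = 1 ∧ (P i).inertiaDeg = (φ i).natDegree
  have h5 : (P i).ramificationIdx = 1 := by nlinarith
  rw [h5, one_mul] at h1
  exact ⟨h5, h1.symm⟩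

end Root

end Above

end Place

end

/-! ### Signatures in quadratic and cubic extensions. -/

noncomputable section

open WithZero IsDedekindDomain

namespace Place

section Signature

variable {K : Type*} [Field K] {p : Place K} {L : Type*} [Field L] [Algebra K L]

theorem HasSignature.card_eq {s : List (ℕ × ℕ)} (h : p.HasSignature L s) :
    Nat.card (p.Above L) = s.length := by
  obtain ⟨P, -⟩ := h
  rw [← Nat.card_congr P, Nat.card_eq_fintype_card, Fintype.card_fin]

theorem HasSignature.mem_iff {s : List (ℕ × ℕ)} (h : p.HasSignature L s) (a : ℕ × ℕ) :
    a ∈ s ↔ ∃ P : p.Above L, (P.ramificationIdx, P.inertiaDeg) = a := by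
  obtain ⟨P, hP⟩ := h
  rw [List.mem_iff_get]
  constructor
  · rintro ⟨i, hi⟩
    exact ⟨P i, (hP i).trans hi⟩
  · rintro ⟨Q, hQ⟩
    refine ⟨P.symm Q, ?_⟩
    rw [← hP, Equiv.apply_symm_apply, hQ]

theorem hasSignature_of_forall {n : ℕ} {s : List (ℕ × ℕ)} (hs : s.length = n)
    (P : Fin n ≃ p.Above L)
    (h : ∀ i : Fin n, ((P i).ramificationIdx, (P i).inertiaDeg) = s.get (i.cast hs.symm)) :
    p.HasSignature L s := by
  subst hs
  exact ⟨P, h⟩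

theorem hasSignature_singleton_iff {a : ℕ × ℕ} :
    p.HasSignature L [a] ↔
      ∃ P : p.Above L, (∀ Q, Q = P) ∧ (P.ramificationIdx, P.inertiaDeg) = a := by
  constructor
  · rintro ⟨P, hP⟩
    refine ⟨P 0, fun Q => ?_, hP 0⟩
    obtain ⟨i, rfl⟩ := P.surjective Q
    exact congrArg P (Subsingleton.elim (α := Fin 1) i 0)
  · rintro ⟨P, hP, h⟩
    refine ⟨Equiv.ofBijective (fun _ => P) ⟨fun i j _ => Subsingleton.elim (α := Fin 1) i j,
      fun Q => ⟨0, (hP Q).symm⟩⟩, fun i => ?_⟩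
    obtain rfl : i = 0 := Subsingleton.elim (α := Fin 1) i 0
    exact h

theorem hasSignature_pair_iff {a b : ℕ × ℕ} :
    p.HasSignature L [a, b] ↔
      ∃ P Q : p.Above L, P ≠ Q ∧ (∀ R, R = P ∨ R = Q) ∧
        (P.ramificationIdx, P.inertiaDeg) = a ∧ (Q.ramificationIdx, Q.inertiaDeg) = b := by
  constructor
  · rintro ⟨P, hP⟩
    refine ⟨P 0, P 1, fun h => absurd (congrArg Fin.val (P.injective h)) Nat.zero_ne_one, fun R => ?_, hP 0, hP 1⟩
    obtain ⟨i, rfl⟩ := P.surjective R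
    change Fin 2 at i
    fin_cases i
    · exact Or.inl rfl
    · exact Or.inr rfl
  · rintro ⟨P, Q, hne, hall, ha, hb⟩
    have hbij : Function.Bijective (fun i : Fin 2 => if i = 0 then P else Q) := by
      constructor
      · intro i j hij
        fin_cases i <;> fin_cases j <;> simp_all
      · intro R
        rcases hall R with rfl | rfl
        · exact ⟨0, rfl⟩
        · exact ⟨1, rfl⟩
    refine hasSignature_of_forall rfl (Equiv.ofBijective _ hbij) fun i => ?_
    fin_cases i
    · exact ha
    · exact hb

theorem HasSignature.swap {a b : ℕ × ℕ} (h : p.HasSignature L [a, b]) :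
    p.HasSignature L [b, a] := by
  rw [hasSignature_pair_iff] at h ⊢
  obtain ⟨P, Q, h1, h2, h3, h4⟩ := h
  exact ⟨Q, P, h1.symm, fun R => (h2 R).symm, h4, h3⟩

variable [FiniteDimensional K L] [Algebra.IsSeparable K L]

theorem Above.mul_eq_finrank_of_forall_eq {P : p.Above L} (h : ∀ Q, Q = P) :
    P.ramificationIdx * P.inertiaDeg = Module.finrank K L := by
  have := Above.finite p L
  have := Fintype.ofFinite (p.Above L)
  have hu : (Finset.univ : Finset (p.Above L)) = {P} := by
    ext Q; simp [h Q]
  rw [← Above.sum_ramificationIdx_mul_inertiaDeg p L, hu, Finset.sum_singleton]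

theorem Above.mul_add_mul_eq_finrank {P Q : p.Above L} (hne : P ≠ Q) (h : ∀ R, R = P ∨ R = Q) :
    P.ramificationIdx * P.inertiaDeg + Q.ramificationIdx * Q.inertiaDeg =
      Module.finrank K L := by
  classical
  have := Above.finite p L
  have := Fintype.ofFinite (p.Above L)
  have hu : (Finset.univ : Finset (p.Above L)) = {P, Q} := by
    ext R; simpa using h R
  rw [← Above.sum_ramificationIdx_mul_inertiaDeg p L, hu, Finset.sum_pair hne]

theorem Above.mul_le_finrank (P : p.Above L) :
    P.ramificationIdx * P.inertiaDeg ≤ Module.finrank K L := by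
  have := Above.finite p L
  have := Fintype.ofFinite (p.Above L)
  rw [← Above.sum_ramificationIdx_mul_inertiaDeg p L]
  exact Finset.single_le_sum (f := fun Q : p.Above L => Q.ramificationIdx * Q.inertiaDeg)
    (fun _ _ => Nat.zero_le _) (Finset.mem_univ P)

theorem Above.mul_add_mul_le_finrank {P Q : p.Above L} (hne : P ≠ Q) :
    P.ramificationIdx * P.inertiaDeg + Q.ramificationIdx * Q.inertiaDeg ≤
      Module.finrank K L := by
  classical
  have := Above.finite p L
  have := Fintype.ofFinite (p.Above L)
  rw [← Above.sum_ramificationIdx_mul_inertiaDeg p L, ← Finset.sum_pair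
    (f := fun Q : p.Above L => Q.ramificationIdx * Q.inertiaDeg) hne]
  exact Finset.sum_le_sum_of_subset (Finset.subset_univ _)

/-- A second place would contribute at least 1 to the sum ∑ e f, which `P` already exhausts. -/
theorem Above.eq_of_finrank_le_mul {P : p.Above L}
    (h : Module.finrank K L ≤ P.ramificationIdx * P.inertiaDeg) (Q : p.Above L) : Q = P := by
  by_contra hne
  have := Above.mul_add_mul_le_finrank hne
  have := mul_pos Q.ramificationIdx_pos Q.inertiaDeg_pos
  omega

section Quadratic

variable (h2 : Module.finrank K L = 2)
include h2

theorem isInert_of_inertiaDeg_eq_two {P : p.Above L} (h : P.inertiaDeg = 2) : p.IsInert L := by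
  have := P.ramificationIdx_pos
  refine ⟨P, Above.eq_of_finrank_le_mul ?_, h.trans h2.symm⟩
  rw [h2, h]
  omega

/-- `P` contributes 1 to ∑ e f = 2, which leaves room for exactly one other place. -/
theorem isCompletelySplit_of_eq_one {P : p.Above L} (he : P.ramificationIdx = 1)
    (hf : P.inertiaDeg = 1) : p.IsCompletelySplit L := by
  have := Above.finite p L
  rw [IsCompletelySplit, h2]
  have hex : ∃ Q, Q ≠ P := by
    by_contra! hall
    have := Above.mul_eq_finrank_of_forall_eq hall
    rw [he, hf, h2] at this
    omega
  obtain ⟨Q, hQ⟩ := hex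
  refine Nat.card_eq_two_iff.2 ⟨P, Q, hQ.symm, ?_⟩
  by_contra hall
  have hall : ∃ R, R ∉ ({P, Q} : Set (p.Above L)) := by
    by_contra! h
    exact hall (Set.eq_univ_of_forall h)
  obtain ⟨R, hR⟩ := hall
  rw [Set.mem_insert_iff, Set.mem_singleton_iff, not_or] at hR
  classical
  have := Fintype.ofFinite (p.Above L)
  have h3 := Finset.sum_le_sum_of_subset
    (f := fun Q : p.Above L => Q.ramificationIdx * Q.inertiaDeg) (Finset.subset_univ {R, P, Q})
  rw [Finset.sum_insert (by simp [hR.1, hR.2]), Finset.sum_pair hQ.symm,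
    Above.sum_ramificationIdx_mul_inertiaDeg, h2] at h3
  have := mul_pos R.ramificationIdx_pos R.inertiaDeg_pos
  have := mul_pos Q.ramificationIdx_pos Q.inertiaDeg_pos
  have := mul_pos P.ramificationIdx_pos P.inertiaDeg_pos
  omega

omit [FiniteDimensional K L] [Algebra.IsSeparable K L] in
theorem not_isInert_of_isCompletelySplit (h : p.IsCompletelySplit L) : ¬ p.IsInert L := by
  rintro ⟨P, hP, -⟩
  rw [IsCompletelySplit, h2, Nat.card_eq_two_iff] at h
  obtain ⟨Q, R, hne, -⟩ := h
  exact hne ((hP Q).trans (hP R).symm)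

theorem not_isRamified_of_isCompletelySplit (h : p.IsCompletelySplit L) : ¬ p.IsRamified L := by
  rintro ⟨P, hP⟩
  have hle : Module.finrank K L ≤ P.ramificationIdx * P.inertiaDeg := by
    have := P.inertiaDeg_pos
    rw [h2]
    nlinarith
  have hall := Above.eq_of_finrank_le_mul hle
  rw [IsCompletelySplit, h2, Nat.card_eq_two_iff] at h
  obtain ⟨Q, R, hne, -⟩ := h
  exact hne ((hall Q).trans (hall R).symm)

theorem not_isRamified_of_isInert (h : p.IsInert L) : ¬ p.IsRamified L := by
  rintro ⟨Q, hQ⟩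
  obtain ⟨P, hP, hf⟩ := h
  obtain rfl := hP Q
  have := Q.mul_le_finrank
  rw [hf, h2] at this
  omega

end Quadratic

section Cubic

variable (h3 : Module.finrank K L = 3)
include h3

variable (p L) in
/-- The possible signatures in a cubic extension. -/
theorem hasSignature_of_finrank_eq_three :
    p.HasSignature L [(1, 1), (1, 1), (1, 1)] ∨ p.HasSignature L [(1, 1), (1, 2)] ∨
      p.HasSignature L [(2, 1), (1, 1)] ∨ p.HasSignature L [(1, 3)] ∨
      p.HasSignature L [(3, 1)] := by
  have := Above.finite p L
  have := Fintype.ofFinite (p.Above L)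
  obtain ⟨n, ⟨E⟩⟩ := Finite.exists_equiv_fin (p.Above L)
  have hsum := Above.sum_ramificationIdx_mul_inertiaDeg p L
  rw [h3, ← E.symm.sum_comp] at hsum
  have hpos : ∀ i, 0 < (E.symm i).ramificationIdx ∧ 0 < (E.symm i).inertiaDeg := fun i =>
    ⟨(E.symm i).ramificationIdx_pos, (E.symm i).inertiaDeg_pos⟩
  have hone : ∀ i, 1 ≤ (E.symm i).ramificationIdx * (E.symm i).inertiaDeg := fun i =>
    Nat.mul_pos (hpos i).1 (hpos i).2
  have hn : n ≤ 3 := by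
    have := Finset.sum_le_sum fun i (_ : i ∈ (Finset.univ : Finset (Fin n))) => hone i
    rw [hsum] at this
    simpa using this
  have hmul1 : ∀ {a b : ℕ}, a * b = 1 → (a, b) = (1, 1) := fun {a b} h => by
    rw [Nat.eq_one_of_mul_eq_one_right h, Nat.eq_one_of_mul_eq_one_left h]
  have hmulp : ∀ {a b q : ℕ}, q.Prime → a * b = q → (a, b) = (1, q) ∨ (a, b) = (q, 1) := by
    intro a b q hq h
    rcases (Nat.dvd_prime hq).1 (Dvd.intro _ h) with rfl | rfl
    · exact Or.inl (by rw [one_mul] at h; rw [h])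
    · exact Or.inr (by rw [Nat.eq_of_mul_eq_mul_left hq.pos (h.trans (mul_one _).symm)])
  -- Each place contributes a product e f ≥ 1 to the sum 3, so the products are 3, or 1 and 2, or 1,
  -- 1, 1; since 2 and 3 are prime, each splits into (e, f) in two ways only.
  interval_cases n
  · simp at hsum
  · rw [Fin.sum_univ_one] at hsum
    rcases hmulp Nat.prime_three hsum with h | h
    · refine Or.inr <| Or.inr <| Or.inr <| Or.inl <| hasSignature_of_forall rfl E.symm fun i => ?_
      fin_cases i
      exact h
    · refine Or.inr <| Or.inr <| Or.inr <| Or.inr <| hasSignature_of_forall rfl E.symm fun i => ?_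
      fin_cases i
      exact h
  · rw [Fin.sum_univ_two] at hsum
    have h0 := hone 0
    have h1 := hone 1
    have hcase : ((E.symm 0).ramificationIdx * (E.symm 0).inertiaDeg = 1 ∧
        (E.symm 1).ramificationIdx * (E.symm 1).inertiaDeg = 2) ∨
        ((E.symm 0).ramificationIdx * (E.symm 0).inertiaDeg = 2 ∧
        (E.symm 1).ramificationIdx * (E.symm 1).inertiaDeg = 1) := by omega
    have hmk : ∀ {a b : ℕ × ℕ},
        ((E.symm 0).ramificationIdx, (E.symm 0).inertiaDeg) = a →
        ((E.symm 1).ramificationIdx, (E.symm 1).inertiaDeg) = b → p.HasSignature L [a, b] := by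
      intro a b ha hb
      refine hasSignature_of_forall rfl E.symm fun i => ?_
      fin_cases i
      · exact ha
      · exact hb
    rcases hcase with ⟨ha, hb⟩ | ⟨ha, hb⟩
    · rcases hmulp Nat.prime_two hb with h | h
      · exact Or.inr <| Or.inl <| hmk (hmul1 ha) h
      · exact Or.inr <| Or.inr <| Or.inl <| (hmk (hmul1 ha) h).swap
    · rcases hmulp Nat.prime_two ha with h | h
      · exact Or.inr <| Or.inl <| (hmk h (hmul1 hb)).swap
      · exact Or.inr <| Or.inr <| Or.inl <| hmk h (hmul1 hb)
  · rw [Fin.sum_univ_three] at hsum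
    have h0 := hone 0
    have h1 := hone 1
    have h2 := hone 2
    have key : (E.symm 0).ramificationIdx * (E.symm 0).inertiaDeg = 1 ∧
        (E.symm 1).ramificationIdx * (E.symm 1).inertiaDeg = 1 ∧
        (E.symm 2).ramificationIdx * (E.symm 2).inertiaDeg = 1 := by omega
    refine Or.inl <| hasSignature_of_forall rfl E.symm fun i => ?_
    fin_cases i
    · exact hmul1 key.1
    · exact hmul1 key.2.1
    · exact hmul1 key.2.2

theorem isCompletelySplit_iff_hasSignature :
    p.IsCompletelySplit L ↔ p.HasSignature L [(1, 1), (1, 1), (1, 1)] := by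
  rw [IsCompletelySplit, h3]
  constructor
  · intro hc
    rcases hasSignature_of_finrank_eq_three p L h3 with h | h | h | h | h
    · exact h
    all_goals
      have := h.card_eq
      rw [hc] at this
      simp at this
  · intro h
    exact h.card_eq

theorem isInert_iff_hasSignature : p.IsInert L ↔ p.HasSignature L [(1, 3)] := by
  rw [hasSignature_singleton_iff]
  refine exists_congr fun P => and_congr_right fun hP => ?_
  have h := Above.mul_eq_finrank_of_forall_eq hP
  rw [h3] at h ⊢
  constructor
  · intro hf
    rw [hf] at h ⊢
    rw [show P.ramificationIdx = 1 by omega]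
  · intro he
    exact (Prod.ext_iff.1 he).2

theorem isFullyRamified_iff_hasSignature : p.IsFullyRamified L ↔ p.HasSignature L [(3, 1)] := by
  rw [hasSignature_singleton_iff]
  refine exists_congr fun P => ?_
  rw [h3]
  constructor
  · intro he
    have h1 := P.mul_le_finrank
    have h2 := P.inertiaDeg_pos
    rw [h3, he] at h1
    have hf : P.inertiaDeg = 1 := by omega
    refine ⟨Above.eq_of_finrank_le_mul (by rw [he, hf, h3]), by rw [he, hf]⟩
  · rintro ⟨-, he⟩
    exact (Prod.ext_iff.1 he).1

theorem exists_unique_ramificationIdx_eq_three_iff :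
    (∃ P : p.Above L, (∀ Q, Q = P) ∧ P.ramificationIdx = 3) ↔ p.HasSignature L [(3, 1)] := by
  rw [hasSignature_singleton_iff]
  refine exists_congr fun P => and_congr_right fun hP => ?_
  have h := Above.mul_eq_finrank_of_forall_eq hP
  rw [h3] at h
  constructor
  · intro he
    rw [he] at h ⊢
    rw [show P.inertiaDeg = 1 by omega]
  · intro he
    exact (Prod.ext_iff.1 he).1

theorem inertiaDeg_of_pair_unramified {P Q : p.Above L} (hne : P ≠ Q) (hall : ∀ R, R = P ∨ R = Q)
    (hP : P.ramificationIdx = 1) (hQ : Q.ramificationIdx = 1) :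
    (P.inertiaDeg = 1 ∧ Q.inertiaDeg = 2) ∨ (Q.inertiaDeg = 1 ∧ P.inertiaDeg = 2) := by
  have h := Above.mul_add_mul_eq_finrank hne hall
  have := P.inertiaDeg_pos
  have := Q.inertiaDeg_pos
  rw [h3, hP, hQ] at h
  omega

theorem inertiaDeg_of_pair_ramified {P Q : p.Above L} (hne : P ≠ Q) (hall : ∀ R, R = P ∨ R = Q)
    (hP : P.ramificationIdx = 2) (hQ : Q.ramificationIdx = 1) :
    P.inertiaDeg = 1 ∧ Q.inertiaDeg = 1 := by
  have h := Above.mul_add_mul_eq_finrank hne hall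
  have := P.inertiaDeg_pos
  have := Q.inertiaDeg_pos
  rw [h3, hP, hQ] at h
  omega

/-- An ideal factorisation shows only ramification indices; here they determine the inertia degrees
up to order, since two positive integers with sum 3 are 1 and 2. -/
theorem exists_pair_unramified_iff :
    (∃ P Q : p.Above L, P ≠ Q ∧ (∀ R, R = P ∨ R = Q) ∧ P.ramificationIdx = 1 ∧
      Q.ramificationIdx = 1) ↔ p.HasSignature L [(1, 1), (1, 2)] := by
  constructor
  · rintro ⟨P, Q, hne, hall, hP, hQ⟩
    rcases inertiaDeg_of_pair_unramified h3 hne hall hP hQ with ⟨h1, h2⟩ | ⟨h1, h2⟩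
    · exact hasSignature_pair_iff.2 ⟨P, Q, hne, hall, by rw [hP, h1], by rw [hQ, h2]⟩
    · exact hasSignature_pair_iff.2
        ⟨Q, P, hne.symm, fun R => (hall R).symm, by rw [hQ, h1], by rw [hP, h2]⟩
  · rw [hasSignature_pair_iff]
    rintro ⟨P, Q, hne, hall, hP, hQ⟩
    exact ⟨P, Q, hne, hall, (Prod.ext_iff.1 hP).1, (Prod.ext_iff.1 hQ).1⟩

theorem exists_pair_ramified_iff :
    (∃ P Q : p.Above L, P ≠ Q ∧ (∀ R, R = P ∨ R = Q) ∧ P.ramificationIdx = 2 ∧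
      Q.ramificationIdx = 1) ↔ p.HasSignature L [(2, 1), (1, 1)] := by
  constructor
  · rintro ⟨P, Q, hne, hall, hP, hQ⟩
    obtain ⟨h1, h2⟩ := inertiaDeg_of_pair_ramified h3 hne hall hP hQ
    exact hasSignature_pair_iff.2 ⟨P, Q, hne, hall, by rw [hP, h1], by rw [hQ, h2]⟩
  · rw [hasSignature_pair_iff]
    rintro ⟨P, Q, hne, hall, hP, hQ⟩
    exact ⟨P, Q, hne, hall, (Prod.ext_iff.1 hP).1, (Prod.ext_iff.1 hQ).1⟩

end Cubic

end Signature

end Place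

end

/-! ### Decomposition in a Galois extension with cubic and quadratic subfields. -/

noncomputable section

open WithZero IsDedekindDomain

namespace Place

section Galois

variable {K L M N : Type*} [Field K] [Field L] [Field M] [Field N] [Algebra K L] [Algebra K M]
  [Algebra K N] [Algebra L N] [Algebra M N] [IsScalarTower K L N] [IsScalarTower K M N]
  [FiniteDimensional K L] [FiniteDimensional K M] [FiniteDimensional L N] [FiniteDimensional M N]
  [Algebra.IsSeparable K L] [Algebra.IsSeparable K M] [FiniteDimensional K N] [IsGalois K N]
  {p : Place K}

omit [FiniteDimensional K N] in
/-- The signature `(1, 1)` at one place of a Galois closure forces a place of a subextension to be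
unramified of degree one. -/
theorem exists_above_of_trans_eq_one (P : p.Above L) (Q : P.1.Above N)
    (hPe : P.ramificationIdx = 1) (hPf : P.inertiaDeg = 1) (hQe : Q.ramificationIdx = 1)
    (hQf : Q.inertiaDeg = 1) : ∃ m : p.Above M, m.ramificationIdx = 1 ∧ m.inertiaDeg = 1 := by
  have := IsGalois.tower_top_of_isGalois K L N
  have := IsGalois.tower_top_of_isGalois K M N
  obtain ⟨m, Q', hQ'⟩ := Above.exists_trans_eq (L := M) (P.trans Q)
  have he := Above.ramificationIdx_trans m Q'
  have hf := Above.inertiaDeg_trans m Q'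
  rw [hQ', Above.ramificationIdx_trans, hPe, hQe] at he
  rw [hQ', Above.inertiaDeg_trans, hPf, hQf] at hf
  exact ⟨m, Nat.eq_one_of_mul_eq_one_right he.symm, Nat.eq_one_of_mul_eq_one_right hf.symm⟩

omit [FiniteDimensional K N] in
theorem isCompletelySplit_of_trans_eq_one (hM : Module.finrank K M = 2) (P : p.Above L)
    (Q : P.1.Above N) (hPe : P.ramificationIdx = 1) (hPf : P.inertiaDeg = 1)
    (hQe : Q.ramificationIdx = 1) (hQf : Q.inertiaDeg = 1) : p.IsCompletelySplit M := by
  obtain ⟨m, h1, h2⟩ := exists_above_of_trans_eq_one (M := M) P Q hPe hPf hQe hQf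
  exact isCompletelySplit_of_eq_one hM h1 h2

variable (hLN : Module.finrank L N = 2) (hMN : Module.finrank M N = 3)
include hLN

omit [FiniteDimensional K M] [FiniteDimensional M N] [Algebra.IsSeparable K M] [Algebra M N]
  [Algebra K M] [IsScalarTower K M N] in
-- All places of the Galois extension `N` above `p` share one f, so a place Q₁ above `P₁` and a
-- place Q₂ above `P₂` satisfy f(Q₁) = 2 f(Q₂). As e f ≤ 2 in N/L, this gives f(Q₁) = 2 and f(Q₂) =
-- 1, both unramified.
theorem isInert_and_isCompletelySplit_of_unramified {P₁ P₂ : p.Above L}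
    (h1 : P₁.inertiaDeg = 1) (h2 : P₂.inertiaDeg = 2)
    (h1e : P₁.ramificationIdx = 1) (h2e : P₂.ramificationIdx = 1) :
    P₁.1.IsInert N ∧ P₂.1.IsCompletelySplit N ∧
      ∀ Q : p.Above N, Q.ramificationIdx = 1 ∧ Q.inertiaDeg = 2 := by
  have := IsGalois.tower_top_of_isGalois K L N
  obtain ⟨Q₁⟩ := Above.nonempty P₁.1 N
  obtain ⟨Q₂⟩ := Above.nonempty P₂.1 N
  have hu := Above.ramificationIdx_eq_and_inertiaDeg_eq_of_isGalois (P₁.trans Q₁) (P₂.trans Q₂)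
  rw [Above.ramificationIdx_trans, Above.ramificationIdx_trans, Above.inertiaDeg_trans,
    Above.inertiaDeg_trans, h1, h2, h1e, h2e, one_mul, one_mul, one_mul] at hu
  have hle := Q₁.mul_le_finrank
  rw [hLN] at hle
  have := Q₁.ramificationIdx_pos
  have := Q₁.inertiaDeg_pos
  have := Q₂.ramificationIdx_pos
  have := Q₂.inertiaDeg_pos
  have hf1 : Q₁.inertiaDeg = 2 := by nlinarith
  have he1 : Q₁.ramificationIdx = 1 := by nlinarith
  refine ⟨isInert_of_inertiaDeg_eq_two hLN hf1,
    isCompletelySplit_of_eq_one (P := Q₂) hLN (by omega) (by omega), fun Q => ?_⟩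
  have hQ := Above.ramificationIdx_eq_and_inertiaDeg_eq_of_isGalois Q (P₁.trans Q₁)
  rw [Above.ramificationIdx_trans, Above.inertiaDeg_trans, h1, h1e, hf1, he1] at hQ
  exact hQ

omit [FiniteDimensional K M] [FiniteDimensional M N] [Algebra.IsSeparable K M] [Algebra M N]
  [Algebra K M] [IsScalarTower K M N] in
-- The same comparison with e in place of f: now 2 e(Q₁) = e(Q₂) for Q₁ above `P₁` and Q₂ above
-- `P₂`.
theorem isCompletelySplit_and_isRamified_of_ramified {P₁ P₂ : p.Above L}
    (h1 : P₁.inertiaDeg = 1) (h2 : P₂.inertiaDeg = 1)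
    (h1e : P₁.ramificationIdx = 2) (h2e : P₂.ramificationIdx = 1) :
    P₁.1.IsCompletelySplit N ∧ P₂.1.IsRamified N ∧
      ∀ Q : p.Above N, Q.ramificationIdx = 2 ∧ Q.inertiaDeg = 1 := by
  have := IsGalois.tower_top_of_isGalois K L N
  obtain ⟨Q₁⟩ := Above.nonempty P₁.1 N
  obtain ⟨Q₂⟩ := Above.nonempty P₂.1 N
  have hu := Above.ramificationIdx_eq_and_inertiaDeg_eq_of_isGalois (P₁.trans Q₁) (P₂.trans Q₂)
  rw [Above.ramificationIdx_trans, Above.ramificationIdx_trans, Above.inertiaDeg_trans,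
    Above.inertiaDeg_trans, h1, h2, h1e, h2e, one_mul, one_mul, one_mul] at hu
  have hle := Q₂.mul_le_finrank
  rw [hLN] at hle
  have := Q₁.ramificationIdx_pos
  have := Q₁.inertiaDeg_pos
  have := Q₂.ramificationIdx_pos
  have := Q₂.inertiaDeg_pos
  have he2 : Q₂.ramificationIdx = 2 := by nlinarith
  have hf2 : Q₂.inertiaDeg = 1 := by nlinarith
  refine ⟨isCompletelySplit_of_eq_one (P := Q₁) hLN (by omega) (by omega),
    ⟨Q₂, by omega⟩, fun Q => ?_⟩
  have hQ := Above.ramificationIdx_eq_and_inertiaDeg_eq_of_isGalois Q (P₂.trans Q₂)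
  rw [Above.ramificationIdx_trans, Above.inertiaDeg_trans, h2, h2e, hf2, he2] at hQ
  exact hQ

include hMN

/-- If `p` has two unramified places in a cubic extension, it is inert in the quadratic subfield
of the Galois closure. -/
theorem isInert_of_hasSignature (hM : Module.finrank K M = 2)
    (h : p.HasSignature L [(1, 1), (1, 2)]) : p.IsInert M := by
  have := IsGalois.tower_top_of_isGalois K M N
  obtain ⟨P₁, P₂, -, -, hP1, hP2⟩ := hasSignature_pair_iff.1 h
  rw [Prod.ext_iff] at hP1 hP2
  have hall := (isInert_and_isCompletelySplit_of_unramified (N := N) hLN hP1.2 hP2.2 hP1.1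
    hP2.1).2.2
  obtain ⟨m⟩ := Above.nonempty p M
  obtain ⟨Q⟩ := Above.nonempty m.1 N
  have hf := (hall (m.trans Q)).2
  rw [Above.inertiaDeg_trans] at hf
  have hQ := Above.card_mul_eq_finrank_of_isGalois Q
  rw [hMN] at hQ
  -- The inertia degree 2 over `p` is f(m) f(Q), and f(Q) divides 3 because N/M is Galois of degree
  -- 3; so f(Q) = 1 and f(m) = 2.
  have hdvd : Q.inertiaDeg ∣ 3 := hQ ▸ (dvd_mul_left _ _).mul_left _
  have hm : m.inertiaDeg = 2 := by
    rcases (Nat.dvd_prime Nat.prime_three).1 hdvd with h | h <;> rw [h] at hf <;> omega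
  exact isInert_of_inertiaDeg_eq_two hM hm

/-- If `p` is partially ramified in a cubic extension, it is ramified in the quadratic subfield
of the Galois closure. -/
theorem isRamified_of_hasSignature (h : p.HasSignature L [(2, 1), (1, 1)]) : p.IsRamified M := by
  have := IsGalois.tower_top_of_isGalois K M N
  obtain ⟨P₁, P₂, -, -, hP1, hP2⟩ := hasSignature_pair_iff.1 h
  rw [Prod.ext_iff] at hP1 hP2
  have hall := (isCompletelySplit_and_isRamified_of_ramified (N := N) hLN hP1.2 hP2.2 hP1.1
    hP2.1).2.2
  obtain ⟨m⟩ := Above.nonempty p M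
  obtain ⟨Q⟩ := Above.nonempty m.1 N
  have he := (hall (m.trans Q)).1
  rw [Above.ramificationIdx_trans] at he
  have hQ := Above.card_mul_eq_finrank_of_isGalois Q
  rw [hMN] at hQ
  -- Since e(Q) divides 3 while e(m) e(Q) = 2, all the ramification happens in M/K.
  have hdvd : Q.ramificationIdx ∣ 3 := hQ ▸ (dvd_mul_right _ _).mul_left _
  refine ⟨m, ?_⟩
  rcases (Nat.dvd_prime Nat.prime_three).1 hdvd with h | h <;> rw [h] at he <;> omega

end Galois

/-- In a Galois extension of prime degree, the signatures `(1, 1; 1, 2)` and `(2, 1; 1, 1)` do not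
occur. -/
theorem not_hasSignature_of_isGalois {K L : Type*} [Field K] [Field L] [Algebra K L]
    [FiniteDimensional K L] [IsGalois K L] {p : Place K} {a b : ℕ × ℕ} (hab : a ≠ b) :
    ¬ p.HasSignature L [a, b] := by
  rw [hasSignature_pair_iff]
  rintro ⟨P, Q, -, -, hP, hQ⟩
  have h := Above.ramificationIdx_eq_and_inertiaDeg_eq_of_isGalois P Q
  rw [h.1, h.2, hQ] at hP
  exact hab hP.symm

end Place

end

/-! ### The cubic, its quadratic resolvent and the Galois closure. -/

noncomputable section

section CubicPoly

theorem cubicPoly_monic {R : Type*} [CommRing R] [Nontrivial R] (a : R) :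
    (cubicPoly a).Monic ∧ (cubicPoly a).natDegree = 3 := by
  have h : cubicPoly a = X ^ 3 - (C 3 * X + C a) := by
    rw [cubicPoly, map_ofNat]; ring
  have hd : (C 3 * X + C a : R[X]).degree < (3 : ℕ) :=
    degree_linear_le.trans_lt (by norm_num)
  constructor
  · rw [h]
    exact monic_X_pow_sub hd
  · rw [h, natDegree_sub_eq_left_of_natDegree_lt, natDegree_X_pow]
    rw [natDegree_X_pow]
    exact (natDegree_linear_le).trans_lt (by norm_num)

theorem map_cubicPoly {R S : Type*} [CommRing R] [CommRing S] (φ : R →+* S) (a : R) :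
    (cubicPoly a).map φ = cubicPoly (φ a) := by
  simp [cubicPoly]

theorem aeval_cubicPoly {R S : Type*} [CommRing R] [CommRing S] [Algebra R S] (a : R) (z : S) :
    aeval z (cubicPoly a) = z ^ 3 - 3 * z - algebraMap R S a := by
  simp [cubicPoly, map_ofNat (aeval (R := R) z) 3]

end CubicPoly

section Fields

variable {K L : Type*} [Field K] [Field L] [Algebra K L] {a : K} {y : L}

theorem finrank_eq_three (hy : K⟮y⟯ = ⊤) (hmin : minpoly K y = cubicPoly a) :
    Module.finrank K L = 3 := by
  have hint : IsIntegral K y := by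
    rw [← minpoly.ne_zero_iff, hmin]
    exact (cubicPoly_monic a).1.ne_zero
  rw [← IntermediateField.finrank_top', ← hy, IntermediateField.adjoin.finrank hint, hmin,
    (cubicPoly_monic a).2]

theorem finiteDimensional_of_minpoly_eq_cubicPoly (hy : K⟮y⟯ = ⊤)
    (hmin : minpoly K y = cubicPoly a) : FiniteDimensional K L :=
  Module.finite_of_finrank_pos (by rw [finrank_eq_three hy hmin]; norm_num)

theorem cubicPoly_root (hmin : minpoly K y = cubicPoly a) : y ^ 3 = 3 * y + algebraMap K L a := by
  have h := minpoly.aeval K y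
  rw [hmin, aeval_cubicPoly] at h
  linear_combination h

/-- The derivative has leading coefficient 3, so an irreducible cubic of this form is separable
outside characteristic 3, also in characteristic 2. -/
theorem cubicPoly_separable (hy : K⟮y⟯ = ⊤) (hmin : minpoly K y = cubicPoly a)
    (h3 : (3 : K) ≠ 0) : (cubicPoly a).Separable := by
  have := finiteDimensional_of_minpoly_eq_cubicPoly hy hmin
  have hirr : Irreducible (cubicPoly a) := hmin ▸ minpoly.irreducible (Algebra.IsIntegral.isIntegral y)
  rw [separable_iff_derivative_ne_zero hirr]
  intro h0
  have h := congrArg (fun q => coeff q 2) h0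
  have h1 := (cubicPoly_monic a).1.coeff_natDegree
  rw [(cubicPoly_monic a).2] at h1
  simp only [coeff_derivative, coeff_zero, h1] at h
  apply h3
  push_cast at h
  linear_combination h

theorem isSeparable_of_minpoly_eq_cubicPoly (hy : K⟮y⟯ = ⊤) (hmin : minpoly K y = cubicPoly a)
    (h3 : (3 : K) ≠ 0) : Algebra.IsSeparable K L := by
  have h1 : IsSeparable K y := by
    rw [IsSeparable, hmin]
    exact cubicPoly_separable hy hmin h3
  have h2 := (isSeparable_adjoin_simple_iff_isSeparable K L).2 h1
  rw [hy] at h2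
  exact AlgEquiv.Algebra.isSeparable (topEquiv (F := K) (E := L))

/-- An element of degree 3 is not a root of X² - 1. The quantity y² - 1 is the denominator when
another root is recovered from y and r. -/
theorem sq_ne_one_of_minpoly_eq_cubicPoly (hmin : minpoly K y = cubicPoly a) : y ^ 2 - 1 ≠ 0 := by
  intro h
  have h1 : (X ^ 2 - C (1 : K)).natDegree = 2 := natDegree_X_pow_sub_C
  have h2 : minpoly K y ∣ X ^ 2 - C (1 : K) := minpoly.dvd K y (by simpa using h)
  have h3 := natDegree_le_of_dvd h2 (by rintro h0; rw [h0] at h1; simp at h1)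
  rw [hmin, (cubicPoly_monic a).2, h1] at h3
  omega

section Closure

variable {N : Type*} [Field N] [Algebra K N] [Algebra L N] [IsScalarTower K L N] {ρ : N}

/-- The second root of the cubic, expressed by the first and a root of the quadratic resolvent. -/
theorem exists_second_root (hmin : minpoly K y = cubicPoly a) (h3 : (3 : K) ≠ 0)
    (hρ : ρ ^ 2 + 3 * algebraMap K N a * ρ + (-27 + 9 * algebraMap K N a ^ 2) = 0) :
    ∃ t : N, ρ = 3 * ((algebraMap L N y ^ 2 - 1) * t + algebraMap L N y) ∧
      t ^ 2 + algebraMap L N y * t + (algebraMap L N y ^ 2 - 3) = 0 := by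
  have h3N : (3 : N) ≠ 0 := by
    have := (_root_.map_ne_zero (algebraMap K N)).2 h3
    rwa [map_ofNat] at this
  set Y := algebraMap L N y with hY
  have hy1 : Y ^ 2 - 1 ≠ 0 := by
    have := (_root_.map_ne_zero (algebraMap L N)).2 (sq_ne_one_of_minpoly_eq_cubicPoly hmin)
    simpa using this
  have hYa : algebraMap K N a = Y ^ 3 - 3 * Y := by
    have h := congrArg (algebraMap L N) (cubicPoly_root hmin)
    simp only [map_pow, map_add, map_mul, map_ofNat, ← IsScalarTower.algebraMap_apply] at h
    linear_combination -h
  rw [hYa] at hρ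
  -- For roots Y, t, s = -Y - t of the cubic, the resolvent root is the cyclic sum Y²t + t²s + s²Y,
  -- which simplifies to 3((Y² - 1)t + Y). Solving this for t gives the witness.
  refine ⟨(ρ / 3 - Y) / (Y ^ 2 - 1), ?_, ?_⟩
  · field_simp
    ring
  · field_simp
    linear_combination hρ

/-- A field generated over `L` by a root of the quadratic resolvent is Galois over `K`. -/
theorem isGalois_of_resolvent_root (hy : K⟮y⟯ = ⊤) (hmin : minpoly K y = cubicPoly a)
    (h3 : (3 : K) ≠ 0)
    (hρ : ρ ^ 2 + 3 * algebraMap K N a * ρ + (-27 + 9 * algebraMap K N a ^ 2) = 0)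
    (hgen : ∀ F : IntermediateField L N, ρ ∈ F → F = ⊤) : IsGalois K N := by
  obtain ⟨t, ht, ht2⟩ := exists_second_root (L := L) hmin h3 hρ
  set Y := algebraMap L N y with hY
  have hYa : algebraMap K N a = Y ^ 3 - 3 * Y := by
    have h := congrArg (algebraMap L N) (cubicPoly_root hmin)
    simp only [map_pow, map_add, map_mul, map_ofNat, ← IsScalarTower.algebraMap_apply] at h
    linear_combination -h
  have hfac : (cubicPoly a).map (algebraMap K N) = (X - C Y) * (X - C t) * (X - C (-Y - t)) := by
    rw [map_cubicPoly, hYa, cubicPoly]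
    have h := congrArg C ht2
    simp only [map_add, map_mul, map_pow, map_sub, map_ofNat, map_zero] at h
    simp only [map_sub, map_neg, map_mul, map_pow, map_ofNat]
    linear_combination (X - C Y) * h
  have hmem : ∀ z : N, (X - C z) ∣ (cubicPoly a).map (algebraMap K N) →
      z ∈ (cubicPoly a).rootSet N := by
    intro z hz
    rw [mem_rootSet_of_ne (cubicPoly_monic a).1.ne_zero, ← eval_map_algebraMap]
    exact dvd_iff_isRoot.1 hz
  have hYr := hmem Y (hfac ▸ (dvd_mul_right _ _).mul_right _)
  have htr := hmem t (hfac ▸ (dvd_mul_left _ _).mul_right _)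
  have : IsSplittingField K N (cubicPoly a) := by
    rw [isSplittingField_iff_intermediateField]
    constructor
    · rw [hfac]
      exact ((Splits.X_sub_C _).mul (Splits.X_sub_C _)).mul (Splits.X_sub_C _)
    · set F := adjoin K ((cubicPoly a).rootSet N) with hF
      have hYF : Y ∈ F := subset_adjoin _ _ hYr
      have htF : t ∈ F := subset_adjoin _ _ htr
      -- The field F generated over K by the roots contains Y, hence L; it contains t as well, hence
      -- ρ, so the generation hypothesis gives F = N.
      have hLF : ∀ l : L, algebraMap L N l ∈ F := by
        have h1 : (K⟮y⟯ : IntermediateField K L) ≤ F.comap (IsScalarTower.toAlgHom K L N) :=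
          adjoin_simple_le_iff.2 hYF
        rw [hy] at h1
        exact fun l => h1 (mem_top (x := l))
      let F' : IntermediateField L N := { F with algebraMap_mem' := hLF }
      have hρF : ρ ∈ F' := by
        change ρ ∈ F
        rw [ht]
        exact mul_mem (ofNat_mem F 3) (add_mem (mul_mem (sub_mem (pow_mem hYF 2) (one_mem _)) htF) hYF)
      have := hgen F' hρF
      refine eq_top_iff.2 fun z _ => ?_
      have hz : z ∈ F' := this ▸ mem_top
      exact hz
  exact IsGalois.of_separable_splitting_field (cubicPoly_separable hy hmin h3)

end Closure

section Resolvent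

variable {Ω : Type*} [Field Ω] [Algebra K Ω] [Algebra L Ω] [IsScalarTower K L Ω] {r : Ω}

theorem eq_top_of_gen_mem {F : IntermediateField L L⟮r⟯} (h : AdjoinSimple.gen L r ∈ F) :
    F = ⊤ := by
  have h1 : L⟮r⟯ ≤ lift F := by
    rw [adjoin_simple_le_iff]
    exact (mem_lift (AdjoinSimple.gen L r)).2 h
  exact eq_top_iff.2 fun z _ => (mem_lift z).1 (h1 z.2)

theorem finrank_adjoin_eq_two {F : Type*} [Field F] [Algebra F Ω] {b c : F}
    (hr : r ^ 2 + algebraMap F Ω b * r + algebraMap F Ω c = 0)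
    (hrF : r ∉ Set.range (algebraMap F Ω)) : Module.finrank F F⟮r⟯ = 2 := by
  have haev : aeval r (X ^ 2 + C b * X + C c) = 0 := by simpa using hr
  have hdeg : (X ^ 2 + C b * X + C c : F[X]).natDegree = 2 := by
    have := natDegree_quadratic (a := (1 : F)) (b := b) (c := c) one_ne_zero
    rwa [C_1, one_mul] at this
  have hne : (X ^ 2 + C b * X + C c : F[X]) ≠ 0 := by
    rintro h0; rw [h0] at hdeg; simp at hdeg
  have hint : IsIntegral F r := IsAlgebraic.isIntegral ⟨_, hne, haev⟩
  rw [adjoin.finrank hint]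
  have h1 := natDegree_le_of_dvd (minpoly.dvd F r haev) hne
  have h2 := minpoly.natDegree_pos hint
  have h3 : (minpoly F r).natDegree ≠ 1 := fun h => hrF (minpoly.natDegree_eq_one_iff.1 h)
  omega

variable (hy : K⟮y⟯ = ⊤) (hmin : minpoly K y = cubicPoly a)
  (hr : r ^ 2 + 3 * algebraMap K Ω a * r + (-27 + 9 * algebraMap K Ω a ^ 2) = 0)
include hr

theorem finrank_resolvent_eq_two (hrK : r ∉ Set.range (algebraMap K Ω)) :
    Module.finrank K K⟮r⟯ = 2 :=
  finrank_adjoin_eq_two (b := 3 * a) (c := -27 + 9 * a ^ 2) (by simp only [map_add, map_mul, map_pow, map_neg, map_ofNat]; exact hr) hrK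

include hy hmin

/-- An element of degree 2 over `K` cannot lie in an extension of degree 3. -/
theorem notMem_range_of_notMem_range (hrK : r ∉ Set.range (algebraMap K Ω)) :
    r ∉ Set.range (algebraMap L Ω) := by
  have := finiteDimensional_of_minpoly_eq_cubicPoly hy hmin
  rintro ⟨l, rfl⟩
  have h2 := finrank_resolvent_eq_two hr hrK
  have hint : IsIntegral K l := Algebra.IsIntegral.isIntegral l
  have hint' : IsIntegral K (algebraMap L Ω l) := hint.map (IsScalarTower.toAlgHom K L Ω)
  rw [adjoin.finrank hint'] at h2
  have h4 := minpoly.algebraMap_eq (A := K) (algebraMap L Ω).injective l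
  have h3 := minpoly.degree_dvd hint
  rw [finrank_eq_three hy hmin, ← h4, h2] at h3
  omega

theorem finrank_adjoin_resolvent_eq_two (hrK : r ∉ Set.range (algebraMap K Ω)) :
    Module.finrank L L⟮r⟯ = 2 :=
  finrank_adjoin_eq_two (b := algebraMap K L (3 * a)) (c := algebraMap K L (-27 + 9 * a ^ 2))
    (by
      simp only [← IsScalarTower.algebraMap_apply, map_add, map_mul, map_pow, map_neg, map_ofNat]
      exact hr)
    (notMem_range_of_notMem_range hy hmin hr hrK)

theorem isGalois_adjoin_resolvent (h3 : (3 : K) ≠ 0) : IsGalois K L⟮r⟯ := by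
  refine isGalois_of_resolvent_root (L := L) (ρ := AdjoinSimple.gen L r) hy hmin h3 ?_
    fun F hF => eq_top_of_gen_mem hF
  apply (algebraMap L⟮r⟯ Ω).injective
  simp only [map_add, map_mul, map_pow, map_neg, map_ofNat, map_zero,
    AdjoinSimple.algebraMap_gen]
  exact hr

theorem isGalois_of_mem_range (h3 : (3 : K) ≠ 0) (hrK : r ∈ Set.range (algebraMap K Ω)) :
    IsGalois K L := by
  obtain ⟨s, rfl⟩ := hrK
  refine isGalois_of_resolvent_root (L := L) (N := L) (ρ := algebraMap K L s) hy hmin h3 ?_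
    fun F _ => eq_top_iff.2 fun z _ => F.algebraMap_mem z
  apply (algebraMap L Ω).injective
  simp only [map_add, map_mul, map_pow, map_neg, map_ofNat, map_zero,
    ← IsScalarTower.algebraMap_apply]
  exact hr

end Resolvent

end Fields

end

/-! ### Factorisation types modulo a place with integral `a`. -/

noncomputable section

section FactorTypes

variable {F : Type*} [Field F]

theorem isCoprime_X_sub_C {α β : F} (h : α ≠ β) : IsCoprime (X - C α) (X - C β) :=
  isCoprime_X_sub_C_of_isUnit_sub (sub_ne_zero.2 h).isUnit

theorem isCoprime_X_sub_C_of_irreducible {α : F} {Q : F[X]} (hQ : Irreducible Q)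
    (hdeg : Q.natDegree = 2) : IsCoprime (X - C α) Q := by
  refine ((irreducible_X_sub_C α).coprime_iff_not_dvd).2 fun hdvd => ?_
  obtain ⟨c, rfl⟩ := hdvd
  rcases hQ.isUnit_or_isUnit rfl with h | h
  · exact (irreducible_X_sub_C α).not_isUnit h
  · rw [natDegree_mul (X_sub_C_ne_zero α) h.ne_zero, natDegree_X_sub_C,
      natDegree_eq_zero_of_isUnit h] at hdeg
    omega

/-- The possible factorisations of `X³ - 3X - c` over a field of characteristic not `3`. -/
theorem cubicPoly_factorisation (c : F) :
    Irreducible (cubicPoly c) ∨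
    (∃ (α : F) (Q : F[X]), Irreducible Q ∧ Q.natDegree = 2 ∧ cubicPoly c = (X - C α) * Q) ∨
    (∃ α β γ : F, α ≠ β ∧ α ≠ γ ∧ β ≠ γ ∧
      cubicPoly c = (X - C α) * (X - C β) * (X - C γ)) ∨
    (∃ α β : F, cubicPoly c = (X - C α) * (X - C β) ^ 2) := by
  by_cases hroot : ∃ α, α ^ 3 - 3 * α - c = 0
  · obtain ⟨α, hα⟩ := hroot
    right
    have hQ : cubicPoly c = (X - C α) * (X ^ 2 + C α * X + C (α ^ 2 - 3)) := by
      obtain rfl : c = α ^ 3 - 3 * α := by linear_combination -hα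
      simp only [cubicPoly, map_sub, map_mul, map_pow, map_ofNat]
      ring
    have hdeg : (X ^ 2 + C α * X + C (α ^ 2 - 3) : F[X]).natDegree = 2 := by
      have := natDegree_quadratic (a := (1 : F)) (b := α) (c := α ^ 2 - 3) one_ne_zero
      rwa [C_1, one_mul] at this
    by_cases hirr : Irreducible (X ^ 2 + C α * X + C (α ^ 2 - 3))
    · exact Or.inl ⟨α, _, hirr, hdeg, hQ⟩
    · right
      -- A reducible quadratic cofactor has a root β, and the roots then sum to zero, so the third
      -- is -α - β; the cases below record possible coincidences.
      obtain ⟨β, hβ⟩ : ∃ β, β ^ 2 + α * β + (α ^ 2 - 3) = 0 := by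
        by_contra! hno
        refine hirr (irreducible_of_degree_le_three_of_not_isRoot (by rw [hdeg]; simp) fun β hβ => ?_)
        apply hno β
        simpa [IsRoot] using hβ
      have hfac : cubicPoly c = (X - C α) * (X - C β) * (X - C (-α - β)) := by
        have h := congrArg C hβ
        simp only [map_add, map_mul, map_pow, map_sub, map_zero, map_ofNat] at h
        rw [hQ]
        simp only [map_sub, map_neg, map_pow, map_ofNat]
        linear_combination (X - C α) * h
      by_cases h1 : α = β
      · refine Or.inr ⟨-α - β, β, ?_⟩
        rw [hfac, h1]; ring
      by_cases h2 : α = -α - β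
      · refine Or.inr ⟨β, α, ?_⟩
        rw [hfac, ← h2]; ring
      by_cases h3 : β = -α - β
      · refine Or.inr ⟨α, β, ?_⟩
        rw [hfac, ← h3]; ring
      exact Or.inl ⟨α, β, -α - β, h1, h2, h3, hfac⟩
  · left
    refine irreducible_of_degree_le_three_of_not_isRoot
      (by rw [(cubicPoly_monic c).2]; simp) fun α hα => hroot ⟨α, ?_⟩
    simpa [IsRoot, cubicPoly] using hα

/-- The relations between the roots of `X³ - 3X - c` in the presence of a double root. -/
theorem double_root_relations (h3 : (3 : F) ≠ 0) {c α β : F}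
    (h : cubicPoly c = (X - C α) * (X - C β) ^ 2) : α = -2 * β ∧ β ^ 2 = 1 ∧ α ≠ β := by
  have h' : X ^ 3 - 3 * X - C c = X ^ 3 - C (α + 2 * β) * X ^ 2 + C (β ^ 2 + 2 * α * β) * X -
      C (α * β ^ 2) := by
    have := h
    rw [cubicPoly] at this
    rw [this]
    simp only [map_add, map_mul, map_pow, map_ofNat]
    ring
  -- The coefficient of X² gives α + 2β = 0; that of X gives β² + 2αβ = -3, which then reads 3β² =
  -- 3.
  have h2 := congrArg (fun q => coeff q 2) h'
  have h1 := congrArg (fun q => coeff q 1) h'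
  have e3 : (3 : F[X]) = C 3 := (map_ofNat C 3).symm
  rw [e3] at h1 h2
  simp only [coeff_sub, coeff_add, coeff_C_mul, coeff_X_pow, coeff_X, coeff_C] at h1 h2
  norm_num at h1 h2
  have hα : α = -2 * β := by linear_combination h2
  have hβ : β ^ 2 = 1 := by
    rw [hα] at h1
    have : 3 * (β ^ 2 - 1) = 0 := by linear_combination h1
    rcases mul_eq_zero.1 this with h | h
    · exact absurd h h3
    · linear_combination h
  refine ⟨hα, hβ, fun hαβ => ?_⟩
  rw [hαβ] at hα
  have h0 : 3 * β = 0 := by linear_combination hα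
  rcases mul_eq_zero.1 h0 with h | h
  · exact h3 h
  · rw [h] at hβ
    simp at hβ

end FactorTypes

namespace Place

section Signature

variable {K : Type*} [Field K] {p : Place K} {L : Type*} [Field L] [Algebra K L]
  [FiniteDimensional K L] [Algebra.IsSeparable K L] (hL : Module.finrank K L = 3)
  {G : p.ring[X]} (hG : G.Monic) {z : L} (hz : minpoly K z = G.map (algebraMap p.ring K))
include hL hG hz

theorem hasSignature_of_distinct {α β γ : p.ResidueField} (h1 : α ≠ β) (h2 : α ≠ γ) (h3 : β ≠ γ)
    (h : G.map (IsLocalRing.residue p.ring) = (X - C α) * (X - C β) * (X - C γ)) :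
    p.HasSignature L [(1, 1), (1, 1), (1, 1)] := by
  obtain ⟨P, hP⟩ := Above.exists_equiv_of_dvd hG hz ![X - C α, X - C β, X - C γ]
    (fun i => by fin_cases i <;> exact irreducible_X_sub_C _)
    (fun i => by
      rw [h]
      fin_cases i
      · exact (dvd_mul_right _ _).mul_right _
      · exact (dvd_mul_left _ _).mul_right _
      · exact dvd_mul_left _ _)
    (fun i j hij => by
      fin_cases i <;> fin_cases j <;> first | exact absurd rfl hij | skip
      · exact isCoprime_X_sub_C h1
      · exact isCoprime_X_sub_C h2
      · exact isCoprime_X_sub_C h1.symm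
      · exact isCoprime_X_sub_C h3
      · exact isCoprime_X_sub_C h2.symm
      · exact isCoprime_X_sub_C h3.symm)
    (by simp [Fin.sum_univ_three, hL])
  refine hasSignature_of_forall rfl P fun i => ?_
  fin_cases i <;> exact Prod.ext (hP _).1 ((hP _).2.trans (natDegree_X_sub_C _))

theorem hasSignature_of_irreducible (hdeg : G.natDegree = 3)
    (h : Irreducible (G.map (IsLocalRing.residue p.ring))) : p.HasSignature L [(1, 3)] := by
  have hd : (G.map (IsLocalRing.residue p.ring)).natDegree = 3 := by
    rw [hG.natDegree_map, hdeg]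
  obtain ⟨P, hP⟩ := Above.exists_equiv_of_dvd hG hz
    (fun _ : Fin 1 => G.map (IsLocalRing.residue p.ring)) (fun _ => h) (fun _ => dvd_rfl)
    (fun i j hij => absurd (Subsingleton.elim i j) hij) (by simp [hd, hL])
  refine hasSignature_of_forall rfl P fun i => ?_
  fin_cases i
  exact Prod.ext (hP _).1 ((hP _).2.trans hd)

theorem hasSignature_of_linear_mul_quadratic {α : p.ResidueField} {Q : p.ResidueField[X]}
    (hQ : Irreducible Q) (hQ2 : Q.natDegree = 2)
    (h : G.map (IsLocalRing.residue p.ring) = (X - C α) * Q) :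
    p.HasSignature L [(1, 1), (1, 2)] := by
  obtain ⟨P, hP⟩ := Above.exists_equiv_of_dvd hG hz ![X - C α, Q]
    (fun i => by
      fin_cases i
      · exact irreducible_X_sub_C _
      · exact hQ)
    (fun i => by
      rw [h]
      fin_cases i
      · exact dvd_mul_right _ _
      · exact dvd_mul_left _ _)
    (fun i j hij => by
      fin_cases i <;> fin_cases j <;> first | exact absurd rfl hij | skip
      · exact isCoprime_X_sub_C_of_irreducible hQ hQ2
      · exact (isCoprime_X_sub_C_of_irreducible hQ hQ2).symm)
    (by simp [hQ2, hL])
  refine hasSignature_of_forall rfl P fun i => ?_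
  fin_cases i
  · exact Prod.ext (hP _).1 ((hP _).2.trans (natDegree_X_sub_C _))
  · exact Prod.ext (hP _).1 ((hP _).2.trans hQ2)

/-- A repeated factor is out of reach of `exists_equiv_of_dvd`, but z reduces to α at one place and
to β at another; having two places excludes the signatures (1,3) and (3,1). -/
theorem hasSignature_of_double {α β : p.ResidueField} (hne : α ≠ β)
    (h : G.map (IsLocalRing.residue p.ring) = (X - C α) * (X - C β) ^ 2) :
    p.HasSignature L [(1, 1), (1, 1), (1, 1)] ∨ p.HasSignature L [(1, 1), (1, 2)] ∨
      p.HasSignature L [(2, 1), (1, 1)] := by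
  obtain ⟨P, hP⟩ := Above.exists_evalReduce_eq_zero hG hz (irreducible_X_sub_C α)
    (h ▸ dvd_mul_right _ _)
  obtain ⟨Q, hQ⟩ := Above.exists_evalReduce_eq_zero hG hz (irreducible_X_sub_C β)
    (h ▸ (dvd_pow_self _ two_ne_zero).mul_left _)
  have hPQ : P ≠ Q := by
    rintro rfl
    simp only [Above.evalReduce, eval₂_sub, eval₂_X, eval₂_C, sub_eq_zero] at hP hQ
    exact hne ((IsLocalRing.ResidueField.map P.ringHom).injective (hP.symm.trans hQ))
  rcases hasSignature_of_finrank_eq_three p L hL with h | h | h | h | h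
  · exact Or.inl h
  · exact Or.inr (Or.inl h)
  · exact Or.inr (Or.inr h)
  all_goals
    obtain ⟨R, hR, -⟩ := hasSignature_singleton_iff.1 h
    exact absurd ((hR P).trans (hR Q).symm) hPQ

end Signature

section Resolvent

variable {K L Ω : Type*} [Field K] [Field L] [Algebra K L] [Field Ω] [Algebra K Ω] [Algebra L Ω]
  [IsScalarTower K L Ω] {p : Place K} {a : K} {y : L} {r : Ω}

theorem adjoin_le_restrictScalars_adjoin :
    K⟮r⟯ ≤ (L⟮r⟯).restrictScalars K :=
  adjoin_simple_le_iff.2 (mem_adjoin_simple_self L r)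

variable (hy : K⟮y⟯ = ⊤) (hmin : minpoly K y = cubicPoly a) (h3 : (3 : K) ≠ 0)
  (hr : r ^ 2 + 3 * algebraMap K Ω a * r + (-27 + 9 * algebraMap K Ω a ^ 2) = 0)
  (hrK : r ∉ Set.range (algebraMap K Ω))
include hy hmin h3 hr hrK

/-- The decomposition of `p` in the field of the quadratic resolvent and of the places of `L` in
the Galois closure, according to the signature of `p` in `L`. -/
theorem resolvent_decomposition :
    (p.HasSignature L [(1, 1), (1, 2)] → p.IsInert K⟮r⟯) ∧
    (p.HasSignature L [(2, 1), (1, 1)] → p.IsRamified K⟮r⟯) ∧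
    (∀ P₁ P₂ : p.Above L, P₁.inertiaDeg = 1 → P₂.inertiaDeg = 2 → P₁.ramificationIdx = 1 →
      P₂.ramificationIdx = 1 → P₁.1.IsInert L⟮r⟯ ∧ P₂.1.IsCompletelySplit L⟮r⟯) ∧
    (∀ P₁ P₂ : p.Above L, P₁.inertiaDeg = 1 → P₂.inertiaDeg = 1 → P₁.ramificationIdx = 2 →
      P₂.ramificationIdx = 1 → P₁.1.IsCompletelySplit L⟮r⟯ ∧ P₂.1.IsRamified L⟮r⟯) ∧
    (∀ (P : p.Above L) (Q : P.1.Above L⟮r⟯), P.ramificationIdx = 1 → P.inertiaDeg = 1 →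
      Q.ramificationIdx = 1 → Q.inertiaDeg = 1 → p.IsCompletelySplit K⟮r⟯) := by
  have := finiteDimensional_of_minpoly_eq_cubicPoly hy hmin
  have := isSeparable_of_minpoly_eq_cubicPoly hy hmin h3
  have := isGalois_adjoin_resolvent hy hmin hr h3
  have hK3 := finrank_eq_three hy hmin
  have hLN := finrank_adjoin_resolvent_eq_two hy hmin hr hrK
  have hM := finrank_resolvent_eq_two hr hrK
  have : FiniteDimensional L L⟮r⟯ := Module.finite_of_finrank_pos (by omega)
  have : FiniteDimensional K K⟮r⟯ := Module.finite_of_finrank_pos (by omega)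
  have : FiniteDimensional K L⟮r⟯ := FiniteDimensional.trans K L L⟮r⟯
  -- Both fields sit inside Ω; the inclusion is made an algebra structure so that L(r) can serve as
  -- the common Galois extension of L and K(r).
  let ι : K⟮r⟯ →+* L⟮r⟯ :=
    (algebraMap K⟮r⟯ Ω).codRestrict L⟮r⟯.toSubring
      fun z => adjoin_le_restrictScalars_adjoin (K := K) (L := L) (r := r) z.2
  let : Algebra K⟮r⟯ L⟮r⟯ := ι.toAlgebra
  have : IsScalarTower K K⟮r⟯ L⟮r⟯ := IsScalarTower.of_algebraMap_eq fun z =>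
    Subtype.ext <| by
      have h1 : ((algebraMap K L⟮r⟯ z : L⟮r⟯) : Ω) = algebraMap K Ω z := rfl
      exact h1.trans (IsScalarTower.algebraMap_apply K K⟮r⟯ Ω z)
  have : FiniteDimensional K⟮r⟯ L⟮r⟯ := FiniteDimensional.right K _ _
  have : Algebra.IsSeparable K K⟮r⟯ := Algebra.isSeparable_tower_bot_of_isSeparable K K⟮r⟯ L⟮r⟯
  have hMN : Module.finrank K⟮r⟯ L⟮r⟯ = 3 := by
    have h1 := Module.finrank_mul_finrank K K⟮r⟯ L⟮r⟯
    have h2 := Module.finrank_mul_finrank K L L⟮r⟯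
    rw [hM, ← h2, hK3, hLN] at h1
    omega
  refine ⟨isInert_of_hasSignature hLN hMN hM, isRamified_of_hasSignature hLN hMN,
    fun P₁ P₂ h1 h2 h3 h4 => ?_, fun P₁ P₂ h1 h2 h3 h4 => ?_, fun P Q h1 h2 h3 h4 => ?_⟩
  · have := isInert_and_isCompletelySplit_of_unramified (N := L⟮r⟯) hLN h1 h2 h3 h4
    exact ⟨this.1, this.2.1⟩
  · have := isCompletelySplit_and_isRamified_of_ramified (N := L⟮r⟯) hLN h1 h2 h3 h4
    exact ⟨this.1, this.2.1⟩
  · exact isCompletelySplit_of_trans_eq_one (N := L⟮r⟯) hM P Q h1 h2 h3 h4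

/-- In the presence of a double root modulo `p`, a place of `L` where `y` reduces to that root is
completely split in the Galois closure. -/
theorem exists_above_eq_one_of_double (ha : a ∈ p.ring) (h3p : (3 : p.ResidueField) ≠ 0)
    {α β : p.ResidueField} (h : cubicPoly (p.reduce a) = (X - C α) * (X - C β) ^ 2) :
    ∃ (P : p.Above L) (Q : P.1.Above L⟮r⟯), Q.ramificationIdx = 1 ∧ Q.inertiaDeg = 1 := by
  have := finiteDimensional_of_minpoly_eq_cubicPoly hy hmin
  have := isSeparable_of_minpoly_eq_cubicPoly hy hmin h3
  have := isGalois_adjoin_resolvent hy hmin hr h3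
  have hLN := finrank_adjoin_resolvent_eq_two hy hmin hr hrK
  have : FiniteDimensional L L⟮r⟯ := Module.finite_of_finrank_pos (by omega)
  have : IsGalois L L⟮r⟯ := IsGalois.tower_top_of_isGalois K L L⟮r⟯
  obtain ⟨hα, hβ, hne⟩ := double_root_relations h3p h
  have hGm : (cubicPoly (⟨a, ha⟩ : p.ring)).map (IsLocalRing.residue p.ring) =
      (X - C α) * (X - C β) ^ 2 := by
    rw [map_cubicPoly, ← p.reduce_of_mem ha, h]
  -- The place is chosen with y ≡ β, so that the two other roots reduce to α and β. With y ≡ α they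
  -- would both reduce to β.
  obtain ⟨P, hP⟩ := Above.exists_evalReduce_eq_zero (L := L) (z := y)
    (G := cubicPoly (⟨a, ha⟩ : p.ring)) (cubicPoly_monic _).1 (by rw [map_cubicPoly, hmin]; rfl)
    (irreducible_X_sub_C β) (hGm ▸ (dvd_pow_self _ two_ne_zero).mul_left _)
  have hyP : y ∈ P.1.ring := P.mem_of_isIntegral
    ⟨cubicPoly (⟨a, ha⟩ : p.ring), (cubicPoly_monic _).1, by
      rw [← aeval_def, aeval_cubicPoly, cubicPoly_root hmin]
      change 3 * y + algebraMap K L a - 3 * y - algebraMap K L a = 0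
      ring⟩
  simp only [Above.evalReduce, eval₂_sub, eval₂_X, eval₂_C, sub_eq_zero] at hP
  rw [P.1.reduce_of_mem hyP] at hP
  obtain ⟨t, ht, ht2⟩ := exists_second_root (L := L) (N := L⟮r⟯) (ρ := AdjoinSimple.gen L r) hmin h3
    (by
      apply (algebraMap L⟮r⟯ Ω).injective
      simp only [map_add, map_mul, map_pow, map_neg, map_ofNat, map_zero,
        AdjoinSimple.algebraMap_gen]
      exact hr)
  let y' : P.1.ring := ⟨y, hyP⟩
  let G : P.1.ring[X] := X ^ 2 + C y' * X + C (y' ^ 2 - 3)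
  have hG2 : G = C 1 * X ^ 2 + C y' * X + C (y' ^ 2 - 3) := by rw [C_1, one_mul]
  have hGmon : G.Monic := by
    rw [hG2, Monic, leadingCoeff_quadratic one_ne_zero]
  have hGdeg : G.natDegree = 2 := by
    rw [hG2, natDegree_quadratic one_ne_zero]
  have hGmap : G.map (algebraMap P.1.ring L) = X ^ 2 + C y * X + C (y ^ 2 - 3) := by
    simp only [G, Polynomial.map_add, Polynomial.map_mul, Polynomial.map_pow, map_X, map_C]
    rfl
  have haev : aeval t (G.map (algebraMap P.1.ring L)) = 0 := by
    rw [hGmap]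
    simpa [map_ofNat] using ht2
  have hint : IsIntegral L t := ⟨_, hGmon.map _, haev⟩
  -- Since r is a polynomial in y and t, having t in L would put r in L.
  have htL : t ∉ (algebraMap L L⟮r⟯).range := by
    rintro ⟨l, rfl⟩
    refine notMem_range_of_notMem_range hy hmin hr hrK ⟨3 * ((y ^ 2 - 1) * l + y), ?_⟩
    have := congrArg (algebraMap L⟮r⟯ Ω) ht
    rw [AdjoinSimple.algebraMap_gen] at this
    rw [this]
    simp only [map_add, map_mul, map_pow, map_sub, map_one, map_ofNat,
      ← IsScalarTower.algebraMap_apply]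
  have hmint : minpoly L t = G.map (algebraMap P.1.ring L) := by
    have h1 := minpoly.natDegree_pos hint
    have h2 : (minpoly L t).natDegree ≠ 1 := fun h => htL (minpoly.natDegree_eq_one_iff.1 h)
    refine (eq_of_monic_of_dvd_of_natDegree_le (minpoly.monic hint) (hGmon.map _)
      (minpoly.dvd L t haev) ?_).symm
    rw [hGmon.natDegree_map, hGdeg]
    omega
  let σ := IsLocalRing.ResidueField.map P.ringHom
  -- The quadratic reduces to X² + βX + β² - 3, and α = -2β, β² = 1 give β² - 3 = -2β² = αβ.
  have hGres : G.map (IsLocalRing.residue P.1.ring) = (X - C (σ α)) * (X - C (σ β)) := by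
    have hβ' : σ β ^ 2 = 1 := by rw [← map_pow, hβ, map_one]
    simp only [G, Polynomial.map_add, Polynomial.map_mul, Polynomial.map_pow, map_X, map_C]
    have hy' : IsLocalRing.residue P.1.ring y' = σ β := hP
    rw [map_sub, map_pow, hy', map_ofNat, hα]
    have hC := congrArg C hβ'
    simp only [map_pow, map_one] at hC
    simp only [map_mul, map_neg, map_ofNat, map_sub, map_pow]
    linear_combination 3 * hC
  have hne' : σ α ≠ σ β := fun h => hne (σ.injective h)
  obtain ⟨Q, hQ⟩ := Above.exists_equiv_of_dvd hGmon hmint ![X - C (σ α), X - C (σ β)]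
    (fun i => by fin_cases i <;> exact irreducible_X_sub_C _)
    (fun i => by
      rw [hGres]
      fin_cases i
      · exact dvd_mul_right _ _
      · exact dvd_mul_left _ _)
    (fun i j hij => by
      fin_cases i <;> fin_cases j <;> first | exact absurd rfl hij | skip
      · exact isCoprime_X_sub_C hne'
      · exact isCoprime_X_sub_C hne'.symm)
    (by simp [hLN])
  exact ⟨P, Q 0, (hQ 0).1, (hQ 0).2.trans (natDegree_X_sub_C _)⟩

/-- If every place of `L` has e = f = 1, the place of L(r) found in `exists_above_eq_one_of_double`
has e = f = 1 over `p`; hence so has its restriction to K(r). -/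
theorem isCompletelySplit_resolvent_of_double (ha : a ∈ p.ring) (h3p : (3 : p.ResidueField) ≠ 0)
    {α β : p.ResidueField} (h : cubicPoly (p.reduce a) = (X - C α) * (X - C β) ^ 2)
    (hs : p.HasSignature L [(1, 1), (1, 1), (1, 1)]) : p.IsCompletelySplit K⟮r⟯ := by
  obtain ⟨P, Q, he, hf⟩ := exists_above_eq_one_of_double hy hmin h3 hr hrK ha h3p h
  have hP := (hs.mem_iff _).2 ⟨P, rfl⟩
  simp only [List.mem_cons, Prod.mk.injEq, List.not_mem_nil, or_false, or_self] at hP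
  exact (resolvent_decomposition hy hmin h3 hr hrK).2.2.2.2 P Q hP.1 hP.2 he hf

end Resolvent

end Place

end

/-! ### Cubes in finite fields. -/

noncomputable section

section FiniteField

variable {F : Type*} [Field F] [Finite F]

theorem card_mod_three (h3 : (3 : F) ≠ 0) : Nat.card F ≡ 1 [MOD 3] ∨ Nat.card F ≡ 2 [MOD 3] := by
  have hne : ¬ 3 ∣ Nat.card F := by
    intro hdvd
    have := Fintype.ofFinite F
    obtain ⟨q, hq⟩ := CharP.exists F
    obtain ⟨n, hqp, hn⟩ := FiniteField.card F q
    rw [Nat.card_eq_fintype_card, hn] at hdvd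
    have := (Nat.prime_dvd_prime_iff_eq Nat.prime_three hqp).1 (Nat.prime_three.dvd_of_dvd_pow hdvd)
    subst this
    exact h3 (by exact_mod_cast CharP.cast_eq_zero F 3)
  simp only [Nat.ModEq]
  omega

theorem pow_natCard_sub_one {u : F} (hu : u ≠ 0) : u ^ (Nat.card F - 1) = 1 := by
  have := Fintype.ofFinite F
  rw [Nat.card_eq_fintype_card]
  exact FiniteField.pow_card_sub_one_eq_one u hu

/-- A reducible cubic has a root; if w³ = u, then u^((q-1)/3) = w^(q-1) = 1, with q the number of
elements. -/
theorem irreducible_X_pow_three_sub_C {u : F} (hu : u ≠ 0) (hq : Nat.card F ≡ 1 [MOD 3])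
    (h : u ^ ((Nat.card F - 1) / 3) ≠ 1) : Irreducible (X ^ 3 - C u : F[X]) := by
  refine irreducible_of_degree_le_three_of_not_isRoot (by rw [natDegree_X_pow_sub_C]; simp)
    fun w hw => h ?_
  have hw3 : w ^ 3 = u := by
    have : w ^ 3 - u = 0 := by simpa [IsRoot] using hw
    linear_combination this
  have hw0 : w ≠ 0 := by
    rintro rfl
    exact hu (by rw [← hw3]; simp)
  have hdvd : 3 ∣ Nat.card F - 1 := (Nat.modEq_iff_dvd' (Nat.card_pos)).1 hq.symm
  rw [← hw3, ← pow_mul, Nat.mul_div_cancel' hdvd]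
  exact pow_natCard_sub_one hw0

/-- Let g generate the unit group, of order 3m, and u = g^n. Then u^m = 1 forces 3 ∣ n, so u has the
cube root w = g^(n/3), and ξ = g^m is a primitive third root of unity; the roots are w, ξw, ξ²w. -/
theorem exists_X_pow_three_sub_C_eq_of_pow_eq_one {u : F} (hu : u ≠ 0)
    (hq : Nat.card F ≡ 1 [MOD 3]) (h : u ^ ((Nat.card F - 1) / 3) = 1) :
    ∃ α β γ : F, α ≠ β ∧ α ≠ γ ∧ β ≠ γ ∧
      (X ^ 3 - C u : F[X]) = (X - C α) * (X - C β) * (X - C γ) := by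
  have hdvd : 3 ∣ Nat.card F - 1 := (Nat.modEq_iff_dvd' (Nat.card_pos)).1 hq.symm
  obtain ⟨m, hm⟩ := hdvd
  have hm' : (Nat.card F - 1) / 3 = m := by omega
  have hm0 : 0 < m := by
    have := Finite.one_lt_card (α := F)
    omega
  rw [hm'] at h
  obtain ⟨g, hg⟩ := IsCyclic.exists_monoid_generator (α := Fˣ)
  have hgo : orderOf g = 3 * m := by
    rw [orderOf_eq_card_of_forall_mem_powers hg, Nat.card_units, hm]
  obtain ⟨n, hn⟩ : ∃ n : ℕ, g ^ n = Units.mk0 u hu := hg _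
  have hn3 : 3 ∣ n := by
    have h1 : g ^ (n * m) = 1 := by
      rw [pow_mul, hn]
      ext
      simpa using h
    have h2 := orderOf_dvd_of_pow_eq_one h1
    rw [hgo] at h2
    exact Nat.dvd_of_mul_dvd_mul_right hm0 h2
  obtain ⟨l, rfl⟩ := hn3
  set w : F := ((g ^ l : Fˣ) : F) with hw
  set ξ : F := ((g ^ m : Fˣ) : F) with hξ
  have hw3 : w ^ 3 = u := by
    rw [hw, ← Units.val_pow_eq_pow_val, ← pow_mul, mul_comm l 3, hn, Units.val_mk0]
  have hξ3 : ξ ^ 3 = 1 := by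
    rw [hξ, ← Units.val_pow_eq_pow_val, ← pow_mul, mul_comm m 3, ← hgo, pow_orderOf_eq_one,
      Units.val_one]
  have hξ1 : ξ ≠ 1 := by
    intro h1
    have h2 : g ^ m = 1 := Units.ext h1
    have := Nat.le_of_dvd hm0 (orderOf_dvd_of_pow_eq_one h2)
    rw [hgo] at this
    omega
  have hw0 : w ≠ 0 := Units.ne_zero _
  have hξ0 : ξ ≠ 0 := Units.ne_zero _
  have hsum : ξ ^ 2 + ξ + 1 = 0 := by
    have : (ξ - 1) * (ξ ^ 2 + ξ + 1) = 0 := by linear_combination hξ3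
    exact (mul_eq_zero.1 this).resolve_left (sub_ne_zero.2 hξ1)
  refine ⟨w, ξ * w, ξ ^ 2 * w, ?_, ?_, ?_, ?_⟩
  · intro h1
    exact hξ1 (mul_right_cancel₀ hw0 (by rw [one_mul]; exact h1.symm))
  · intro h1
    have h2 : ξ ^ 2 = 1 := mul_right_cancel₀ hw0 (by rw [one_mul]; exact h1.symm)
    apply hξ1
    linear_combination hξ3 - ξ * h2
  · intro h1
    have h2 : ξ = ξ ^ 2 := mul_right_cancel₀ hw0 h1
    apply hξ1
    exact mul_left_cancel₀ hξ0 (by rw [mul_one, ← sq]; exact h2.symm)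
  · have hu' := congrArg C hw3
    have hs := congrArg C hsum
    simp only [map_pow, map_add, map_one, map_zero] at hu' hs
    simp only [map_mul, map_pow]
    linear_combination (-X ^ 2 * C w + C ξ * C w ^ 2 * X) * (-hs) + hu' +
      (C w ^ 3 * (C ξ - 1)) * hs

theorem exists_X_pow_three_sub_C_eq_of_card_eq_two {u : F} (h3 : (3 : F) ≠ 0) (hu : u ≠ 0)
    (hq : Nat.card F ≡ 2 [MOD 3]) :
    ∃ (α : F) (Q : F[X]), Irreducible Q ∧ Q.natDegree = 2 ∧
      (X ^ 3 - C u : F[X]) = (X - C α) * Q := by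
  have hq' : Nat.card F % 3 = 2 := hq
  -- Such an m inverts 3 modulo q - 1, so v ↦ v^m inverts cubing on units: u has the cube root u^m
  -- and no other.
  obtain ⟨m, hm⟩ : ∃ m, 3 * m = 2 * (Nat.card F - 1) + 1 :=
    ⟨(2 * (Nat.card F - 1) + 1) / 3, by omega⟩
  have hcube : ∀ v : F, v ≠ 0 → v ^ (3 * m) = v := fun v hv => by
    rw [hm, pow_succ, mul_comm 2, pow_mul, pow_natCard_sub_one hv, one_pow, one_mul]
  set w := u ^ m with hw
  have hw3 : w ^ 3 = u := by rw [hw, ← pow_mul, mul_comm, hcube u hu]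
  have hw0 : w ≠ 0 := pow_ne_zero _ hu
  have hdeg : (X ^ 2 + C w * X + C (w ^ 2) : F[X]).natDegree = 2 := by
    have := natDegree_quadratic (a := (1 : F)) (b := w) (c := w ^ 2) one_ne_zero
    rwa [C_1, one_mul] at this
  refine ⟨w, X ^ 2 + C w * X + C (w ^ 2), ?_, hdeg, ?_⟩
  · refine irreducible_of_degree_le_three_of_not_isRoot (by rw [hdeg]; simp) fun s hs => ?_
    have hs : s ^ 2 + w * s + w ^ 2 = 0 := by simpa [IsRoot] using hs
    have hs3 : s ^ 3 = w ^ 3 := by linear_combination (s - w) * hs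
    have hs0 : s ≠ 0 := by
      rintro rfl
      exact pow_ne_zero 3 hw0 (by rw [← hs3]; simp)
    have hsw : s = w := by
      rw [← hcube s hs0, ← hcube w hw0, pow_mul, pow_mul, hs3]
    rw [hsw] at hs
    have : 3 * w ^ 2 = 0 := by linear_combination hs
    exact (mul_ne_zero h3 (pow_ne_zero 2 hw0)) this
  · rw [← hw3]
    simp only [map_pow]
    ring

/-- The power in question has cube 1, so it is either 1 or itself a primitive third root of unity.
-/
theorem exists_primitiveRoot_iff {u : F} (hu : u ≠ 0) (hq : Nat.card F ≡ 1 [MOD 3]) :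
    (∃ ξ : F, IsPrimitiveRoot ξ 3 ∧ ∃ i : ℕ, (i = 1 ∨ i = 2) ∧
      u ^ ((Nat.card F - 1) / 3) = ξ ^ i) ↔ u ^ ((Nat.card F - 1) / 3) ≠ 1 := by
  have hdvd : 3 ∣ Nat.card F - 1 := (Nat.modEq_iff_dvd' (Nat.card_pos)).1 hq.symm
  constructor
  · rintro ⟨ξ, hξ, i, hi, h⟩
    rw [h]
    exact hξ.pow_ne_one_of_pos_of_lt (by omega) (by omega)
  · intro h
    refine ⟨_, ?_, 1, Or.inl rfl, (pow_one _).symm⟩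
    have hp : (u ^ ((Nat.card F - 1) / 3)) ^ 3 = 1 := by
      rw [← pow_mul, Nat.div_mul_cancel hdvd]
      exact pow_natCard_sub_one hu
    have := orderOf_eq_prime hp h
    exact IsPrimitiveRoot.iff_orderOf.2 this

end FiniteField

/-! ### Places where `a` has a pole. -/

namespace Place

variable {K L : Type*} [Field K] [Field L] [Algebra K L] {p : Place K} {a : K} {y : L}
  (hy : K⟮y⟯ = ⊤) (hmin : minpoly K y = cubicPoly a) (h3 : (3 : K) ≠ 0)
include hy hmin h3

/-- If the valuation of `a` is negative and prime to `3`, then `p` is totally ramified. -/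
theorem hasSignature_of_not_dvd_ord (ha : p.ord a < 0) (hd : ¬ 3 ∣ p.ord a) :
    p.HasSignature L [(3, 1)] := by
  have := finiteDimensional_of_minpoly_eq_cubicPoly hy hmin
  have := isSeparable_of_minpoly_eq_cubicPoly hy hmin h3
  have hL := finrank_eq_three hy hmin
  obtain ⟨P⟩ := Above.nonempty p L
  have hroot := cubicPoly_root hmin
  have h3P : (3 : L) ∈ P.1.ring := ofNat_mem P.1.ring 3
  have haP := P.ord_algebraMap a
  have he := P.ramificationIdx_pos
  have hneg : P.1.ord (algebraMap K L a) < 0 := by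
    rw [haP]
    exact mul_neg_of_pos_of_neg (by exact_mod_cast he) ha
  have hyP : y ∉ P.1.ring := by
    intro hyP
    have : algebraMap K L a ∈ P.1.ring := by
      have e : algebraMap K L a = y ^ 3 - 3 * y := by linear_combination -hroot
      rw [e]
      exact sub_mem (pow_mem hyP 3) (mul_mem h3P hyP)
    have := P.1.ord_nonneg this
    omega
  -- As y has a pole at P, the term y³ strictly dominates 3y in a = y³ - 3y.
  have hval : P.1.val (algebraMap K L a) = P.1.val y ^ 3 := by
    have e : algebraMap K L a = y ^ 3 - 3 * y := by linear_combination -hroot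
    have hy1 : 1 < P.1.val y := by
      rw [← P.1.val_le_one_iff] at hyP
      exact not_le.1 hyP
    rw [e, ← map_pow]
    apply Valuation.map_sub_eq_of_lt_left
    rw [map_mul, map_pow]
    calc P.1.val 3 * P.1.val y ≤ 1 * P.1.val y :=
          mul_le_mul_left (P.1.val_le_one_iff.2 h3P) _
      _ = P.1.val y ^ 1 := by rw [one_mul, pow_one]
      _ < P.1.val y ^ 3 := pow_lt_pow_right₀ hy1 (by norm_num)
  have hord : P.1.ord (algebraMap K L a) = 3 * P.1.ord y := by
    have := P.1.ord_pow y 3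
    rw [ord_def, map_pow, ← hval, ← ord_def] at this
    exact this
  rw [haP] at hord
  have h3e : (3 : ℤ) ∣ P.ramificationIdx := by
    have hdvd : (3 : ℤ) ∣ P.ramificationIdx * p.ord a := ⟨_, hord⟩
    exact (Int.prime_three.dvd_or_dvd hdvd).resolve_right hd
  have h3e : 3 ∣ P.ramificationIdx := by exact_mod_cast h3e
  have hle := P.mul_le_finrank
  rw [hL] at hle
  have hf := P.inertiaDeg_pos
  have he3 := Nat.le_of_dvd he h3e
  have hf1 : P.inertiaDeg = 1 := by nlinarith
  have he1 : P.ramificationIdx = 3 := by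
    rw [hf1] at hle
    omega
  exact hasSignature_singleton_iff.2
    ⟨P, Above.eq_of_finrank_le_mul (by rw [hL, hf1, he1]), by rw [hf1, he1]⟩

omit h3 in
/-- After rescaling, a root of the cubic with `3 ∣ ord a < 0` has a minimal polynomial reducing to
`X³ - u`. -/
theorem exists_minpoly_of_dvd_ord (ha : p.ord a < 0) (hd : 3 ∣ p.ord a) {π : K}
    (hπ : p.ord π = 1) :
    p.reduce (π ^ (-p.ord a) * a) ≠ 0 ∧
    ∃ (z : L) (G : p.ring[X]), G.Monic ∧ G.natDegree = 3 ∧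
      minpoly K z = G.map (algebraMap p.ring K) ∧
      G.map (IsLocalRing.residue p.ring) = X ^ 3 - C (p.reduce (π ^ (-p.ord a) * a)) := by
  have := finiteDimensional_of_minpoly_eq_cubicPoly hy hmin
  have hL := finrank_eq_three hy hmin
  obtain ⟨m, hm⟩ : ∃ m : ℕ, p.ord a = -(3 * m : ℕ) := by
    obtain ⟨c, hc⟩ := hd
    exact ⟨(-c).toNat, by omega⟩
  have hm0 : 0 < m := by omega
  have hπ0 : π ≠ 0 := by rintro rfl; simp at hπ
  have ha0 : a ≠ 0 := by rintro rfl; simp at ha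
  rw [hm, neg_neg, zpow_natCast]
  have hπr : π ∈ p.ring := p.mem_of_ord_nonneg (by omega)
  have hb0 : π ^ (3 * m) * a ≠ 0 := mul_ne_zero (pow_ne_zero _ hπ0) ha0
  have hord : p.ord (π ^ (3 * m) * a) = 0 := by
    rw [ord_mul _ (pow_ne_zero _ hπ0) ha0, ord_pow, hπ, hm]
    push_cast
    ring
  have hbr : π ^ (3 * m) * a ∈ p.ring := p.mem_of_ord_nonneg hord.ge
  have hred : p.reduce (π ^ (3 * m) * a) ≠ 0 := by
    rw [p.reduce_of_mem hbr, Ne, IsLocalRing.residue_eq_zero_iff, mem_maximalIdeal_iff,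
      ← ord_pos_iff _ hb0, hord]
    exact lt_irrefl 0
  refine ⟨hred, ?_⟩
  set ϖ : p.ring := ⟨π, hπr⟩ with hϖ
  set b : p.ring := ⟨_, hbr⟩ with hb
  -- This is the equation of π^m y, obtained on multiplying that of y by π^(3m). Its linear
  -- coefficient vanishes modulo `p` since m > 0.
  let G : p.ring[X] := C 1 * X ^ 3 + C 0 * X ^ 2 + C (-(3 * ϖ ^ (2 * m))) * X + C (-b)
  have hGdeg : G.natDegree = 3 := natDegree_cubic one_ne_zero
  have hG : G.Monic := by rw [Monic, leadingCoeff_cubic one_ne_zero]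
  let c : L := algebraMap K L (π ^ m)
  have hc0 : π ^ m ≠ 0 := pow_ne_zero _ hπ0
  have haev : aeval (c * y) (G.map (algebraMap p.ring K)) = 0 := by
    have hroot := cubicPoly_root hmin
    rw [aeval_map_algebraMap]
    have e1 : algebraMap p.ring L ϖ = algebraMap K L π := rfl
    have e2 : algebraMap p.ring L b = algebraMap K L (π ^ (3 * m) * a) := rfl
    simp only [G, map_add, map_mul, map_pow, map_neg, aeval_C, aeval_X, map_one, map_zero,
      map_ofNat, e1, e2, c]
    linear_combination (algebraMap K L π) ^ (3 * m) * hroot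
  have hint : IsIntegral K (c * y) := Algebra.IsIntegral.isIntegral _
  refine ⟨c * y, G, hG, hGdeg, ?_, ?_⟩
  · refine (eq_of_monic_of_dvd_of_natDegree_le (minpoly.monic hint) (hG.map _)
      (minpoly.dvd K _ haev) ?_).symm
    rw [hG.natDegree_map, hGdeg]
    have h1 := minpoly.degree_dvd hint
    rw [hL] at h1
    rcases (Nat.dvd_prime Nat.prime_three).1 h1 with h | h
    · obtain ⟨s, hs⟩ := minpoly.natDegree_eq_one_iff.1 h
      have hys : y = algebraMap K L ((π ^ m)⁻¹ * s) := by
        rw [map_mul, hs, map_inv₀, inv_mul_cancel_left₀ ((_root_.map_ne_zero _).2 hc0)]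
      have h2 : (minpoly K y).natDegree = 1 := minpoly.natDegree_eq_one_iff.2 ⟨_, hys.symm⟩
      rw [hmin, (cubicPoly_monic a).2] at h2
      omega
    · exact h.ge
  · have hϖ0 : IsLocalRing.residue p.ring ϖ = 0 := by
      rw [IsLocalRing.residue_eq_zero_iff, mem_maximalIdeal_iff, ← ord_pos_iff _ hπ0]
      omega
    have e2 : IsLocalRing.residue p.ring b = p.reduce (π ^ (3 * m) * a) :=
      (p.reduce_of_mem hbr).symm
    simp only [G, Polynomial.map_add, Polynomial.map_mul, Polynomial.map_pow, map_X, map_C]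
    simp only [map_neg, map_mul, map_pow, hϖ0, zero_pow (show 2 * m ≠ 0 by omega), e2]
    simp [sub_eq_add_neg]

variable [Finite p.ResidueField] (h3p : (3 : p.ResidueField) ≠ 0) (ha : p.ord a < 0) {π : K}
    (hπ : p.ord π = 1) (hd : 3 ∣ p.ord a)
include h3p ha hπ hd

omit h3p in
theorem hasSignature_of_pow_eq_one (hq : Nat.card p.ResidueField ≡ 1 [MOD 3])
    (hu : p.reduce (π ^ (-p.ord a) * a) ^ ((Nat.card p.ResidueField - 1) / 3) = 1) :
    p.HasSignature L [(1, 1), (1, 1), (1, 1)] := by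
  have := finiteDimensional_of_minpoly_eq_cubicPoly hy hmin
  have := isSeparable_of_minpoly_eq_cubicPoly hy hmin h3
  obtain ⟨hu0, z, G, hG, -, hz, hGm⟩ := exists_minpoly_of_dvd_ord hy hmin ha hd hπ
  obtain ⟨α, β, γ, h1, h2, h3, h⟩ := exists_X_pow_three_sub_C_eq_of_pow_eq_one hu0 hq hu
  exact hasSignature_of_distinct (finrank_eq_three hy hmin) hG hz h1 h2 h3 (hGm.trans h)

omit h3p in
theorem hasSignature_of_pow_ne_one (hq : Nat.card p.ResidueField ≡ 1 [MOD 3])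
    (hu : p.reduce (π ^ (-p.ord a) * a) ^ ((Nat.card p.ResidueField - 1) / 3) ≠ 1) :
    p.HasSignature L [(1, 3)] := by
  have := finiteDimensional_of_minpoly_eq_cubicPoly hy hmin
  have := isSeparable_of_minpoly_eq_cubicPoly hy hmin h3
  obtain ⟨hu0, z, G, hG, hGd, hz, hGm⟩ := exists_minpoly_of_dvd_ord hy hmin ha hd hπ
  exact hasSignature_of_irreducible (finrank_eq_three hy hmin) hG hz hGd
    (hGm ▸ irreducible_X_pow_three_sub_C hu0 hq hu)

theorem hasSignature_of_card_eq_two (hq : Nat.card p.ResidueField ≡ 2 [MOD 3]) :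
    p.HasSignature L [(1, 1), (1, 2)] := by
  have := finiteDimensional_of_minpoly_eq_cubicPoly hy hmin
  have := isSeparable_of_minpoly_eq_cubicPoly hy hmin h3
  obtain ⟨hu0, z, G, hG, -, hz, hGm⟩ := exists_minpoly_of_dvd_ord hy hmin ha hd hπ
  obtain ⟨α, Q, h1, h2, h⟩ := exists_X_pow_three_sub_C_eq_of_card_eq_two h3p hu0 hq
  exact hasSignature_of_linear_mul_quadratic (finrank_eq_three hy hmin) hG hz h1 h2 (hGm.trans h)

end Place

end

/-! ### Fractions of integral elements in valuation rings. -/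

noncomputable section

section Denominators

variable {F : Type*} [Field F]

/-- If `z` in a valuation ring satisfies an algebraic relation, with coefficients in an integrally
closed subring and not all in the maximal ideal, then `z` is a quotient of elements of the subring,
with denominator a unit of the valuation ring. -/
theorem ValuationSubring.exists_mul_eq_of_aeval_eq_zero (V : ValuationSubring F) {B : Type*}
    [CommRing B] [Algebra B F] [IsIntegrallyClosedIn B F] {z : F} (hz : z ∈ V) (g : B[X])
    (hg : aeval z g = 0) (i : ℕ) (hi : ¬ V.valuation (algebraMap B F (g.coeff i)) < 1) :
    ∃ b c : B, ¬ V.valuation (algebraMap B F b) < 1 ∧ algebraMap B F c = algebraMap B F b * z := by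
  induction hn : g.natDegree using Nat.strong_induction_on generalizing g i with
  | _ n ih =>
    have hint : IsIntegral B (algebraMap B F g.leadingCoeff * z) := by
      rw [← Algebra.smul_def]
      exact isIntegral_leadingCoeff_smul g z hg
    obtain ⟨c, hc⟩ := IsIntegrallyClosedIn.isIntegral_iff.1 hint
    -- A leading coefficient outside the maximal ideal is the required denominator. Otherwise c, the
    -- leading coefficient times z, is a nonunit of V as well: the top term is replaced by c
    -- X^(n-1), which lowers the degree and changes the others only by a nonunit, so coefficient i
    -- stays a unit.
    by_cases hlead : V.valuation (algebraMap B F g.leadingCoeff) < 1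
    · have hcm : V.valuation (algebraMap B F c) < 1 := by
        rw [hc, map_mul]
        exact mul_lt_one_of_lt_of_le hlead ((V.valuation_le_one_iff z).2 hz)
      have hin : i ≠ n := by
        rintro rfl
        rw [← hn] at hi
        exact hi hlead
      have hi' : i < n := by
        refine lt_of_le_of_ne ?_ hin
        by_contra hlt
        rw [coeff_eq_zero_of_natDegree_lt (by omega)] at hi
        simp at hi
      have hev : aeval z (g.eraseLead + C c * X ^ (n - 1)) = 0 := by
        have h1 := congrArg (aeval z) g.eraseLead_add_C_mul_X_pow
        rw [hg, map_add, map_mul, aeval_C, map_pow, aeval_X, hn] at h1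
        rw [map_add, map_mul, aeval_C, map_pow, aeval_X, hc, mul_assoc, ← pow_succ',
          Nat.sub_add_cancel (by omega), h1]
      refine ih _ ?_ (g.eraseLead + C c * X ^ (n - 1)) hev i ?_ rfl
      · have h1 := g.eraseLead_natDegree_le
        have h2 := natDegree_C_mul_X_pow_le c (n - 1)
        have h3 := natDegree_add_le g.eraseLead (C c * X ^ (n - 1))
        have : max g.eraseLead.natDegree (C c * X ^ (n - 1)).natDegree ≤ n - 1 :=
          max_le (by omega) h2
        omega
      · rw [coeff_add, eraseLead_coeff_of_ne _ (by omega), coeff_C_mul_X_pow]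
        split_ifs with h
        · intro hlt
          rw [map_add] at hlt
          apply hi
          have := V.valuation.map_sub_lt hlt hcm
          rwa [add_sub_cancel_right] at this
        · rwa [add_zero]
    · exact ⟨g.leadingCoeff, c, hlead, hc⟩

variable {A : Type*} [CommRing A] [IsDomain A] [IsPrincipalIdealRing A] [Algebra A F]
  [FaithfulSMul A F] [Algebra.IsAlgebraic A F]

theorem exists_isPrimitive_aeval_eq_zero (z : F) : ∃ g : A[X], g.IsPrimitive ∧ aeval z g = 0 := by
  obtain ⟨g, hg0, hg⟩ := Algebra.IsAlgebraic.isAlgebraic (R := A) z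
  let : NormalizedGCDMonoid A := Classical.choice inferInstance
  refine ⟨g.primPart, g.isPrimitive_primPart, ?_⟩
  rw [g.eq_C_content_mul_primPart, map_mul, aeval_C] at hg
  refine (mul_eq_zero.1 hg).resolve_left fun h => hg0 ?_
  rw [← content_eq_zero_iff]
  exact FaithfulSMul.algebraMap_injective A F (by rw [h, map_zero])

/-- In an algebraic extension of the fractions of a principal ideal domain, every element of a
valuation ring is a quotient of integral elements, with denominator a unit. -/
theorem ValuationSubring.exists_mul_eq (V : ValuationSubring F)
    (hV : ∀ z : A, algebraMap A F z ∈ V) {z : F} (hz : z ∈ V) :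
    ∃ b c : integralClosure A F, ¬ V.valuation (b : F) < 1 ∧ (c : F) = b * z := by
  obtain ⟨g, hg, hgz⟩ := exists_isPrimitive_aeval_eq_zero (A := A) z
  let φ : A →+* V := (algebraMap A F).codRestrict V.toSubring hV
  -- The contraction of the maximal ideal is (d) with d not a unit, so d cannot divide all
  -- coefficients of a primitive polynomial.
  obtain ⟨d, hd⟩ := IsPrincipalIdealRing.principal ((IsLocalRing.maximalIdeal V).comap φ)
  have hmem : ∀ t : A, V.valuation (algebraMap A F t) < 1 ↔ d ∣ t := fun t => by
    rw [← Ideal.mem_span_singleton, ← Ideal.submodule_span_eq, ← hd, Ideal.mem_comap]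
    exact (V.valuation_lt_one_iff (φ t)).symm
  obtain ⟨i, hi⟩ : ∃ i, ¬ d ∣ g.coeff i := by
    by_contra! h
    have h1 := hg d ((C_dvd_iff_dvd_coeff _ _).2 h)
    have h2 := (hmem 1).2 (isUnit_iff_dvd_one.1 h1)
    simp at h2
  have := V.exists_mul_eq_of_aeval_eq_zero (B := integralClosure A F) hz
    (g.map (algebraMap A (integralClosure A F))) (by rwa [aeval_map_algebraMap]) i
    (by rw [coeff_map, ← IsScalarTower.algebraMap_apply, hmem]; exact hi)
  exact this

end Denominators

end

/-! ### Factorisation of the extension of the centre of a place. -/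

noncomputable section

namespace Place

variable {A K : Type*} [CommRing A] [IsDomain A] [IsPrincipalIdealRing A] [Field K] [Algebra A K]
  [FaithfulSMul A K] [Algebra.IsAlgebraic A K] (p : Place K)
  (hA : ∀ z : A, algebraMap A K z ∈ p.ring)
include hA

omit [IsDomain A] [IsPrincipalIdealRing A] [FaithfulSMul A K] [Algebra.IsAlgebraic A K] in
theorem integralClosure_mem (z : integralClosure A K) : (z : K) ∈ p.ring := by
  let φ : A →+* p.ring := (algebraMap A K).codRestrict p.ring.toSubring hA
  have : IsIntegral p.ring (z : K) :=
    ((mem_integralClosure_iff _ _).1 z.2).map_of_comp_eq φ (RingHom.id K) rfl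
  obtain ⟨w, hw⟩ := IsIntegrallyClosed.isIntegral_iff.1 this
  rw [← hw]
  exact w.2

omit [IsDomain A] [IsPrincipalIdealRing A] [FaithfulSMul A K] [Algebra.IsAlgebraic A K] in
theorem mem_centre_integralClosure_iff (z : integralClosure A K) :
    z ∈ p.centre (integralClosure A K) ↔ p.ring.valuation (z : K) < 1 :=
  p.mem_centre_iff (p.integralClosure_mem hA) z

omit [IsDomain A] [IsPrincipalIdealRing A] [FaithfulSMul A K] [Algebra.IsAlgebraic A K] in
theorem centre_integralClosure_isPrime : (p.centre (integralClosure A K)).IsPrime :=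
  p.centre_isPrime (p.integralClosure_mem hA)

/-- The centre of a place contains an element of valuation `1`. -/
theorem exists_mem_centre_ord_eq_one :
    ∃ c ∈ p.centre (integralClosure A K), (c : K) ≠ 0 ∧ p.ord (c : K) = 1 := by
  obtain ⟨π, h0, hπ⟩ := p.exists_ord_eq_one
  obtain ⟨b, c, hb, hc⟩ := p.ring.exists_mul_eq hA (p.mem_of_ord_nonneg (z := π) (by omega))
  have hb0 : (b : K) ≠ 0 := by
    intro h
    rw [h, map_zero] at hb
    exact hb zero_lt_one
  have hbo : p.ord (b : K) = 0 := by
    have h1 := p.ord_nonneg (p.integralClosure_mem hA b)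
    rw [← p.ord_pos_iff hb0] at hb
    omega
  have hc0 : (c : K) ≠ 0 := hc ▸ mul_ne_zero hb0 h0
  have hco : p.ord (c : K) = 1 := by rw [hc, ord_mul p hb0 h0, hbo, hπ, zero_add]
  exact ⟨c, (p.mem_centre_integralClosure_iff hA c).2 ((p.ord_pos_iff hc0).1 (by omega)), hc0, hco⟩

theorem centre_integralClosure_isMaximal : (p.centre (integralClosure A K)).IsMaximal := by
  have := p.centre_integralClosure_isPrime hA
  refine Ideal.IsPrime.isMaximal this fun h => ?_
  obtain ⟨c, hc, hc0, -⟩ := p.exists_mem_centre_ord_eq_one hA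
  rw [h, Ideal.mem_bot] at hc
  exact hc0 (by rw [hc]; rfl)

/-- Writing elements of the valuation ring as c/b with b outside the maximal centre, and inverting b
modulo the centre, shows that the residue field is a quotient of the integral closure by a nonzero
ideal. -/
theorem finite_residueField [Ring.HasFiniteQuotients (integralClosure A K)] :
    Finite p.ResidueField := by
  let φ : integralClosure A K →+* p.ring :=
    (algebraMap (integralClosure A K) K).codRestrict p.ring.toSubring (p.integralClosure_mem hA)
  let ψ : integralClosure A K →+* p.ResidueField := (IsLocalRing.residue p.ring).comp φ
  have hker : RingHom.ker ψ = p.centre (integralClosure A K) := by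
    ext z
    rw [RingHom.mem_ker, p.mem_centre_integralClosure_iff hA]
    exact (IsLocalRing.residue_eq_zero_iff _).trans (p.mem_maximalIdeal_iff (φ z))
  have hmax : (RingHom.ker ψ).IsMaximal := hker ▸ p.centre_integralClosure_isMaximal hA
  have hsurj : Function.Surjective ψ := by
    intro t
    obtain ⟨z, rfl⟩ := IsLocalRing.residue_surjective t
    obtain ⟨b, c, hb, hc⟩ := p.ring.exists_mul_eq hA z.2
    have hb' : b ∉ RingHom.ker ψ := by rwa [hker, p.mem_centre_integralClosure_iff hA]
    obtain ⟨b', i, hi, hbi⟩ := hmax.exists_inv hb'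
    have h1 : ψ b' * ψ b = 1 := by
      rw [← map_mul, ← map_one ψ, ← hbi, map_add, hi, add_zero]
    have h2 : ψ c = ψ b * IsLocalRing.residue p.ring z := by
      have : φ c = φ b * z := Subtype.ext hc
      change IsLocalRing.residue p.ring (φ c) = IsLocalRing.residue p.ring (φ b) * _
      rw [this, map_mul]
    exact ⟨b' * c, by rw [map_mul, h2, ← mul_assoc, h1, one_mul]⟩
  have hbot : RingHom.ker ψ ≠ ⊥ := by
    intro h
    obtain ⟨c, hc, hc0, -⟩ := p.exists_mem_centre_ord_eq_one hA
    rw [← hker, h, Ideal.mem_bot] at hc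
    exact hc0 (by rw [hc]; rfl)
  have := Ring.HasFiniteQuotients.finiteQuotient hbot
  exact Finite.of_equiv _ (RingHom.quotientKerEquivOfSurjective hsurj).toEquiv

variable {L : Type*} [Field L] [Algebra K L] [Algebra A L] [IsScalarTower A K L] {p}

omit [IsDomain A] [IsPrincipalIdealRing A] [FaithfulSMul A K] [Algebra.IsAlgebraic A K] in
theorem Above.algebraMap_mem (P : p.Above L) (z : A) : algebraMap A L z ∈ P.1.ring := by
  rw [IsScalarTower.algebraMap_apply A K L, P.mem_iff]
  exact hA z

variable (p) (A) (L) in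
/-- The extension to the integral closure in `L` of the centre of `p`. -/
def extendedCentre : Ideal (integralClosure A L) :=
  Ideal.span {z | ∃ w : integralClosure A K,
    w ∈ p.centre (integralClosure A K) ∧ algebraMap K L (w : K) = (z : L)}

omit [IsDomain A] [IsPrincipalIdealRing A] [FaithfulSMul A K] [Algebra.IsAlgebraic A K] hA in
theorem exists_extended {w : integralClosure A K} (hw : w ∈ p.centre (integralClosure A K)) :
    ∃ z ∈ p.extendedCentre A L, (z : L) = algebraMap K L w :=
  ⟨⟨algebraMap K L w, ((mem_integralClosure_iff _ _).1 w.2).algebraMap⟩,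
    Ideal.subset_span ⟨w, hw, rfl⟩, rfl⟩

variable [FaithfulSMul A L] [Algebra.IsAlgebraic A L] [IsDedekindDomain (integralClosure A L)]

/-- The primes of the integral closure over the centre of `p` are the centres of the places
above `p`. -/
theorem exists_centre_eq (v : IsDedekindDomain.HeightOneSpectrum (integralClosure A L))
    (hv : p.extendedCentre A L ≤ v.asIdeal) :
    ∃ P : p.Above L, P.1.centre (integralClosure A L) = v.asIdeal := by
  have : IsFractionRing (integralClosure A L) L :=
    integralClosure.isFractionRing_of_algebraic
      fun z hz => FaithfulSMul.algebraMap_injective A L (by rw [hz, map_zero])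
  let V : ValuationSubring L := (ofPrime (K := L) v).ring
  have hVv : ∀ z : integralClosure A L, V.valuation (z : L) < 1 ↔ z ∈ v.asIdeal := fun z => by
    rw [← centre_ofPrime (K := L) v]
    exact (mem_centre_iff (ofPrime (K := L) v) (fun z => v.valuation_le_one z) z).symm
  have hVmem : ∀ z : integralClosure A L, (z : L) ∈ V := fun z => v.valuation_le_one z
  have hVO : ∀ z : integralClosure A K, algebraMap K L z ∈ V := fun z =>
    hVmem ⟨algebraMap K L z, ((mem_integralClosure_iff _ _).1 z.2).algebraMap⟩
  have hmax := p.centre_integralClosure_isMaximal hA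
  have hcentre : ∀ z ∈ p.centre (integralClosure A K), V.valuation (algebraMap K L z) < 1 :=
    fun z hz => by
      obtain ⟨t, ht, h⟩ := exists_extended (L := L) hz
      rw [← h, hVv]
      exact hv ht
  -- An element c/b of the ring of `p` stays in V: b is invertible modulo the centre, whose image
  -- lies in the maximal ideal of V, so b is a unit of V.
  have hle : p.ring ≤ V.comap (algebraMap K L) := by
    intro z hz
    obtain ⟨b, c, hb, hc⟩ := p.ring.exists_mul_eq hA hz
    rw [← p.mem_centre_integralClosure_iff hA] at hb
    obtain ⟨b', i, hi, hbi⟩ := hmax.exists_inv hb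
    have hbV : ¬ V.valuation (algebraMap K L b) < 1 := by
      intro hlt
      have h1 : V.valuation (algebraMap K L (b' * b + i : K)) < 1 := by
        rw [map_add, map_mul]
        refine V.valuation.map_add_lt ?_ (hcentre i hi)
        rw [map_mul]
        rw [mul_comm]
        exact mul_lt_one_of_lt_of_le hlt ((V.valuation_le_one_iff _).2 (hVO b'))
      have h2 : (b' * b + i : K) = 1 := congrArg Subtype.val hbi
      rw [h2, map_one, map_one] at h1
      exact lt_irrefl _ h1
    have hb1 : V.valuation (algebraMap K L b) = 1 :=
      le_antisymm ((V.valuation_le_one_iff _).2 (hVO b)) (not_lt.1 hbV)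
    rw [ValuationSubring.mem_comap, ← V.valuation_le_one_iff]
    have h3 := (V.valuation_le_one_iff _).2 (hVO c)
    rwa [hc, map_mul, map_mul, hb1, one_mul] at h3
  have htop : V.comap (algebraMap K L) ≠ ⊤ := by
    intro h
    obtain ⟨c, hc, hc0, -⟩ := p.exists_mem_centre_ord_eq_one hA
    have h1 : (c : K)⁻¹ ∈ V.comap (algebraMap K L) := h ▸ ValuationSubring.mem_top _
    rw [ValuationSubring.mem_comap, ← V.valuation_le_one_iff] at h1
    have h2 : V.valuation (algebraMap K L ((c : K)⁻¹ * c)) < 1 := by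
      rw [map_mul, map_mul]
      rw [mul_comm]
      exact mul_lt_one_of_lt_of_le (hcentre c hc) h1
    rw [inv_mul_cancel₀ hc0, map_one, map_one] at h2
    exact lt_irrefl _ h2
  exact ⟨⟨ofPrime v, (p.ring_eq_of_le hle htop).symm⟩, centre_ofPrime v⟩

variable [FiniteDimensional K L] [Algebra.IsSeparable K L]
  [IsFractionRing (integralClosure A L) L]

namespace Above

variable (P : p.Above L)

omit [IsDomain A] [IsPrincipalIdealRing A] [FaithfulSMul A K] [Algebra.IsAlgebraic A K]
  [FiniteDimensional K L] [Algebra.IsSeparable K L] [FaithfulSMul A L] [Algebra.IsAlgebraic A L] in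
theorem exists_heightOneSpectrum_eq :
    ∃ v : IsDedekindDomain.HeightOneSpectrum (integralClosure A L),
      ofPrime v = P.1 ∧ v.asIdeal = P.1.centre (integralClosure A L) :=
  exists_heightOneSpectrum_eq_centre P.1 (P.1.integralClosure_mem (P.algebraMap_mem hA))

omit [IsDomain A] [IsPrincipalIdealRing A] [FaithfulSMul A K] [Algebra.IsAlgebraic A K]
  [FiniteDimensional K L] [Algebra.IsSeparable K L] [FaithfulSMul A L] [Algebra.IsAlgebraic A L] in
theorem prime_centre : Prime (P.1.centre (integralClosure A L)) := by
  obtain ⟨v, -, h⟩ := P.exists_heightOneSpectrum_eq hA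
  exact h ▸ v.prime

omit [IsDomain A] [IsPrincipalIdealRing A] [FaithfulSMul A K] [Algebra.IsAlgebraic A K]
  [FiniteDimensional K L] [Algebra.IsSeparable K L] [FaithfulSMul A L] [Algebra.IsAlgebraic A L] in
theorem isMaximal_centre : (P.1.centre (integralClosure A L)).IsMaximal := by
  obtain ⟨v, -, h⟩ := P.exists_heightOneSpectrum_eq hA
  exact h ▸ v.isMaximal

omit [IsDomain A] [IsPrincipalIdealRing A] [FaithfulSMul A K] [Algebra.IsAlgebraic A K]
  [FiniteDimensional K L] [Algebra.IsSeparable K L] [FaithfulSMul A L] [Algebra.IsAlgebraic A L] in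
theorem centre_injective {P Q : p.Above L}
    (h : P.1.centre (integralClosure A L) = Q.1.centre (integralClosure A L)) : P = Q := by
  obtain ⟨v, hv, hv'⟩ := P.exists_heightOneSpectrum_eq hA
  obtain ⟨w, hw, hw'⟩ := Q.exists_heightOneSpectrum_eq hA
  obtain rfl : v = w := IsDedekindDomain.HeightOneSpectrum.ext (by rw [hv', hw', h])
  exact Subtype.ext (hv.symm.trans hw)

omit [FaithfulSMul A L] [Algebra.IsAlgebraic A L] in
-- Elements of the centre of `p` have order at least 1, and one has order exactly 1; in `L` these
-- orders are multiplied by e, so the smallest order attained on the extended ideal is e.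
theorem pow_centre_dvd_iff (n : ℕ) :
    P.1.centre (integralClosure A L) ^ n ∣ p.extendedCentre A L ↔ n ≤ P.ramificationIdx := by
  obtain ⟨v, hv, hv'⟩ := P.exists_heightOneSpectrum_eq hA
  have key : ∀ z : integralClosure A L, (z : L) ≠ 0 →
      (z ∈ v.asIdeal ^ n ↔ (n : ℤ) ≤ P.1.ord (z : L)) := fun z hz => by
    rw [← Ideal.dvd_span_singleton, ← v.intValuation_le_pow_iff_dvd,
      ← v.valuation_of_algebraMap (K := L), ← val_ofPrime, hv]
    change P.1.val (z : L) ≤ _ ↔ _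
    rw [P.1.val_eq_exp hz, WithZero.exp_le_exp, neg_le_neg_iff]
  rw [← hv', Ideal.dvd_iff_le]
  constructor
  · intro h
    obtain ⟨c, hc, hc0, hco⟩ := p.exists_mem_centre_ord_eq_one hA
    obtain ⟨z, hz, hzc⟩ := exists_extended (L := L) hc
    have h1 := (key z (by rw [hzc]; exact (_root_.map_ne_zero _).2 hc0)).1 (h hz)
    rw [hzc, P.ord_algebraMap, hco, mul_one] at h1
    exact_mod_cast h1
  · intro h
    refine Ideal.span_le.2 ?_
    rintro z ⟨w, hw, hwz⟩
    rcases eq_or_ne (w : K) 0 with h0 | h0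
    · have : z = 0 := Subtype.ext (by rw [← hwz, h0, map_zero]; rfl)
      rw [this]
      exact zero_mem _
    · refine (key z (by rw [← hwz]; exact (_root_.map_ne_zero _).2 h0)).2 ?_
      rw [← hwz, P.ord_algebraMap]
      have h1 : 0 < p.ord (w : K) :=
        (p.ord_pos_iff h0).2 ((p.mem_centre_integralClosure_iff hA w).1 hw)
      have h2 : (n : ℤ) ≤ P.ramificationIdx := by exact_mod_cast h
      nlinarith

omit [FaithfulSMul A L] [Algebra.IsAlgebraic A L] in
theorem emultiplicity_centre :
    emultiplicity (P.1.centre (integralClosure A L)) (p.extendedCentre A L) =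
      P.ramificationIdx := by
  rw [emultiplicity_eq_coe, P.pow_centre_dvd_iff hA, P.pow_centre_dvd_iff hA]
  omega

end Above

/-- The factorisation of the extension of the centre of `p`. -/
theorem extendedCentre_eq_prod [Fintype (p.Above L)] :
    p.extendedCentre A L =
      ∏ P : p.Above L, P.1.centre (integralClosure A L) ^ P.ramificationIdx := by
  let f : p.Above L → Ideal (integralClosure A L) :=
    fun P => P.1.centre (integralClosure A L) ^ P.ramificationIdx
  have hcop : Pairwise (Function.onFun IsRelPrime f) := by
    intro P Q hPQ
    have h1 := P.isMaximal_centre hA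
    have h2 := Q.isMaximal_centre hA
    have h3 : IsCoprime (P.1.centre (integralClosure A L)) (Q.1.centre (integralClosure A L)) :=
      Ideal.isCoprime_of_isMaximal fun h => hPQ (Above.centre_injective hA h)
    exact (h3.pow (m := P.ramificationIdx) (n := Q.ramificationIdx)).isRelPrime
  have hdvd : ∀ P, f P ∣ p.extendedCentre A L := fun P => (P.pow_centre_dvd_iff hA _).2 le_rfl
  obtain ⟨J, hJ⟩ : ∏ P, f P ∣ p.extendedCentre A L :=
    Finset.prod_dvd_of_isRelPrime (fun P _ Q _ h => hcop h) fun P _ => hdvd P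
  -- If the cofactor J were proper, it would lie in a maximal ideal over the centre of `p`, that is,
  -- the centre of some P; this centre would divide the extended ideal e(P) + 1 times.
  suffices J = 1 by
    rw [hJ, this, mul_one]
  by_contra hJ1
  rw [Ideal.one_eq_top] at hJ1
  obtain ⟨M, hM, hJM⟩ := Ideal.exists_le_maximal J hJ1
  have hI0 : p.extendedCentre A L ≠ ⊥ := by
    obtain ⟨c, hc, hc0, -⟩ := p.exists_mem_centre_ord_eq_one hA
    obtain ⟨z, hz, hzc⟩ := exists_extended (L := L) hc
    intro h
    rw [h, Ideal.mem_bot] at hz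
    rw [hz] at hzc
    exact (_root_.map_ne_zero (algebraMap K L)).2 hc0 hzc.symm
  have hIM : p.extendedCentre A L ≤ M := by
    rw [hJ]
    exact Ideal.mul_le_right.trans hJM
  have hM0 : M ≠ ⊥ := fun h => hI0 (le_bot_iff.1 (h ▸ hIM))
  obtain ⟨P, hP⟩ := exists_centre_eq hA ⟨M, hM.isPrime, hM0⟩ hIM
  change _ = M at hP
  have h1 : P.1.centre (integralClosure A L) ^ (P.ramificationIdx + 1) ∣ p.extendedCentre A L := by
    rw [hJ, pow_succ]
    refine mul_dvd_mul (Finset.dvd_prod_of_mem f (Finset.mem_univ P)) ?_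
    rw [Ideal.dvd_iff_le, hP]
    exact hJM
  rw [P.pow_centre_dvd_iff hA] at h1
  omega

/-- Comparing multiplicities at each place R gives e(R) on the left, and m, n or 0 on the right
according as R is `P`, `Q` or neither. Since e(R) > 0, no third place exists. -/
theorem extendedCentre_eq_pow_mul_pow_iff {P Q : p.Above L} (hPQ : P ≠ Q) {m n : ℕ} :
    p.extendedCentre A L =
        P.1.centre (integralClosure A L) ^ m * Q.1.centre (integralClosure A L) ^ n ↔
      (∀ R : p.Above L, R = P ∨ R = Q) ∧ P.ramificationIdx = m ∧ Q.ramificationIdx = n := by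
  classical
  have := Above.finite p L
  have := Fintype.ofFinite (p.Above L)
  have hne : ∀ {R S : p.Above L}, R ≠ S → emultiplicity (R.1.centre (integralClosure A L))
      (S.1.centre (integralClosure A L)) = 0 := fun {R S} h => by
    rw [emultiplicity_eq_zero]
    intro hdvd
    have := R.isMaximal_centre hA (A := A)
    have := S.isMaximal_centre hA (A := A)
    have h1 := (S.isMaximal_centre hA (A := A)).eq_of_le (R.isMaximal_centre hA).ne_top
      (Ideal.dvd_iff_le.1 hdvd)
    exact h (Above.centre_injective hA h1).symm
  have hself : ∀ R : p.Above L, emultiplicity (R.1.centre (integralClosure A L))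
      (R.1.centre (integralClosure A L)) = 1 := fun R => by
    have := emultiplicity_pow_self_of_prime (R.prime_centre hA (A := A)) 1
    simpa using this
  constructor
  · intro h
    have hR : ∀ R : p.Above L, (R.ramificationIdx : ℕ∞) =
        m * emultiplicity (R.1.centre (integralClosure A L)) (P.1.centre (integralClosure A L)) +
        n * emultiplicity (R.1.centre (integralClosure A L)) (Q.1.centre (integralClosure A L)) :=
      fun R => by
        rw [← R.emultiplicity_centre hA (A := A), h, emultiplicity_mul (R.prime_centre hA),
          emultiplicity_pow (R.prime_centre hA), emultiplicity_pow (R.prime_centre hA)]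
    refine ⟨fun R => ?_, ?_, ?_⟩
    · by_contra! hRR
      have h1 := hR R
      rw [hne hRR.1, hne hRR.2, mul_zero, mul_zero, add_zero] at h1
      have h2 : R.ramificationIdx = 0 := by exact_mod_cast h1
      exact R.ramificationIdx_pos.ne' h2
    · have h1 := hR P
      rw [hself, hne hPQ, mul_zero, mul_one, add_zero] at h1
      exact_mod_cast h1
    · have h1 := hR Q
      rw [hself, hne hPQ.symm, mul_zero, mul_one, zero_add] at h1
      exact_mod_cast h1
  · rintro ⟨h, rfl, rfl⟩
    have huniv : (Finset.univ : Finset (p.Above L)) = {P, Q} := by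
      ext R
      simpa using h R
    rw [extendedCentre_eq_prod hA, huniv, Finset.prod_pair hPQ]

theorem extendedCentre_eq_pow_iff {P : p.Above L} {m : ℕ} :
    p.extendedCentre A L = P.1.centre (integralClosure A L) ^ m ↔
      (∀ R : p.Above L, R = P) ∧ P.ramificationIdx = m := by
  classical
  have := Above.finite p L
  have := Fintype.ofFinite (p.Above L)
  constructor
  · intro h
    refine ⟨fun R => ?_, ?_⟩
    · have h1 : R.1.centre (integralClosure A L) ∣ P.1.centre (integralClosure A L) ^ m := by
        rw [← h, ← pow_one (R.1.centre _), R.pow_centre_dvd_iff hA]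
        exact R.ramificationIdx_pos
      have h2 := (P.isMaximal_centre hA (A := A)).eq_of_le (R.isMaximal_centre hA).ne_top
        (Ideal.dvd_iff_le.1 ((R.prime_centre hA).dvd_of_dvd_pow h1))
      exact (Above.centre_injective hA h2).symm
    · have h1 := P.emultiplicity_centre hA (A := A)
      rw [h, emultiplicity_pow_self_of_prime (P.prime_centre hA)] at h1
      exact_mod_cast h1.symm
  · rintro ⟨h, rfl⟩
    have huniv : (Finset.univ : Finset (p.Above L)) = {P} := by
      ext R
      simpa using h R
    rw [extendedCentre_eq_prod hA, huniv, Finset.prod_singleton]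

end Place

end

/-! ### Function fields over a finite field. -/

noncomputable section

section FunctionField

open scoped algebraAdjoinAdjoin

variable {k K : Type*} [Field k] [Field K] [Algebra k K]

instance (x : K) : IsPrincipalIdealRing (Algebra.adjoin k {x}) := by
  rw [Algebra.adjoin_singleton_eq_range_aeval]
  exact IsPrincipalIdealRing.of_surjective (aeval x : k[X] →ₐ[k] K).rangeRestrict
    (AlgHom.rangeRestrict_surjective _)

/-- A nonzero element of `I` is a polynomial relation for the class of `x`, so the quotient is
finite-dimensional over the finite field `k`. -/
instance [Finite k] (x : K) : Ring.HasFiniteQuotients (Algebra.adjoin k {x}) where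
  finiteQuotient {I} hI := by
    let A := Algebra.adjoin k {x}
    let ξ : A := ⟨x, Algebra.self_mem_adjoin_singleton k x⟩
    obtain ⟨f, hf, hf0⟩ := Submodule.exists_mem_ne_zero_of_ne_bot hI
    have hA : ∀ z : A, ∃ g : k[X], aeval ξ g = z := fun z => by
      have hz : (z : K) ∈ Algebra.adjoin k {x} := z.2
      rw [Algebra.adjoin_singleton_eq_range_aeval] at hz
      obtain ⟨g, hg⟩ := hz
      exact ⟨g, Subtype.ext ((aeval_algHom_apply A.val ξ g).symm.trans hg)⟩
    have htop : Algebra.adjoin k {Ideal.Quotient.mkₐ k I ξ} = ⊤ := by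
      refine (Algebra.adjoin_singleton_eq_range_aeval k _).trans
        ((AlgHom.range_eq_top _).2 fun w => ?_)
      obtain ⟨z, rfl⟩ := Ideal.Quotient.mkₐ_surjective k I w
      obtain ⟨g, rfl⟩ := hA z
      exact ⟨g, aeval_algHom_apply _ _ _⟩
    obtain ⟨g, hg⟩ := hA f
    have hint : IsIntegral k (Ideal.Quotient.mkₐ k I ξ) := by
      rw [← isAlgebraic_iff_isIntegral]
      refine ⟨g, by rintro rfl; exact hf0 (by rw [← hg, map_zero]), ?_⟩
      rw [aeval_algHom_apply, hg]
      exact Ideal.Quotient.eq_zero_iff_mem.2 hf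
    have hfg := hint.fg_adjoin_singleton
    rw [htop] at hfg
    have : Module.Finite k (A ⧸ I) := ⟨hfg⟩
    exact Module.finite_of_finite k

theorem IsFunctionField.isTranscendenceBasis (hK : IsFunctionField k K) {x : K}
    (hx : Transcendental k x) : IsTranscendenceBasis k (fun _ : Unit => x) := by
  obtain ⟨t, -, hfin⟩ := hK
  have h1 : Algebra.IsAlgebraic k⟮t⟯ K := inferInstance
  have h2 : Algebra.IsAlgebraic (Algebra.adjoin k {t}) K :=
    Algebra.IsAlgebraic.trans _ k⟮t⟯ _
  refine AlgebraicIndependent.isTranscendenceBasis_of_lift_trdeg_le_of_finite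
    ((algebraicIndependent_singleton_iff ()).2 hx) ?_
  have h3 := Algebra.IsAlgebraic.trdeg_le_cardinalMk k ({t} : Set K)
  simpa using h3

theorem IsFunctionField.isAlgebraic_adjoin (hK : IsFunctionField k K) {x : K}
    (hx : Transcendental k x) : Algebra.IsAlgebraic (Algebra.adjoin k {x}) K := by
  have := (hK.isTranscendenceBasis hx).isAlgebraic
  rwa [Set.range_const] at this

theorem IsFunctionField.essFiniteType (hK : IsFunctionField k K) : Algebra.EssFiniteType k K := by
  obtain ⟨t, -, hfin⟩ := hK
  have : Algebra.EssFiniteType k k⟮t⟯ :=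
    essFiniteType_iff.2 (fg_adjoin_of_finite (Set.finite_singleton t))
  exact Algebra.EssFiniteType.comp k k⟮t⟯ K

/-- Finite fields are perfect, so a separating transcendence basis exists; transcendence degree one
makes it a single element. -/
theorem IsFunctionField.exists_isSeparable [Finite k] (hK : IsFunctionField k K) :
    ∃ x : K, Transcendental k x ∧ Algebra.IsSeparable k⟮x⟯ K := by
  have := hK.essFiniteType
  obtain ⟨s, hs, hsep⟩ := exists_isTranscendenceBasis_and_isSeparable_of_perfectField
    (k := k) (K := K)
  obtain ⟨t, ht, -⟩ := id hK
  have hcard := hs.lift_cardinalMk_eq (hK.isTranscendenceBasis ht)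
  obtain ⟨x, rfl⟩ : ∃ x, s = {x} := by
    rw [← Finset.card_eq_one]
    simpa using hcard
  refine ⟨x, ?_, ?_⟩
  · exact (algebraicIndependent_singleton_iff ⟨x, Finset.mem_singleton_self x⟩).1 hs.1
  · rwa [Finset.coe_singleton] at hsep

variable [Finite k] (p : Place K)

/-- A nonzero constant is a root of unity, hence has order 0. -/
theorem Place.algebraMap_mem (c : k) : algebraMap k K c ∈ p.ring := by
  rcases eq_or_ne c 0 with rfl | hc
  · rw [map_zero]
    exact zero_mem _
  refine p.mem_of_ord_nonneg (le_of_eq ?_)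
  have h1 := congrArg (fun z => p.ord (algebraMap k K z)) (pow_natCard_sub_one hc)
  simp only [map_pow, map_one, p.ord_pow, p.ord_one] at h1
  have h2 := Finite.one_lt_card (α := k)
  exact ((mul_eq_zero.1 h1).resolve_left (by omega)).symm

theorem Place.adjoin_mem {x : K} (hx : x ∈ p.ring) (z : Algebra.adjoin k {x}) :
    algebraMap (Algebra.adjoin k {x}) K z ∈ p.ring := by
  obtain ⟨z, hz⟩ := z
  change z ∈ p.ring
  induction hz using Algebra.adjoin_induction with
  | mem y hy => rwa [Set.mem_singleton_iff.1 hy]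
  | algebraMap c => exact p.algebraMap_mem c
  | add y z _ _ h1 h2 => exact add_mem h1 h2
  | mul y z _ _ h1 h2 => exact mul_mem h1 h2

theorem Place.exists_mem_isSeparable (hK : IsFunctionField k K) :
    ∃ x ∈ p.ring, Transcendental k x ∧ Algebra.IsSeparable k⟮x⟯ K := by
  obtain ⟨x, hx, hsep⟩ := hK.exists_isSeparable
  rcases p.ring.mem_or_inv_mem x with h | h
  · exact ⟨x, h, hx, hsep⟩
  · refine ⟨x⁻¹, h, fun h1 => hx (by simpa using h1.inv), ?_⟩
    have : k⟮x⁻¹⟯ = k⟮x⟯ := by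
      apply le_antisymm
      · rw [adjoin_simple_le_iff]
        exact inv_mem (mem_adjoin_simple_self k x)
      · rw [adjoin_simple_le_iff]
        simpa using inv_mem (mem_adjoin_simple_self k x⁻¹)
    rwa [this]

variable {p}

/-- For a separating `x` integral at `p`, the integral closure of k[x] is a finite k[x]-module and
inherits finite quotients. -/
theorem Place.finite_residueField_of_isFunctionField (hK : IsFunctionField k K) :
    Finite p.ResidueField := by
  obtain ⟨x, hxp, hx, hsep⟩ := p.exists_mem_isSeparable hK
  have := hK.essFiniteType
  have := hK.isAlgebraic_adjoin hx
  have : Algebra.EssFiniteType k⟮x⟯ K := Algebra.EssFiniteType.of_comp k k⟮x⟯ K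
  have : FiniteDimensional k⟮x⟯ K := Algebra.finite_of_essFiniteType_of_isAlgebraic
  have : Module.Finite (Algebra.adjoin k {x}) (integralClosure (Algebra.adjoin k {x}) K) :=
    IsIntegralClosure.finite _ k⟮x⟯ K _
  have := Ring.HasFiniteQuotients.of_module_finite (Algebra.adjoin k {x})
    (integralClosure (Algebra.adjoin k {x}) K)
  exact p.finite_residueField (p.adjoin_mem (k := k) hxp)

/-- A separating element, or its inverse, is integral at `p`; `L` is then finite separable over
k(x), and the integral closure of k[x] is Dedekind. -/
theorem Place.exists_isFiniteFor (hK : IsFunctionField k K) (L : Type*) [Field L] [Algebra K L]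
    [FiniteDimensional K L] [Algebra.IsSeparable K L] : ∃ x : K, p.IsFiniteFor k x L := by
  obtain ⟨x, hxp, hx, hsep⟩ := p.exists_mem_isSeparable hK
  have := hK.essFiniteType
  have : Algebra.EssFiniteType k⟮x⟯ K := Algebra.EssFiniteType.of_comp k k⟮x⟯ K
  have : FiniteDimensional k⟮x⟯ K := Algebra.finite_of_essFiniteType_of_isAlgebraic
  have : FiniteDimensional k⟮x⟯ L := Module.Finite.trans K L
  have : Algebra.IsSeparable k⟮x⟯ L := Algebra.IsSeparable.trans k⟮x⟯ K L
  have : IsScalarTower (Algebra.adjoin k {x}) k⟮x⟯ L := IsScalarTower.of_algebraMap_eq fun _ => rfl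
  exact ⟨x, hx, hxp, integralClosure.isDedekindDomain _ k⟮x⟯ L⟩

namespace Place

variable {L : Type*} [Field L] [Algebra K L] [FiniteDimensional K L] [Algebra.IsSeparable K L]
  {x : K} (hK : IsFunctionField k K) (hx : p.IsFiniteFor k x L)
include hK hx

theorem extendedIdeal_eq_pow_mul_pow_iff {P Q : p.Above L} (hPQ : P ≠ Q) {m n : ℕ} :
    p.extendedIdeal k x L = P.primeIdeal k x ^ m * Q.primeIdeal k x ^ n ↔
      (∀ R : p.Above L, R = P ∨ R = Q) ∧ P.ramificationIdx = m ∧ Q.ramificationIdx = n := by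
  obtain ⟨hxt, hxp, hD⟩ := hx
  have := hK.isAlgebraic_adjoin hxt
  have : Algebra.IsAlgebraic (Algebra.adjoin k {x}) L := Algebra.IsAlgebraic.trans _ K _
  have : FaithfulSMul (Algebra.adjoin k {x}) L := inferInstance
  have : IsFractionRing (integralClosure (Algebra.adjoin k {x}) L) L :=
    integralClosure.isFractionRing_of_algebraic fun z hz =>
      FaithfulSMul.algebraMap_injective (Algebra.adjoin k {x}) L (by rw [hz, map_zero])
  exact extendedCentre_eq_pow_mul_pow_iff (p.adjoin_mem (k := k) hxp) hPQ

theorem extendedIdeal_eq_pow_iff {P : p.Above L} {m : ℕ} :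
    p.extendedIdeal k x L = P.primeIdeal k x ^ m ↔
      (∀ R : p.Above L, R = P) ∧ P.ramificationIdx = m := by
  obtain ⟨hxt, hxp, hD⟩ := hx
  have := hK.isAlgebraic_adjoin hxt
  have : Algebra.IsAlgebraic (Algebra.adjoin k {x}) L := Algebra.IsAlgebraic.trans _ K _
  have : FaithfulSMul (Algebra.adjoin k {x}) L := inferInstance
  have : IsFractionRing (integralClosure (Algebra.adjoin k {x}) L) L :=
    integralClosure.isFractionRing_of_algebraic fun z hz =>
      FaithfulSMul.algebraMap_injective (Algebra.adjoin k {x}) L (by rw [hz, map_zero])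
  exact extendedCentre_eq_pow_iff (p.adjoin_mem (k := k) hxp)

end Place

end FunctionField

end

/-! ### Assembling the criteria. -/

noncomputable section

theorem three_ne_zero_of_ringChar_ne {K : Type*} [Field K] (h : ringChar K ≠ 3) : (3 : K) ≠ 0 := by
  intro h3
  have h1 : ringChar K ∣ 3 := ringChar.dvd (by exact_mod_cast h3)
  rcases (Nat.dvd_prime Nat.prime_three).1 h1 with h2 | h2
  · exact CharP.ringChar_ne_one h2
  · exact h h2

namespace Place

theorem three_ne_zero_residueField (k : Type*) {K : Type*} [Field k] [Finite k] [Field K]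
    [Algebra k K] (p : Place K) (h3 : (3 : K) ≠ 0) : (3 : p.ResidueField) ≠ 0 := by
  let φ : k →+* p.ResidueField := (IsLocalRing.residue p.ring).comp
    ((algebraMap k K).codRestrict p.ring.toSubring p.algebraMap_mem)
  have h3k : (3 : k) ≠ 0 := fun h => h3 (by rw [← map_ofNat (algebraMap k K) 3, h, map_zero])
  rw [← map_ofNat φ 3]
  exact (_root_.map_ne_zero φ).2 h3k

theorem HasSignature.mem_iff_mem {K L : Type*} [Field K] [Field L] [Algebra K L] {p : Place K}
    {s t : List (ℕ × ℕ)} (h : p.HasSignature L s) (h' : p.HasSignature L t) (a : ℕ × ℕ) :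
    a ∈ s ↔ a ∈ t := by
  rw [h.mem_iff, h'.mem_iff]

/-- In each pair some (e, f) occurs in one list only. This exclusivity turns one-way implications
into equivalences. -/
theorem HasSignature.exclusive {K : Type*} [Field K] (p : Place K) (L : Type*) [Field L]
    [Algebra K L] :
    (p.HasSignature L [(1, 1), (1, 1), (1, 1)] → ¬ p.HasSignature L [(1, 3)]) ∧
    (p.HasSignature L [(1, 1), (1, 1), (1, 1)] → ¬ p.HasSignature L [(1, 1), (1, 2)]) ∧
    (p.HasSignature L [(1, 1), (1, 1), (1, 1)] → ¬ p.HasSignature L [(2, 1), (1, 1)]) ∧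
    (p.HasSignature L [(1, 3)] → ¬ p.HasSignature L [(1, 1), (1, 2)]) ∧
    (p.HasSignature L [(1, 3)] → ¬ p.HasSignature L [(2, 1), (1, 1)]) ∧
    (p.HasSignature L [(1, 1), (1, 2)] → ¬ p.HasSignature L [(2, 1), (1, 1)]) ∧
    (p.HasSignature L [(3, 1)] → ¬ p.HasSignature L [(1, 1), (1, 1), (1, 1)]) ∧
    (p.HasSignature L [(3, 1)] → ¬ p.HasSignature L [(1, 3)]) ∧
    (p.HasSignature L [(3, 1)] → ¬ p.HasSignature L [(1, 1), (1, 2)]) := by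
  refine ⟨fun h h' => ?_, fun h h' => ?_, fun h h' => ?_, fun h h' => ?_, fun h h' => ?_,
    fun h h' => ?_, fun h h' => ?_, fun h h' => ?_, fun h h' => ?_⟩
  · simpa using h.mem_iff_mem h' (1, 3)
  · simpa using h.mem_iff_mem h' (1, 2)
  · simpa using h.mem_iff_mem h' (2, 1)
  · simpa using h.mem_iff_mem h' (1, 3)
  · simpa using h.mem_iff_mem h' (1, 3)
  · simpa using h.mem_iff_mem h' (1, 2)
  · simpa using h.mem_iff_mem h' (3, 1)
  · simpa using h.mem_iff_mem h' (3, 1)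
  · simpa using h.mem_iff_mem h' (3, 1)

variable {K L Ω : Type*} [Field K] [Field L] [Algebra K L] [Field Ω] [Algebra K Ω] [Algebra L Ω]
  [IsScalarTower K L Ω] {p : Place K} {a : K} {y : L} {r : Ω}
  (hy : K⟮y⟯ = ⊤) (hmin : minpoly K y = cubicPoly a) (h3 : (3 : K) ≠ 0)

section Nonneg

variable (ha : a ∈ p.ring)
include hy hmin h3 ha

theorem hasSignature_of_cubicPoly_irreducible (h : Irreducible (cubicPoly (p.reduce a))) :
    p.HasSignature L [(1, 3)] := by
  have := finiteDimensional_of_minpoly_eq_cubicPoly hy hmin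
  have := isSeparable_of_minpoly_eq_cubicPoly hy hmin h3
  refine hasSignature_of_irreducible (finrank_eq_three hy hmin)
    (cubicPoly_monic (⟨a, ha⟩ : p.ring)).1 (z := y) (by rw [hmin, map_cubicPoly]; rfl)
    (cubicPoly_monic _).2 ?_
  rwa [map_cubicPoly, ← p.reduce_of_mem ha]

theorem hasSignature_of_cubicPoly_linear_mul_quadratic
    (h : ∃ (α : p.ResidueField) (Q : p.ResidueField[X]), Irreducible Q ∧ Q.natDegree = 2 ∧
      cubicPoly (p.reduce a) = (X - C α) * Q) : p.HasSignature L [(1, 1), (1, 2)] := by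
  have := finiteDimensional_of_minpoly_eq_cubicPoly hy hmin
  have := isSeparable_of_minpoly_eq_cubicPoly hy hmin h3
  obtain ⟨α, Q, hQ, hQ2, h⟩ := h
  refine hasSignature_of_linear_mul_quadratic (finrank_eq_three hy hmin)
    (cubicPoly_monic (⟨a, ha⟩ : p.ring)).1 (z := y) (by rw [hmin, map_cubicPoly]; rfl) hQ hQ2
    (α := α) ?_
  rwa [map_cubicPoly, ← p.reduce_of_mem ha]

theorem hasSignature_of_cubicPoly_distinct
    (h : ∃ α β γ : p.ResidueField, α ≠ β ∧ α ≠ γ ∧ β ≠ γ ∧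
      cubicPoly (p.reduce a) = (X - C α) * (X - C β) * (X - C γ)) :
    p.HasSignature L [(1, 1), (1, 1), (1, 1)] := by
  have := finiteDimensional_of_minpoly_eq_cubicPoly hy hmin
  have := isSeparable_of_minpoly_eq_cubicPoly hy hmin h3
  obtain ⟨α, β, γ, h1, h2, h3, h⟩ := h
  refine hasSignature_of_distinct (finrank_eq_three hy hmin)
    (cubicPoly_monic (⟨a, ha⟩ : p.ring)).1 (z := y) (by rw [hmin, map_cubicPoly]; rfl) h1 h2 h3 ?_
  rwa [map_cubicPoly, ← p.reduce_of_mem ha]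

variable (h3p : (3 : p.ResidueField) ≠ 0)
include h3p

theorem hasSignature_of_cubicPoly_double
    (h : ∃ α β : p.ResidueField, cubicPoly (p.reduce a) = (X - C α) * (X - C β) ^ 2) :
    p.HasSignature L [(1, 1), (1, 1), (1, 1)] ∨ p.HasSignature L [(1, 1), (1, 2)] ∨
      p.HasSignature L [(2, 1), (1, 1)] := by
  have := finiteDimensional_of_minpoly_eq_cubicPoly hy hmin
  have := isSeparable_of_minpoly_eq_cubicPoly hy hmin h3
  obtain ⟨α, β, h⟩ := h
  refine hasSignature_of_double (finrank_eq_three hy hmin)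
    (cubicPoly_monic (⟨a, ha⟩ : p.ring)).1 (z := y) (by rw [hmin, map_cubicPoly]; rfl)
    (double_root_relations h3p h).2.2 ?_
  rwa [map_cubicPoly, ← p.reduce_of_mem ha]

omit ha h3p in
-- The element r lies in L(r), which is Galois over `K`; separability is needed to use ∑ e f = 2 in
-- K(r).
theorem isSeparable_adjoin_resolvent
    (hr : r ^ 2 + 3 * algebraMap K Ω a * r + (-27 + 9 * algebraMap K Ω a ^ 2) = 0) :
    Algebra.IsSeparable K K⟮r⟯ := by
  have := isGalois_adjoin_resolvent hy hmin hr h3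
  let f : L⟮r⟯ →ₐ[K] Ω := L⟮r⟯.val.restrictScalars K
  have hf : f (AdjoinSimple.gen L r) = r := rfl
  have hsep := Algebra.IsSeparable.isSeparable K (AdjoinSimple.gen L r)
  rw [isSeparable_adjoin_simple_iff_isSeparable, ← hf]
  exact hsep.map f f.injective

variable (hr : r ^ 2 + 3 * algebraMap K Ω a * r + (-27 + 9 * algebraMap K Ω a ^ 2) = 0)
include hr

/-- The signature of `p` when the cubic has a double root modulo `p`, according to the resolvent. -/
theorem hasSignature_iff_of_cubicPoly_double
    (h : ∃ α β : p.ResidueField, cubicPoly (p.reduce a) = (X - C α) * (X - C β) ^ 2) :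
    (p.HasSignature L [(1, 1), (1, 1), (1, 1)] ↔ r ∈ Set.range (algebraMap K Ω) ∨
      (r ∉ Set.range (algebraMap K Ω) ∧ p.IsCompletelySplit K⟮r⟯)) ∧
    (p.HasSignature L [(1, 1), (1, 2)] ↔ r ∉ Set.range (algebraMap K Ω) ∧ p.IsInert K⟮r⟯) ∧
    (p.HasSignature L [(2, 1), (1, 1)] ↔ r ∉ Set.range (algebraMap K Ω) ∧ p.IsRamified K⟮r⟯) := by
  have := finiteDimensional_of_minpoly_eq_cubicPoly hy hmin
  have hd := hasSignature_of_cubicPoly_double hy hmin h3 ha h3p h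
  by_cases hrK : r ∈ Set.range (algebraMap K Ω)
  · have := isGalois_of_mem_range hy hmin hr h3 hrK
    have h12 : ¬ p.HasSignature L [(1, 1), (1, 2)] := not_hasSignature_of_isGalois (by simp)
    have h21 : ¬ p.HasSignature L [(2, 1), (1, 1)] := not_hasSignature_of_isGalois (by simp)
    exact ⟨iff_of_true ((hd.resolve_right (not_or_intro h12 h21))) (Or.inl hrK),
      iff_of_false h12 fun h' => h'.1 hrK, iff_of_false h21 fun h' => h'.1 hrK⟩
  · have hM := finrank_resolvent_eq_two hr hrK
    have : FiniteDimensional K K⟮r⟯ := Module.finite_of_finrank_pos (by omega)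
    have := isSeparable_adjoin_resolvent hy hmin h3 hr
    obtain ⟨α, β, h⟩ := h
    obtain ⟨hin, hram, -⟩ := resolvent_decomposition (p := p) hy hmin h3 hr hrK
    have hsp := isCompletelySplit_resolvent_of_double hy hmin h3 hr hrK ha h3p h
    have e1 := not_isInert_of_isCompletelySplit (p := p) hM
    have e2 := not_isRamified_of_isCompletelySplit (p := p) hM
    have e3 := not_isRamified_of_isInert (p := p) hM
    -- The three possible signatures imply respectively split, inert and ramified in K(r). As these
    -- behaviours exclude one another, each implication reverses.
    tauto

omit hr h3p in
theorem hasSignature_cases_of_mem :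
    Irreducible (cubicPoly (p.reduce a)) ∧ p.HasSignature L [(1, 3)] ∨
    (∃ (α : p.ResidueField) (Q : p.ResidueField[X]), Irreducible Q ∧ Q.natDegree = 2 ∧
      cubicPoly (p.reduce a) = (X - C α) * Q) ∧ p.HasSignature L [(1, 1), (1, 2)] ∨
    (∃ α β γ : p.ResidueField, α ≠ β ∧ α ≠ γ ∧ β ≠ γ ∧
      cubicPoly (p.reduce a) = (X - C α) * (X - C β) * (X - C γ)) ∧
      p.HasSignature L [(1, 1), (1, 1), (1, 1)] ∨
    (∃ α β : p.ResidueField, cubicPoly (p.reduce a) = (X - C α) * (X - C β) ^ 2) :=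
  (cubicPoly_factorisation (p.reduce a)).imp
    (fun h => ⟨h, hasSignature_of_cubicPoly_irreducible hy hmin h3 ha h⟩) <|
    Or.imp (fun h => ⟨h, hasSignature_of_cubicPoly_linear_mul_quadratic hy hmin h3 ha h⟩) <|
    Or.imp_left fun h => ⟨h, hasSignature_of_cubicPoly_distinct hy hmin h3 ha h⟩

/-- The signature of `p` in terms of the cubic modulo `p`, when `a` is integral at `p`. -/
theorem hasSignature_iff_of_mem :
    (p.HasSignature L [(1, 1), (1, 1), (1, 1)] ↔
      (∃ α β γ : p.ResidueField, α ≠ β ∧ α ≠ γ ∧ β ≠ γ ∧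
        cubicPoly (p.reduce a) = (X - C α) * (X - C β) * (X - C γ)) ∨
      ((∃ α β : p.ResidueField, cubicPoly (p.reduce a) = (X - C α) * (X - C β) ^ 2) ∧
        (r ∈ Set.range (algebraMap K Ω) ∨
          (r ∉ Set.range (algebraMap K Ω) ∧ p.IsCompletelySplit K⟮r⟯)))) ∧
    (p.HasSignature L [(1, 3)] ↔ Irreducible (cubicPoly (p.reduce a))) ∧
    (p.HasSignature L [(1, 1), (1, 2)] ↔
      (∃ (α : p.ResidueField) (Q : p.ResidueField[X]), Irreducible Q ∧ Q.natDegree = 2 ∧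
        cubicPoly (p.reduce a) = (X - C α) * Q) ∨
      (r ∉ Set.range (algebraMap K Ω) ∧
        (∃ α β : p.ResidueField, cubicPoly (p.reduce a) = (X - C α) * (X - C β) ^ 2) ∧
        p.IsInert K⟮r⟯)) ∧
    (p.HasSignature L [(2, 1), (1, 1)] ↔ r ∉ Set.range (algebraMap K Ω) ∧
      (∃ α β : p.ResidueField, cubicPoly (p.reduce a) = (X - C α) * (X - C β) ^ 2) ∧
      p.IsRamified K⟮r⟯) := by
  have c1 := hasSignature_cases_of_mem hy hmin h3 ha
  have c2 := hasSignature_iff_of_cubicPoly_double hy hmin h3 ha h3p hr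
  have c3 := hasSignature_of_cubicPoly_irreducible hy hmin h3 ha
  have c4 := hasSignature_of_cubicPoly_linear_mul_quadratic hy hmin h3 ha
  have c5 := hasSignature_of_cubicPoly_distinct hy hmin h3 ha
  have c6 := hasSignature_of_cubicPoly_double hy hmin h3 ha h3p
  obtain ⟨e1, e2, e3, e4, e5, e6, -⟩ := HasSignature.exclusive p L
  generalize p.HasSignature L [(1, 1), (1, 1), (1, 1)] = S111 at *
  generalize p.HasSignature L [(1, 3)] = S13 at *
  generalize p.HasSignature L [(1, 1), (1, 2)] = S12 at *
  generalize p.HasSignature L [(2, 1), (1, 1)] = S21 at *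
  generalize Irreducible (cubicPoly (p.reduce a)) = I at *
  generalize (∃ (α : p.ResidueField) (Q : p.ResidueField[X]), Irreducible Q ∧ Q.natDegree = 2 ∧
        cubicPoly (p.reduce a) = (X - C α) * Q) = Q at *
  generalize (∃ α β γ : p.ResidueField, α ≠ β ∧ α ≠ γ ∧ β ≠ γ ∧
        cubicPoly (p.reduce a) = (X - C α) * (X - C β) * (X - C γ)) = D at *
  generalize (∃ α β : p.ResidueField, cubicPoly (p.reduce a) = (X - C α) * (X - C β) ^ 2) = E at *
  generalize (r ∈ Set.range (algebraMap K Ω)) = R at *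
  generalize p.IsCompletelySplit K⟮r⟯ = T1 at *
  generalize p.IsInert K⟮r⟯ = T2 at *
  generalize p.IsRamified K⟮r⟯ = T3 at *
  clear hy hmin h3 ha h3p hr
  grind

end Nonneg

section Pairs

variable (hr : r ^ 2 + 3 * algebraMap K Ω a * r + (-27 + 9 * algebraMap K Ω a ^ 2) = 0)
  {P₁ P₂ : p.Above L} (hne : P₁ ≠ P₂) (hall : ∀ R, R = P₁ ∨ R = P₂)
include hy hmin h3 hr hne hall

theorem resolvent_of_pair_unramified (h1 : P₁.ramificationIdx = 1) (h2 : P₂.ramificationIdx = 1) :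
    r ∉ Set.range (algebraMap K Ω) ∧
      ((P₁.inertiaDeg = 1 ∧ P₁.1.IsInert L⟮r⟯ ∧
          P₂.inertiaDeg = 2 ∧ P₂.1.IsCompletelySplit L⟮r⟯) ∨
        (P₂.inertiaDeg = 1 ∧ P₂.1.IsInert L⟮r⟯ ∧
          P₁.inertiaDeg = 2 ∧ P₁.1.IsCompletelySplit L⟮r⟯)) := by
  have := finiteDimensional_of_minpoly_eq_cubicPoly hy hmin
  have := isSeparable_of_minpoly_eq_cubicPoly hy hmin h3
  have hL := finrank_eq_three hy hmin
  have hs := (exists_pair_unramified_iff hL).1 ⟨P₁, P₂, hne, hall, h1, h2⟩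
  have hrK : r ∉ Set.range (algebraMap K Ω) := fun h => by
    have := isGalois_of_mem_range hy hmin hr h3 h
    exact not_hasSignature_of_isGalois (by simp) hs
  refine ⟨hrK, ?_⟩
  obtain ⟨-, -, hd, -⟩ := resolvent_decomposition (p := p) hy hmin h3 hr hrK
  rcases inertiaDeg_of_pair_unramified hL hne hall h1 h2 with ⟨f1, f2⟩ | ⟨f2, f1⟩
  · obtain ⟨d1, d2⟩ := hd P₁ P₂ f1 f2 h1 h2
    exact Or.inl ⟨f1, d1, f2, d2⟩
  · obtain ⟨d1, d2⟩ := hd P₂ P₁ f2 f1 h2 h1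
    exact Or.inr ⟨f2, d1, f1, d2⟩

theorem resolvent_of_pair_ramified (h1 : P₁.ramificationIdx = 2) (h2 : P₂.ramificationIdx = 1) :
    P₁.inertiaDeg = 1 ∧ P₂.inertiaDeg = 1 ∧
      P₁.1.IsCompletelySplit L⟮r⟯ ∧ P₂.1.IsRamified L⟮r⟯ := by
  have := finiteDimensional_of_minpoly_eq_cubicPoly hy hmin
  have := isSeparable_of_minpoly_eq_cubicPoly hy hmin h3
  have hL := finrank_eq_three hy hmin
  have hs := (exists_pair_ramified_iff hL).1 ⟨P₁, P₂, hne, hall, h1, h2⟩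
  have hrK : r ∉ Set.range (algebraMap K Ω) := fun h => by
    have := isGalois_of_mem_range hy hmin hr h3 h
    exact not_hasSignature_of_isGalois (by simp) hs
  obtain ⟨-, -, -, hd, -⟩ := resolvent_decomposition (p := p) hy hmin h3 hr hrK
  obtain ⟨f1, f2⟩ := inertiaDeg_of_pair_ramified hL hne hall h1 h2
  exact ⟨f1, f2, hd P₁ P₂ f1 f2 h1 h2⟩

end Pairs

include hy hmin h3

/-- The signature of `p` when `a` has a pole at `p`. -/
theorem hasSignature_iff_of_ord_neg [Finite p.ResidueField] (h3p : (3 : p.ResidueField) ≠ 0)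
    (ha : p.ord a < 0) {π : K} (hπ : p.ord π = 1) :
    (p.HasSignature L [(3, 1)] ↔ ¬ 3 ∣ p.ord a) ∧
    (p.HasSignature L [(1, 1), (1, 1), (1, 1)] ↔
      3 ∣ p.ord a ∧ Nat.card p.ResidueField ≡ 1 [MOD 3] ∧
        p.reduce (π ^ (-p.ord a) * a) ^ ((Nat.card p.ResidueField - 1) / 3) = 1) ∧
    (p.HasSignature L [(1, 3)] ↔
      3 ∣ p.ord a ∧ Nat.card p.ResidueField ≡ 1 [MOD 3] ∧
        ∃ ξ : p.ResidueField, IsPrimitiveRoot ξ 3 ∧ ∃ i : ℕ, (i = 1 ∨ i = 2) ∧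
          p.reduce (π ^ (-p.ord a) * a) ^ ((Nat.card p.ResidueField - 1) / 3) = ξ ^ i) ∧
    (p.HasSignature L [(1, 1), (1, 2)] ↔
      3 ∣ p.ord a ∧ Nat.card p.ResidueField ≡ 2 [MOD 3]) := by
  -- The four conditions cover all cases, because the residue field has cardinality 1 or 2 modulo 3;
  -- exclusivity of signatures then yields the converses.
  have key : (¬ 3 ∣ p.ord a → p.HasSignature L [(3, 1)]) ∧
      (3 ∣ p.ord a → Nat.card p.ResidueField ≡ 2 [MOD 3] → p.HasSignature L [(1, 1), (1, 2)]) ∧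
      (3 ∣ p.ord a → Nat.card p.ResidueField ≡ 1 [MOD 3] →
        p.reduce (π ^ (-p.ord a) * a) ^ ((Nat.card p.ResidueField - 1) / 3) = 1 →
        p.HasSignature L [(1, 1), (1, 1), (1, 1)]) ∧
      (3 ∣ p.ord a → Nat.card p.ResidueField ≡ 1 [MOD 3] →
        p.reduce (π ^ (-p.ord a) * a) ^ ((Nat.card p.ResidueField - 1) / 3) ≠ 1 →
        p.HasSignature L [(1, 3)]) :=
    ⟨hasSignature_of_not_dvd_ord hy hmin h3 ha, hasSignature_of_card_eq_two hy hmin h3 h3p ha hπ,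
      hasSignature_of_pow_eq_one hy hmin h3 ha hπ, hasSignature_of_pow_ne_one hy hmin h3 ha hπ⟩
  have hq := card_mod_three h3p
  have hq' : Nat.card p.ResidueField ≡ 1 [MOD 3] → ¬ Nat.card p.ResidueField ≡ 2 [MOD 3] :=
    fun h1 h2 => by simpa [Nat.ModEq] using h1.symm.trans h2
  rw [and_congr_right fun hd => and_congr_right fun h =>
    exists_primitiveRoot_iff (exists_minpoly_of_dvd_ord hy hmin ha hd hπ).1 h]
  have excl := HasSignature.exclusive p L
  clear hy hmin h3 h3p hπ
  generalize p.HasSignature L [(1, 1), (1, 1), (1, 1)] = S111 at *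
  generalize p.HasSignature L [(1, 3)] = S13 at *
  generalize p.HasSignature L [(1, 1), (1, 2)] = S12 at *
  generalize p.HasSignature L [(3, 1)] = S31 at *
  generalize (Nat.card p.ResidueField ≡ 1 [MOD 3]) = Q1 at *
  generalize (Nat.card p.ResidueField ≡ 2 [MOD 3]) = Q2 at *
  generalize p.reduce (π ^ (-p.ord a) * a) ^ ((Nat.card p.ResidueField - 1) / 3) = w at *
  generalize (3 ∣ p.ord a) = D at *
  clear ha
  grind

end Place

end

theorem mainTheorem8
    {k K L Ω : Type*} [Field k] [Finite k] [Field K] [Algebra k K] (hK : IsFunctionField k K)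
    (hchar : ringChar K ≠ 3)
    [Field L] [Algebra K L] (a : K) (y : L) (hy : K⟮y⟯ = ⊤) (hmin : minpoly K y = cubicPoly a)
    [Field Ω] [Algebra K Ω] [Algebra L Ω] [IsScalarTower K L Ω] [IsAlgClosure K Ω]
    (r : Ω) (hr : r ^ 2 + 3 * algebraMap K Ω a * r + (-27 + 9 * algebraMap K Ω a ^ 2) = 0)
    (p : Place K) :
    (∃ x : K, p.IsFiniteFor k x L) ∧
    ∀ x : K, p.IsFiniteFor k x L →
      -- the case of nonnegative valuation; `cubicPoly (p.reduce a)` is the polynomial modulo `p`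
      (0 ≤ p.ord a →
        -- completely split
        ((p.IsCompletelySplit L ↔
            (∃ α β γ : p.ResidueField, α ≠ β ∧ α ≠ γ ∧ β ≠ γ ∧
              cubicPoly (p.reduce a) = (X - C α) * (X - C β) * (X - C γ)) ∨
            ((∃ α β : p.ResidueField, cubicPoly (p.reduce a) = (X - C α) * (X - C β) ^ 2) ∧
              (r ∈ Set.range (algebraMap K Ω) ∨
                (r ∉ Set.range (algebraMap K Ω) ∧ p.IsCompletelySplit K⟮r⟯)))) ∧
          (p.IsCompletelySplit L ↔ p.HasSignature L [(1, 1), (1, 1), (1, 1)])) ∧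
        -- inert
        ((p.IsInert L ↔ Irreducible (cubicPoly (p.reduce a))) ∧
          (p.IsInert L ↔ p.HasSignature L [(1, 3)])) ∧
        -- two unramified places
        (((∃ P₁ P₂ : p.Above L, P₁ ≠ P₂ ∧
              p.extendedIdeal k x L = P₁.primeIdeal k x * P₂.primeIdeal k x) ↔
            (∃ (α : p.ResidueField) (Q : p.ResidueField[X]), Irreducible Q ∧ Q.natDegree = 2 ∧
              cubicPoly (p.reduce a) = (X - C α) * Q) ∨
            (r ∉ Set.range (algebraMap K Ω) ∧
              (∃ α β : p.ResidueField, cubicPoly (p.reduce a) = (X - C α) * (X - C β) ^ 2) ∧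
              p.IsInert K⟮r⟯)) ∧
          (∀ P₁ P₂ : p.Above L, P₁ ≠ P₂ →
            p.extendedIdeal k x L = P₁.primeIdeal k x * P₂.primeIdeal k x →
            r ∉ Set.range (algebraMap K Ω) ∧
            ((P₁.inertiaDeg = 1 ∧ P₁.1.IsInert L⟮r⟯ ∧
                P₂.inertiaDeg = 2 ∧ P₂.1.IsCompletelySplit L⟮r⟯) ∨
              (P₂.inertiaDeg = 1 ∧ P₂.1.IsInert L⟮r⟯ ∧
                P₁.inertiaDeg = 2 ∧ P₁.1.IsCompletelySplit L⟮r⟯))) ∧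
          ((∃ P₁ P₂ : p.Above L, P₁ ≠ P₂ ∧
              p.extendedIdeal k x L = P₁.primeIdeal k x * P₂.primeIdeal k x) ↔
            p.HasSignature L [(1, 1), (1, 2)])) ∧
        -- two places, one of them ramified
        (((∃ P₁ P₂ : p.Above L, P₁ ≠ P₂ ∧
              p.extendedIdeal k x L = P₁.primeIdeal k x ^ 2 * P₂.primeIdeal k x) ↔
            r ∉ Set.range (algebraMap K Ω) ∧
              (∃ α β : p.ResidueField, cubicPoly (p.reduce a) = (X - C α) * (X - C β) ^ 2) ∧
              p.IsRamified K⟮r⟯) ∧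
          (∀ P₁ P₂ : p.Above L, P₁ ≠ P₂ →
            p.extendedIdeal k x L = P₁.primeIdeal k x ^ 2 * P₂.primeIdeal k x →
            P₁.inertiaDeg = 1 ∧ P₂.inertiaDeg = 1 ∧
              P₁.1.IsCompletelySplit L⟮r⟯ ∧ P₂.1.IsRamified L⟮r⟯) ∧
          ((∃ P₁ P₂ : p.Above L, P₁ ≠ P₂ ∧
              p.extendedIdeal k x L = P₁.primeIdeal k x ^ 2 * P₂.primeIdeal k x) ↔
            p.HasSignature L [(2, 1), (1, 1)]))) ∧
      -- the case of negative valuation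
      (p.ord a < 0 → ∀ π : K, p.ord π = 1 →
        -- fully ramified
        (((∃ P : p.Above L, p.extendedIdeal k x L = P.primeIdeal k x ^ 3) ↔
            Int.gcd (p.ord a) 3 = 1) ∧
          (p.IsFullyRamified L ↔ Int.gcd (p.ord a) 3 = 1) ∧
          (p.IsFullyRamified L ↔ p.HasSignature L [(3, 1)])) ∧
        -- completely split
        ((p.IsCompletelySplit L ↔
            3 ∣ p.ord a ∧ Nat.card p.ResidueField ≡ 1 [MOD 3] ∧
              p.reduce (π ^ (-p.ord a) * a) ^ ((Nat.card p.ResidueField - 1) / 3) = 1) ∧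
          (p.IsCompletelySplit L ↔ p.HasSignature L [(1, 1), (1, 1), (1, 1)])) ∧
        -- inert
        ((p.IsInert L ↔
            3 ∣ p.ord a ∧ Nat.card p.ResidueField ≡ 1 [MOD 3] ∧
              ∃ ξ : p.ResidueField, IsPrimitiveRoot ξ 3 ∧ ∃ i : ℕ, (i = 1 ∨ i = 2) ∧
                p.reduce (π ^ (-p.ord a) * a) ^ ((Nat.card p.ResidueField - 1) / 3) = ξ ^ i) ∧
          (p.IsInert L ↔ p.HasSignature L [(1, 3)])) ∧
        -- two unramified places
        (((∃ P₁ P₂ : p.Above L, P₁ ≠ P₂ ∧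
              p.extendedIdeal k x L = P₁.primeIdeal k x * P₂.primeIdeal k x) ↔
            3 ∣ p.ord a ∧ Nat.card p.ResidueField ≡ 2 [MOD 3]) ∧
          (∀ P₁ P₂ : p.Above L, P₁ ≠ P₂ →
            p.extendedIdeal k x L = P₁.primeIdeal k x * P₂.primeIdeal k x →
            r ∉ Set.range (algebraMap K Ω) ∧
            ((P₁.inertiaDeg = 1 ∧ P₁.1.IsInert L⟮r⟯ ∧
                P₂.inertiaDeg = 2 ∧ P₂.1.IsCompletelySplit L⟮r⟯) ∨
              (P₂.inertiaDeg = 1 ∧ P₂.1.IsInert L⟮r⟯ ∧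
                P₁.inertiaDeg = 2 ∧ P₁.1.IsCompletelySplit L⟮r⟯))) ∧
          ((∃ P₁ P₂ : p.Above L, P₁ ≠ P₂ ∧
              p.extendedIdeal k x L = P₁.primeIdeal k x * P₂.primeIdeal k x) ↔
            p.HasSignature L [(1, 1), (1, 2)]))) := by
  have h3 := three_ne_zero_of_ringChar_ne hchar
  have h3p := p.three_ne_zero_residueField k h3
  have := finiteDimensional_of_minpoly_eq_cubicPoly hy hmin
  have := isSeparable_of_minpoly_eq_cubicPoly hy hmin h3
  have := p.finite_residueField_of_isFunctionField hK
  have hL := finrank_eq_three hy hmin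
  refine ⟨Place.exists_isFiniteFor hK L, fun x hx => ?_⟩
  have unram : ∀ P₁ P₂ : p.Above L, P₁ ≠ P₂ →
      (p.extendedIdeal k x L = P₁.primeIdeal k x * P₂.primeIdeal k x ↔
        (∀ R, R = P₁ ∨ R = P₂) ∧ P₁.ramificationIdx = 1 ∧ P₂.ramificationIdx = 1) :=
    fun P₁ P₂ hne => by
      simpa using Place.extendedIdeal_eq_pow_mul_pow_iff hK hx hne (m := 1) (n := 1)
  have ram : ∀ P₁ P₂ : p.Above L, P₁ ≠ P₂ →
      (p.extendedIdeal k x L = P₁.primeIdeal k x ^ 2 * P₂.primeIdeal k x ↔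
        (∀ R, R = P₁ ∨ R = P₂) ∧ P₁.ramificationIdx = 2 ∧ P₂.ramificationIdx = 1) :=
    fun P₁ P₂ hne => by
      simpa using Place.extendedIdeal_eq_pow_mul_pow_iff hK hx hne (m := 2) (n := 1)
  have unram_iff : (∃ P₁ P₂ : p.Above L, P₁ ≠ P₂ ∧
      p.extendedIdeal k x L = P₁.primeIdeal k x * P₂.primeIdeal k x) ↔
        p.HasSignature L [(1, 1), (1, 2)] := by
    rw [← Place.exists_pair_unramified_iff hL]
    exact exists₂_congr fun P₁ P₂ => and_congr_right fun hne => unram P₁ P₂ hne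
  have ram_iff : (∃ P₁ P₂ : p.Above L, P₁ ≠ P₂ ∧
      p.extendedIdeal k x L = P₁.primeIdeal k x ^ 2 * P₂.primeIdeal k x) ↔
        p.HasSignature L [(2, 1), (1, 1)] := by
    rw [← Place.exists_pair_ramified_iff hL]
    exact exists₂_congr fun P₁ P₂ => and_congr_right fun hne => ram P₁ P₂ hne
  have cube_iff : (∃ P : p.Above L, p.extendedIdeal k x L = P.primeIdeal k x ^ 3) ↔
      p.HasSignature L [(3, 1)] := by
    rw [← Place.exists_unique_ramificationIdx_eq_three_iff hL]
    exact exists_congr fun P => Place.extendedIdeal_eq_pow_iff hK hx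
  have pairs : ∀ P₁ P₂ : p.Above L, P₁ ≠ P₂ →
      p.extendedIdeal k x L = P₁.primeIdeal k x * P₂.primeIdeal k x →
      r ∉ Set.range (algebraMap K Ω) ∧
      ((P₁.inertiaDeg = 1 ∧ P₁.1.IsInert L⟮r⟯ ∧
          P₂.inertiaDeg = 2 ∧ P₂.1.IsCompletelySplit L⟮r⟯) ∨
        (P₂.inertiaDeg = 1 ∧ P₂.1.IsInert L⟮r⟯ ∧
          P₁.inertiaDeg = 2 ∧ P₁.1.IsCompletelySplit L⟮r⟯)) := fun P₁ P₂ hne h => by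
    obtain ⟨hall, h1, h2⟩ := (unram P₁ P₂ hne).1 h
    exact Place.resolvent_of_pair_unramified hy hmin h3 hr hne hall h1 h2
  have hsplit := Place.isCompletelySplit_iff_hasSignature (p := p) hL
  have hinert := Place.isInert_iff_hasSignature (p := p) hL
  have hfull := Place.isFullyRamified_iff_hasSignature (p := p) hL
  refine ⟨fun ha => ?_, fun ha π hπ => ?_⟩
  · obtain ⟨s1, s2, s3, s4⟩ :=
      Place.hasSignature_iff_of_mem hy hmin h3 (p.mem_of_ord_nonneg ha) h3p hr
    refine ⟨⟨hsplit.trans s1, hsplit⟩, ⟨hinert.trans s2, hinert⟩,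
      ⟨unram_iff.trans s3, pairs, unram_iff⟩, ram_iff.trans s4, fun P₁ P₂ hne h => ?_, ram_iff⟩
    obtain ⟨hall, h1, h2⟩ := (ram P₁ P₂ hne).1 h
    exact Place.resolvent_of_pair_ramified hy hmin h3 hr hne hall h1 h2
  · obtain ⟨s1, s2, s3, s4⟩ := Place.hasSignature_iff_of_ord_neg hy hmin h3 h3p ha hπ
    have hgcd : Int.gcd (p.ord a) 3 = 1 ↔ ¬ 3 ∣ p.ord a := by
      rw [Int.gcd_comm, ← Int.isCoprime_iff_gcd_eq_one]
      exact Int.prime_three.coprime_iff_not_dvd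
    rw [hgcd]
    exact ⟨⟨cube_iff.trans s1, hfull.trans s1, hfull⟩, ⟨hsplit.trans s2, hsplit⟩,
      ⟨hinert.trans s3, hinert⟩, unram_iff.trans s4, pairs, unram_iff⟩
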